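/- For $t>0$ and $x\in\mathbb R$ let $$G_t(x)=\frac1\pi\int_0^\infty e^{-tk^4}\cos(kx)\,dk,\qquad H_t(x)=\int_0^x G_t(y)\,dy,\qquad g=G_1,$$ where primes on $G_t$ denote derivatives in $x$. Let $u_0\in C^\infty([0,\infty))$ be tempered, i.e. $\int_0^\infty |u_0(x)|(1+x)^{-K}dx<\infty$ for some $K\in\mathbb N$ (for instance $u_0$ integrable, or $u_0(x)\to0$ as $x\to\infty$), and assume $$u_0(0)=0,\quad u_0'(0)\neq 0,\quad u_0''(0)=-\tfrac12,\quad u_0'''(0)=0 .$$ With $W(t)=\int_0^tV(s)\,ds$, consider the system of two integral equations for $(V,\beta)$: $$-\int_0^t G''_{t-s}(W(t)-W(s))\,\beta(s)\,ds=\int_0^\infty G_t(W(t)-y)\,u_0(y)\,dy-\frac12\int_0^tG'_{t-s}(W(t)-W(s))\,ds,$$ $$\beta(t)+2\beta(0)H_t(W(t))+2\int_0^tH_{t-s}(W(t)-W(s))\,\beta'(s)\,ds-2V(t)\int_0^tG_{t-s}(W(t)-W(s))\,\beta(s)\,ds$$ $$=2\int_0^\infty G'_t(W(t)-y)\,u_0(y)\,dy-\int_0^tG''_{t-s}(W(t)-W(s))\,ds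 .$$ Fractional power series $$\beta(t)=\beta_0+\sum_{n=4}^\infty\beta_{n/4}t^{n/4},\qquad V(t)=V_0+\sum_{n=1}^\infty V_{n/4}t^{n/4}$$ are called a formal solution if for every $N\in\mathbb N$ all sufficiently long partial sums $\sum_{n\le M}\beta_{n/4}t^{n/4}$, $\sum_{n\le M}V_{n/4}t^{n/4}$ satisfy both equations up to an error $O(t^{N/4})$ as $t\to0^+$ (that is, both equations hold at every order in $t^{1/4}$). Then there is exactly one formal solution of this form. It has $\beta_0=u_0'(0)$ and $V_0=u_0^{(4)}(0)/u_0'(0)$; in particular all the coefficients $\{\beta_{n/4},V_{(n-3)/4}\}_{n\ge4}$ exist and are uniquely determined. Moreover, for every $n\in\mathbb N$ the constant $$C_n:=-\frac{4(n+1)}3\,g(0)\,g''(0)\int_0^1\frac{(1-x)^{n/4}}{x^{3/4}}\,dx=\frac{n+1}{6\sqrt2\,\pi}\,\frac{\Gamma\left(\frac{n+4}4\right)\Gamma\left(\frac14\right)}{\Gamma\left(\frac{n+5}4\right)}$$ satisfies $C_n\neq1$. -/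

import Mathlib

open Real Set Filter Topology MeasureTheory Asymptotics
open scoped ContDiff

noncomputable section

namespace ThinFilm

/-- Green's function `G_t(x) = (1/π) ∫_0^∞ exp(-t k⁴) cos(k x) dk` of `h_t + h_xxxx = 0`. -/
def green (t x : ℝ) : ℝ :=
  (1 / π) * ∫ k in Ioi (0 : ℝ), Real.exp (-t * k ^ 4) * Real.cos (k * x)

/-- `H_t(x) = ∫_0^x G_t(y) dy`. -/
def greenPrim (t x : ℝ) : ℝ := ∫ y in (0 : ℝ)..x, green t y

/-- The self-similar profile `g(z) = (1/π) ∫_0^∞ exp(-k⁴) cos(k z) dk = G_1(z)`. -/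
def profile (z : ℝ) : ℝ := green 1 z

/-- The displacement `W(t) = ∫_0^t V(s) ds`. -/
def displ (V : ℝ → ℝ) (t : ℝ) : ℝ := ∫ s in (0 : ℝ)..t, V s

/-- Left-hand side minus right-hand side, at time `t`, of the integral equation that expresses
`u(0,t) = 0`:
`-∫_0^t G''_{t-s}(W(t)-W(s)) β(s) ds
  = ∫_0^∞ G_t(W(t)-y) u₀(y) dy - (1/2) ∫_0^t G'_{t-s}(W(t)-W(s)) ds`. -/
def residualA (u₀ V β : ℝ → ℝ) (t : ℝ) : ℝ :=
  (-∫ s in (0 : ℝ)..t, iteratedDeriv 2 (green (t - s)) (displ V t - displ V s) * β s)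
  - ((∫ y in Ioi (0 : ℝ), green t (displ V t - y) * u₀ y)
      - (1 / 2) * ∫ s in (0 : ℝ)..t, deriv (green (t - s)) (displ V t - displ V s))

/-- Left-hand side minus right-hand side, at time `t`, of the integral equation that expresses
`u_x(0,t) = β(t)`:
`β(t) + 2 β(0) H_t(W(t)) + 2 ∫_0^t H_{t-s}(W(t)-W(s)) β'(s) ds
    - 2 V(t) ∫_0^t G_{t-s}(W(t)-W(s)) β(s) ds
  = 2 ∫_0^∞ G'_t(W(t)-y) u₀(y) dy - ∫_0^t G''_{t-s}(W(t)-W(s)) ds`. -/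
def residualB (u₀ V β : ℝ → ℝ) (t : ℝ) : ℝ :=
  (β t + 2 * β 0 * greenPrim t (displ V t)
    + 2 * (∫ s in (0 : ℝ)..t, greenPrim (t - s) (displ V t - displ V s) * deriv β s)
    - 2 * V t * ∫ s in (0 : ℝ)..t, green (t - s) (displ V t - displ V s) * β s)
  - (2 * (∫ y in Ioi (0 : ℝ), deriv (green t) (displ V t - y) * u₀ y)
      - ∫ s in (0 : ℝ)..t, iteratedDeriv 2 (green (t - s)) (displ V t - displ V s))

/-- The partial sum `∑_{n ≤ M} c_n t^{n/4}` of the fractional power series with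
coefficients `c` (so `c n` is the coefficient of `t^{n/4}`). -/
def partialSum (c : ℕ → ℝ) (M : ℕ) (t : ℝ) : ℝ :=
  ∑ n ∈ Finset.range (M + 1), c n * t ^ ((n : ℝ) / 4)

/-- The fractional power series `β = b₀ + ∑_{n ≥ 4} b_n t^{n/4}` and `V = v₀ + ∑_{n ≥ 1} v_n t^{n/4}`
are a formal solution of the two integral equations: at every order `N`, all sufficiently long
partial sums satisfy both equations up to an error `O(t^{N/4})` as `t → 0+`. -/
structure IsFormalSolution (u₀ : ℝ → ℝ) (b v : ℕ → ℝ) : Prop where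
  gap : b 1 = 0 ∧ b 2 = 0 ∧ b 3 = 0
  eqA : ∀ N : ℕ, ∀ᶠ M in atTop,
    residualA u₀ (partialSum v M) (partialSum b M) =O[𝓝[>] 0] fun t : ℝ => t ^ ((N : ℝ) / 4)
  eqB : ∀ N : ℕ, ∀ᶠ M in atTop,
    residualB u₀ (partialSum v M) (partialSum b M) =O[𝓝[>] 0] fun t : ℝ => t ^ ((N : ℝ) / 4)

/-- `C_n = (n+1) / (6 √2 π) · Γ((n+4)/4) Γ(1/4) / Γ((n+5)/4)`. -/
def constC (n : ℕ) : ℝ :=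
  ((n : ℝ) + 1) / (6 * √2 * π)
    * (Real.Gamma (((n : ℝ) + 4) / 4) * Real.Gamma (1 / 4) / Real.Gamma (((n : ℝ) + 5) / 4))

end ThinFilm

end

/-! ### The profile g: Fourier representation, differential equation, half-line moments. -/

noncomputable section

namespace ThinFilm

open scoped SchwartzMap FourierTransform

/-! Write τ = t^(1/4) and s = τ⁴x with 0 < x < 1. Since G_t(y) = t^(-1/4) g(t^(-1/4) y), every
kernel becomes a power of τ, times an integrable weight (1-x)^(-a/4), times a derivative or
primitive of g at the similarity variable Z = (W(t)-W(s))/(t-s)^(1/4). If V is a polynomial in τ,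
then Z is τ³ times a polynomial in τ whose coefficients are bounded continuous functions of x.
Taylor expansion at 0, integrated against the weight (`kernel_expansion`), and a similar expansion
of the initial-data integrals (`data_expansion`) turn the first residual, and τ times the second,
into polynomials in τ modulo any power τ^K (`eqMod_residualA`, `eqMod_residualB`). By
`EqMod.isBigO_iff` an error O(τ^m) means divisibility by X^m, so what remains is algebra.

Low orders. The equation g''' = zg/4 gives the half-line moments of g that enter through order τ⁴.
The first equation then forces β₀ = u₀'(0) and V₀ = u₀⁗(0)/u₀'(0), and the second holds to the same
order automatically, thanks to the prescribed values of u₀'' and u₀''' at 0 (`polyA_congX`,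
`polyB_congX`, `solvesTo_five_iff`).

Higher orders. Changing β_{(n+4)/4} by c and V_{(n+1)/4} by d first affects both expansions at order
τ^(n+5), and does so linearly there (`lead_polyA_sub`, `lead_polyB_sub`). With B = ∫(1-x)^((n+4)/4)
x^(-3/4) dx over (0,1), the changes are -g''(0) B c - 2u₀'(0) d/(n+5) and c - (8/3) g(0) u₀'(0) d.
Eliminating c leaves the factor (2u₀'(0)/(n+5)) (1 - C_{n+4}) in front of d, so each pair of
coefficients exists and is unique as soon as C_{n+4} ≠ 1 (`system_det_ne_zero`,
`SolvesTo.exists_succ`, `SolvesTo.dvd_sub_succ`).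

That C_n ≠ 1 is a numerical fact (`constC_ne_one`). The value 1 is crossed between n = 8 and n = 9,
and C_{n+4} = ((n+4)/(n+1)) C_n propagates the lower bound to all large n. -/

lemma exists_bound_polynomial_mul_exp_quartic (p : Polynomial ℝ) :
    ∃ C, ∀ x : ℝ, |p.eval x * Real.exp (-(2 * π * x) ^ 4)| ≤ C := by
  induction p using Polynomial.induction_on' with
  | add p q hp hq =>
    obtain ⟨C, hC⟩ := hp
    obtain ⟨D, hD⟩ := hq
    refine ⟨C + D, fun x => ?_⟩
    rw [Polynomial.eval_add, add_mul]
    exact (abs_add_le _ _).trans (add_le_add (hC x) (hD x))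
  | monomial n a =>
    refine ⟨|a| * (n.factorial * Real.exp 1), fun x => ?_⟩
    have h1 : |x| ^ n ≤ n.factorial * Real.exp |x| := by
      have := Real.pow_div_factorial_le_exp |x| (abs_nonneg x) n
      rwa [div_le_iff₀ (by positivity), mul_comm] at this
    have h2 : Real.exp (-(2 * π * x) ^ 4) ≤ Real.exp 1 * Real.exp (-|x|) := by
      rw [← Real.exp_add, Real.exp_le_exp]
      have h3 : |x| ≤ 1 + |x| ^ 4 := by
        nlinarith [sq_nonneg (|x| ^ 2 - 1), sq_nonneg (|x| - 1), abs_nonneg x]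
      have h4 : |x| ^ 4 = x ^ 4 := by
        rw [← abs_pow]; exact abs_of_nonneg (by positivity)
      have h5 : x ^ 4 ≤ (2 * π * x) ^ 4 := by
        rw [mul_pow]
        exact le_mul_of_one_le_left (by positivity)
          (one_le_pow₀ (by nlinarith [Real.pi_gt_three]))
      linarith
    rw [Polynomial.eval_monomial, abs_mul, abs_mul, abs_pow, mul_assoc, Real.abs_exp]
    refine mul_le_mul_of_nonneg_left ?_ (abs_nonneg a)
    calc |x| ^ n * Real.exp (-(2 * π * x) ^ 4)
        ≤ (n.factorial * Real.exp |x|) * (Real.exp 1 * Real.exp (-|x|)) := by gcongr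
      _ = n.factorial * Real.exp 1 * (Real.exp |x| * Real.exp (-|x|)) := by ring
      _ = n.factorial * Real.exp 1 := by rw [← Real.exp_add]; simp

lemma hasDerivAt_exp_quartic (x : ℝ) :
    HasDerivAt (fun x : ℝ => Real.exp (-(2 * π * x) ^ 4))
      (-(4 * (2 * π) ^ 4) * x ^ 3 * Real.exp (-(2 * π * x) ^ 4)) x := by
  have h := ((((hasDerivAt_id x).const_mul (2 * π)).pow 4).neg).exp
  refine h.congr_deriv ?_
  simp
  ring

lemma iteratedDeriv_exp_quartic (n : ℕ) :
    ∃ p : Polynomial ℝ, iteratedDeriv n (fun x : ℝ => Real.exp (-(2 * π * x) ^ 4)) =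
      fun x => p.eval x * Real.exp (-(2 * π * x) ^ 4) := by
  induction n with
  | zero => exact ⟨1, by ext x; simp⟩
  | succ n ih =>
    obtain ⟨p, hp⟩ := ih
    refine ⟨p.derivative - Polynomial.C (4 * (2 * π) ^ 4) * Polynomial.X ^ 3 * p, ?_⟩
    rw [iteratedDeriv_succ, hp]
    ext x
    rw [show deriv (fun x => p.eval x * Real.exp (-(2 * π * x) ^ 4)) x = _ from
      ((p.hasDerivAt x).mul (hasDerivAt_exp_quartic x)).deriv]
    simp
    ring

/-- The Schwartz function `x ↦ exp (-(2πx)⁴)`. -/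
def quarticExp : 𝓢(ℝ, ℝ) where
  toFun x := Real.exp (-(2 * π * x) ^ 4)
  smooth' := by fun_prop
  decay' k n := by
    obtain ⟨p, hp⟩ := iteratedDeriv_exp_quartic n
    obtain ⟨C, hC⟩ := exists_bound_polynomial_mul_exp_quartic (Polynomial.X ^ k * p)
    refine ⟨C, fun x => ?_⟩
    rw [norm_iteratedFDeriv_eq_norm_iteratedDeriv, hp, ← norm_pow, ← norm_mul]
    simpa [mul_assoc] using hC x

lemma quarticExp_apply (x : ℝ) : quarticExp x = Real.exp (-(2 * π * x) ^ 4) := rfl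

/-- `quarticExp` as a complex-valued function. -/
def quarticExpC : 𝓢(ℝ, ℂ) := SchwartzMap.postcompCLM Complex.ofRealCLM quarticExp

lemma quarticExpC_apply (x : ℝ) : quarticExpC x = (Real.exp (-(2 * π * x) ^ 4) : ℝ) := by
  simp [quarticExpC, quarticExp_apply]

/-- The profile `g` as a Schwartz function. -/
def profileS : 𝓢(ℝ, ℝ) := SchwartzMap.postcompCLM Complex.reCLM (𝓕 quarticExpC)

lemma profileS_apply (z : ℝ) : profileS z = (𝓕 (quarticExpC : ℝ → ℂ) z).re := by
  simp [profileS, SchwartzMap.fourier_coe]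

lemma profileS_eq_integral (z : ℝ) :
    profileS z = ∫ v : ℝ, Real.cos (2 * π * v * z) * Real.exp (-(2 * π * v) ^ 4) := by
  rw [profileS_apply, Real.fourier_real_eq_integral_exp_smul]
  have hint : Integrable fun v : ℝ => Complex.exp (↑(-2 * π * v * z) * Complex.I) • quarticExpC v := by
    refine quarticExpC.integrable.norm.mono' ?_ ?_
    · refine Continuous.aestronglyMeasurable ?_
      have := quarticExpC.continuous
      fun_prop
    · filter_upwards with v
      rw [norm_smul, Complex.norm_exp_ofReal_mul_I, one_mul]
  rw [show (∫ v : ℝ, Complex.exp (↑(-2 * π * v * z) * Complex.I) • quarticExpC v).re = _ from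
    (Complex.reCLM.integral_comp_comm hint).symm]
  congr 1
  ext v
  rw [Complex.reCLM_apply, quarticExpC_apply, smul_eq_mul, Complex.re_mul_ofReal, Complex.exp_ofReal_mul_I_re]
  congr 1
  rw [← Real.cos_neg]
  congr 1
  ring

/-- The substitution k = 2πv passes from the 2π-normalized Fourier transform on the line to the
cosine integral defining `green`; evenness supplies the factor 2 that leaves 1/π. -/
lemma integral_comp_two_pi_mul_even (F : ℝ → ℝ) (hF : ∀ x, F (-x) = F x) :
    ∫ v : ℝ, F (2 * π * v) = (1 / π) * ∫ k in Ioi (0 : ℝ), F k := by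
  rw [Measure.integral_comp_mul_left F (2 * π)]
  have h : ∀ x, F x = F |x| := fun x => by
    rcases abs_choice x with h | h <;> rw [h]
    exact (hF x).symm
  rw [integral_congr_ae (Eventually.of_forall h), integral_comp_abs, abs_of_pos (by positivity),
    smul_eq_mul]
  field_simp

lemma profile_eq_profileS : profile = profileS := by
  ext z
  rw [profileS_eq_integral,
    integral_comp_two_pi_mul_even (fun k => Real.cos (k * z) * Real.exp (-k ^ 4))]
  · simp only [profile, green]
    congr 2
    ext k
    simp [mul_comm]
  · intro x
    rw [neg_mul, Real.cos_neg, neg_pow]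
    norm_num

lemma profileS_neg (z : ℝ) : profileS (-z) = profileS z := by
  rw [← profile_eq_profileS]
  simp [profile, green]

lemma integrable_pow_smul_quarticExpC (n : ℕ) : Integrable (fun x : ℝ => x ^ n • quarticExpC x) := by
  refine (quarticExpC.integrable_pow_mul volume n).mono' ?_ ?_
  · refine Continuous.aestronglyMeasurable ?_
    have := quarticExpC.continuous
    fun_prop
  · filter_upwards with v
    rw [norm_smul, norm_pow]

lemma iteratedDeriv_profileS (n : ℕ) (z : ℝ) : iteratedDeriv n profileS z =
    (iteratedDeriv n (𝓕 (quarticExpC : ℝ → ℂ)) z).re := by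
  have hc : ContDiff ℝ ∞ (𝓕 (quarticExpC : ℝ → ℂ)) := by
    rw [← SchwartzMap.fourier_coe]; exact (𝓕 quarticExpC).smooth ⊤
  induction n generalizing z with
  | zero => simp [profileS_apply]
  | succ n ih =>
    rw [iteratedDeriv_succ, iteratedDeriv_succ, funext ih]
    have hd : DifferentiableAt ℝ (iteratedDeriv n (𝓕 (quarticExpC : ℝ → ℂ))) z :=
      (hc.differentiable_iteratedDeriv n (by exact_mod_cast ENat.natCast_lt_top n)) z
    exact (Complex.reCLM.hasFDerivAt.comp_hasDerivAt z hd.hasDerivAt).deriv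

lemma iteratedDeriv_fourier_quarticExpC (n : ℕ) : iteratedDeriv n (𝓕 (quarticExpC : ℝ → ℂ)) =
    𝓕 (fun x : ℝ => (-2 * π * Complex.I * x) ^ n • quarticExpC x) :=
  Real.iteratedDeriv_fourier (N := ⊤) (fun n _ => integrable_pow_smul_quarticExpC n) le_top

/-- The profile equation `g''' = z g / 4`. -/
lemma iteratedDeriv_three_profileS (z : ℝ) :
    iteratedDeriv 3 profileS z = z * profileS z / 4 := by
  have hd : ∀ x, HasDerivAt quarticExpC ((-(4 * (2 * π) ^ 4) * x ^ 3 : ℝ) • quarticExpC x) x := by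
    intro x
    have h := (hasDerivAt_exp_quartic x).ofReal_comp
    have he : (quarticExpC : ℝ → ℂ) = fun x => ((Real.exp (-(2 * π * x) ^ 4) : ℝ) : ℂ) :=
      funext quarticExpC_apply
    rw [he]
    refine h.congr_deriv ?_
    push_cast
    simp
  have hderiv : deriv quarticExpC = fun x : ℝ => (-(4 * (2 * π) ^ 4) * x ^ 3 : ℝ) • quarticExpC x :=
    funext fun x => (hd x).deriv
  have hF := Real.fourier_deriv quarticExpC.integrable quarticExpC.differentiable
    (SchwartzMap.derivCLM ℝ ℂ quarticExpC).integrable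
  rw [iteratedDeriv_profileS, iteratedDeriv_fourier_quarticExpC, profileS_apply]
  -- Multiplying exp(-(2πx)⁴) by x³ is, up to a constant, differentiating it. Hence three
  -- derivatives of the transform amount to one multiplication by z.
  have h1 : (fun x : ℝ => (-2 * π * Complex.I * x) ^ 3 • quarticExpC x) =
      (-Complex.I / (8 * π) : ℂ) • deriv quarticExpC := by
    rw [hderiv]
    ext x
    simp only [Pi.smul_apply, smul_eq_mul, Complex.real_smul]
    have hpi : (π : ℂ) ≠ 0 := by exact_mod_cast Real.pi_ne_zero
    push_cast
    field_simp
    ring_nf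
    rw [Complex.I_sq]
    ring
  have h2 : 𝓕 ((-Complex.I / (8 * π) : ℂ) • deriv quarticExpC) z =
      (-Complex.I / (8 * π) : ℂ) • 𝓕 (deriv quarticExpC) z := by
    simp only [Real.fourier_real_eq_integral_exp_smul, Pi.smul_apply]
    rw [← integral_smul]
    congr 1
    ext v
    simp only [smul_eq_mul]
    ring
  rw [h1, h2, hF]
  have hpi : (π : ℂ) ≠ 0 := by exact_mod_cast Real.pi_ne_zero
  have h3 : (-Complex.I / (8 * π) : ℂ) • (2 * π * Complex.I * z) • 𝓕 (quarticExpC : ℝ → ℂ) z =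
      ((z / 4 : ℝ) : ℂ) * 𝓕 (quarticExpC : ℝ → ℂ) z := by
    simp only [smul_eq_mul]
    push_cast
    field_simp
    ring_nf
    rw [Complex.I_sq]
    ring
  rw [h3, Complex.re_ofReal_mul]
  ring

lemma integral_pow_exp_quartic (m : ℕ) :
    ∫ k in Ioi (0 : ℝ), k ^ m * Real.exp (-k ^ 4) = (1 / 4) * Real.Gamma ((m + 1) / 4) := by
  rw [← integral_rpow_mul_exp_neg_rpow (p := 4) (q := m) (by norm_num) (by linarith [m.cast_nonneg (α := ℝ)])]
  congr 1
  ext k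
  norm_cast

lemma profileS_zero : profileS 0 = Real.Gamma (1 / 4) / (4 * π) := by
  rw [profileS_eq_integral]
  simp only [mul_zero, Real.cos_zero]
  rw [integral_comp_two_pi_mul_even (fun k => 1 * Real.exp (-k ^ 4))]
  · have := integral_pow_exp_quartic 0
    simp only [pow_zero, Nat.cast_zero, zero_add] at this
    rw [this]
    field_simp
  · intro x
    rw [neg_pow]; norm_num

lemma iteratedDeriv_two_profileS_zero :
    iteratedDeriv 2 profileS 0 = -(Real.Gamma (3 / 4) / (4 * π)) := by
  rw [iteratedDeriv_profileS, iteratedDeriv_fourier_quarticExpC,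
    Real.fourier_real_eq_integral_exp_smul]
  have h : ∀ v : ℝ, Complex.exp (↑(-2 * π * v * 0) * Complex.I) •
      ((-2 * π * Complex.I * v) ^ 2 • quarticExpC v) =
      ((-((2 * π * v) ^ 2 * Real.exp (-(2 * π * v) ^ 4)) : ℝ) : ℂ) := by
    intro v
    rw [quarticExpC_apply]
    simp [mul_pow]
  simp_rw [h]
  rw [integral_complex_ofReal, Complex.ofReal_re, integral_neg,
    integral_comp_two_pi_mul_even (fun k => k ^ 2 * Real.exp (-k ^ 4)),
    integral_pow_exp_quartic 2]
  · norm_num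
    field_simp
  · intro x
    rw [neg_pow, neg_pow x 4]; norm_num

/-- Fourier inversion at the origin, where exp(-(2πx)⁴) equals 1. -/
lemma integral_profileS : ∫ z, profileS z = 1 := by
  have h := quarticExpC.continuous.fourierInv_fourier_eq quarticExpC.integrable
    (by rw [← SchwartzMap.fourier_coe]; exact (𝓕 quarticExpC).integrable)
  have h0 := congrFun h 0
  rw [Real.fourierInv_eq] at h0
  simp only [inner_zero_right, AddChar.map_zero_eq_one, one_smul] at h0
  have hre := congrArg Complex.re h0
  rw [show (∫ v : ℝ, 𝓕 (quarticExpC : ℝ → ℂ) v).re = _ from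
    (Complex.reCLM.integral_comp_comm
      (by rw [← SchwartzMap.fourier_coe]; exact (𝓕 quarticExpC).integrable)).symm,
    quarticExpC_apply] at hre
  simp only [Complex.reCLM_apply, ← profileS_apply] at hre
  simpa using hre

/-- The `n`-th derivative of a Schwartz function, as a Schwartz function. -/
def iterDerivS (n : ℕ) (Φ : 𝓢(ℝ, ℝ)) : 𝓢(ℝ, ℝ) := (SchwartzMap.derivCLM ℝ ℝ)^[n] Φ

lemma iterDerivS_zero (Φ : 𝓢(ℝ, ℝ)) : iterDerivS 0 Φ = Φ := rfl

lemma coe_iterDerivS (n : ℕ) (Φ : 𝓢(ℝ, ℝ)) : ⇑(iterDerivS n Φ) = iteratedDeriv n Φ := by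
  induction n with
  | zero => ext x; simp [iterDerivS]
  | succ n ih =>
    ext x
    rw [iteratedDeriv_succ, ← ih, iterDerivS, Function.iterate_succ_apply',
      SchwartzMap.derivCLM_apply]
    rfl

lemma hasDerivAt_iterDerivS (n : ℕ) (Φ : 𝓢(ℝ, ℝ)) (x : ℝ) :
    HasDerivAt (iterDerivS n Φ) (iterDerivS (n + 1) Φ x) x := by
  have h : iterDerivS (n + 1) Φ x = deriv (iterDerivS n Φ) x := by
    rw [coe_iterDerivS, iteratedDeriv_succ, coe_iterDerivS]
  rw [h]
  exact ((iterDerivS n Φ).differentiableAt).hasDerivAt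

/-- Multiplication of a Schwartz function by `x ^ k`. -/
def powMulS (k : ℕ) (Φ : 𝓢(ℝ, ℝ)) : 𝓢(ℝ, ℝ) := SchwartzMap.smulLeftCLM ℝ (fun x : ℝ => x ^ k) Φ

lemma powMulS_apply (k : ℕ) (Φ : 𝓢(ℝ, ℝ)) (x : ℝ) : powMulS k Φ x = x ^ k * Φ x := by
  rw [powMulS, SchwartzMap.smulLeftCLM_apply_apply (by fun_prop), smul_eq_mul]

lemma integral_Ioi_deriv_schwartz (F : 𝓢(ℝ, ℝ)) : ∫ x in Ioi (0 : ℝ), deriv F x = -F 0 := by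
  have h := integral_Ioi_of_hasDerivAt_of_tendsto' (a := 0) (f := F) (f' := deriv F) (m := 0)
    (fun x _ => (F.differentiableAt).hasDerivAt)
    (SchwartzMap.derivCLM ℝ ℝ F).integrable.integrableOn
    (F.tendsto_cocompact.mono_left (by rw [cocompact_eq_atBot_atTop]; exact le_sup_right))
  simpa using h

lemma integrableOn_pow_mul_schwartz (k : ℕ) (Φ : 𝓢(ℝ, ℝ)) :
    IntegrableOn (fun x => x ^ k * Φ x) (Ioi 0) := by
  have := (powMulS k Φ).integrable (μ := volume)
  simp only [funext (powMulS_apply k Φ)] at this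
  exact this.integrableOn

/-- Integration by parts. The power is at least 1, so there is no boundary term at 0. -/
lemma integral_Ioi_pow_mul_deriv (k : ℕ) (Φ : 𝓢(ℝ, ℝ)) :
    ∫ x in Ioi (0 : ℝ), x ^ (k + 1) * iterDerivS 1 Φ x =
      -((k + 1) * ∫ x in Ioi (0 : ℝ), x ^ k * Φ x) := by
  have h := integral_Ioi_deriv_schwartz (powMulS (k + 1) Φ)
  have hd : ∀ x, deriv (powMulS (k + 1) Φ) x =
      (k + 1) * (x ^ k * Φ x) + x ^ (k + 1) * iterDerivS 1 Φ x := by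
    intro x
    rw [funext (powMulS_apply (k + 1) Φ)]
    have := ((hasDerivAt_pow (k + 1) x).mul (hasDerivAt_iterDerivS 0 Φ x)).deriv
    rw [iterDerivS_zero] at this
    rw [show (fun x => x ^ (k + 1) * Φ x) = (fun x => x ^ (k + 1)) * ⇑Φ from rfl, this]
    push_cast
    ring_nf
  simp only [hd, powMulS_apply] at h
  rw [integral_add ((integrableOn_pow_mul_schwartz k Φ).const_mul _)
    (integrableOn_pow_mul_schwartz (k + 1) _), integral_const_mul] at h
  simp at h
  linarith

lemma iterDerivS_succ (n : ℕ) (Φ : 𝓢(ℝ, ℝ)) :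
    iterDerivS (n + 1) Φ = iterDerivS 1 (iterDerivS n Φ) := by
  simp [iterDerivS, Function.iterate_succ_apply']

lemma iterDerivS_add (m n : ℕ) (Φ : 𝓢(ℝ, ℝ)) :
    iterDerivS m (iterDerivS n Φ) = iterDerivS (m + n) Φ := by
  simp [iterDerivS, Function.iterate_add_apply]

lemma integral_Ioi_iterDerivS_one (Φ : 𝓢(ℝ, ℝ)) :
    ∫ x in Ioi (0 : ℝ), iterDerivS 1 Φ x = -Φ 0 := by
  rw [← integral_Ioi_deriv_schwartz]
  congr 1

lemma integral_Ioi_profileS : ∫ x in Ioi (0 : ℝ), profileS x = 1 / 2 := by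
  have h : ∀ x, profileS x = profileS |x| := fun x => by
    rcases abs_choice x with h | h <;> rw [h]
    exact (profileS_neg x).symm
  have h1 := integral_profileS
  rw [integral_congr_ae (Eventually.of_forall h), integral_comp_abs] at h1
  linarith

lemma deriv_profileS_zero : iterDerivS 1 profileS 0 = 0 := by
  have h := (hasDerivAt_iterDerivS 0 profileS (-0)).comp (0 : ℝ) (hasDerivAt_neg (0 : ℝ))
  have he : ⇑(iterDerivS 0 profileS) ∘ Neg.neg = iterDerivS 0 profileS := by
    ext x; simp [iterDerivS, profileS_neg]
  rw [he] at h
  have := h.unique (hasDerivAt_iterDerivS 0 profileS 0)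
  simp at this
  linarith

lemma iterDerivS_three_profileS (z : ℝ) : iterDerivS 3 profileS z = z * profileS z / 4 := by
  rw [coe_iterDerivS, iteratedDeriv_three_profileS]

/-- Integration by parts against the profile equation. -/
lemma integral_Ioi_pow_succ_mul_profileS (k : ℕ) :
    ∫ x in Ioi (0 : ℝ), x ^ (k + 1) * profileS x =
      4 * ∫ x in Ioi (0 : ℝ), x ^ k * iterDerivS 3 profileS x := by
  rw [← integral_const_mul]
  congr 1
  ext x
  rw [iterDerivS_three_profileS]
  ring

lemma integral_Ioi_mul_profileS :
    ∫ x in Ioi (0 : ℝ), x ^ 1 * profileS x = -4 * iterDerivS 2 profileS 0 := by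
  rw [integral_Ioi_pow_succ_mul_profileS 0, iterDerivS_succ 2]
  simp [integral_Ioi_iterDerivS_one]

/-- Two integrations by parts reduce this to g'(0), which vanishes because g is even. As a
consequence u₀''(0) does not enter the first equation at order τ². -/
lemma integral_Ioi_sq_mul_profileS :
    ∫ x in Ioi (0 : ℝ), x ^ 2 * profileS x = 0 := by
  rw [integral_Ioi_pow_succ_mul_profileS 1, iterDerivS_succ 2, integral_Ioi_pow_mul_deriv 0,
    iterDerivS_succ 1]
  simp [integral_Ioi_iterDerivS_one, deriv_profileS_zero]

lemma integral_Ioi_cube_mul_profileS :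
    ∫ x in Ioi (0 : ℝ), x ^ 3 * profileS x = -8 * profileS 0 := by
  rw [integral_Ioi_pow_succ_mul_profileS 2, iterDerivS_succ 2, integral_Ioi_pow_mul_deriv 1,
    iterDerivS_succ 1, integral_Ioi_pow_mul_deriv 0]
  simp [integral_Ioi_iterDerivS_one]
  ring

lemma integral_Ioi_pow_four_mul_profileS :
    ∫ x in Ioi (0 : ℝ), x ^ 4 * profileS x = -12 := by
  rw [integral_Ioi_pow_succ_mul_profileS 3, iterDerivS_succ 2, integral_Ioi_pow_mul_deriv 2,
    iterDerivS_succ 1, integral_Ioi_pow_mul_deriv 1, integral_Ioi_pow_mul_deriv 0]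
  simp [integral_Ioi_profileS]
  norm_num

end ThinFilm
end

/-! ### The constants C_n and the proof that none of them equals 1. -/

noncomputable section

namespace ThinFilm

/-- The Beta integral `∫_0^1 (1-x)^{n/4} x^{-3/4} dx`. -/
def betaQuarter (n : ℕ) : ℝ := ∫ x in (0 : ℝ)..1, (1 - x) ^ ((n : ℝ) / 4) / x ^ ((3 : ℝ) / 4)

lemma betaQuarter_eq_Gamma (n : ℕ) : betaQuarter n =
    Real.Gamma (((n : ℝ) + 4) / 4) * Real.Gamma (1 / 4) / Real.Gamma (((n : ℝ) + 5) / 4) := by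
  have h := ProbabilityTheory.beta_eq_betaIntegralReal (1 / 4) (((n : ℝ) + 4) / 4) (by norm_num)
    (by positivity)
  have h2 : Complex.betaIntegral ((1 / 4 : ℝ) : ℂ) ((((n : ℝ) + 4) / 4 : ℝ) : ℂ) =
      (betaQuarter n : ℂ) := by
    rw [Complex.betaIntegral, betaQuarter, ← intervalIntegral.integral_ofReal]
    refine intervalIntegral.integral_congr fun x hx => ?_
    rw [uIcc_of_le zero_le_one] at hx
    have h1 : (0 : ℝ) ≤ 1 - x := by linarith [hx.2]
    have e1 : ((x : ℂ) ^ (((1 / 4 : ℝ) : ℂ) - 1)) = ((x ^ (-(3 / 4) : ℝ) : ℝ) : ℂ) := by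
      rw [Complex.ofReal_cpow hx.1]; congr 1; push_cast; norm_num
    have e2 : ((1 - (x : ℂ)) ^ (((((n : ℝ) + 4) / 4 : ℝ) : ℂ) - 1)) =
        (((1 - x) ^ ((n : ℝ) / 4) : ℝ) : ℂ) := by
      rw [Complex.ofReal_cpow h1]; push_cast; congr 1; ring
    simp only [e1, e2]
    rw [← Complex.ofReal_mul, Real.rpow_neg hx.1, ← div_eq_inv_mul]
  rw [h2, Complex.ofReal_re, ProbabilityTheory.beta] at h
  rw [← h]
  congr 1
  · ring
  · congr 1; ring

lemma constC_eq (n : ℕ) : constC n = ((n : ℝ) + 1) / (6 * √2 * π) * betaQuarter n := by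
  rw [constC, betaQuarter_eq_Gamma]

/-- Euler's reflection formula, Γ(1/4)Γ(3/4) = π√2. -/
lemma profileS_zero_mul_iteratedDeriv_two :
    profileS 0 * iteratedDeriv 2 profileS 0 = -(√2 / (16 * π)) := by
  have h := Real.Gamma_mul_Gamma_one_sub (1 / 4)
  rw [show (1 : ℝ) - 1 / 4 = 3 / 4 by norm_num, show π * (1 / 4) = π / 4 by ring,
    Real.sin_pi_div_four] at h
  rw [profileS_zero, iteratedDeriv_two_profileS_zero]
  have h2 : √2 * √2 = 2 := Real.mul_self_sqrt (by norm_num)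
  have h3 : Real.Gamma (1 / 4) * Real.Gamma (3 / 4) = π * √2 := by
    rw [h]; field_simp; nlinarith
  field_simp
  linear_combination -16 * h3

lemma constC_eq_profileS (n : ℕ) : constC n =
    -(4 * ((n : ℝ) + 1) / 3) * profileS 0 * iteratedDeriv 2 profileS 0 * betaQuarter n := by
  rw [constC_eq, mul_assoc (-(4 * ((n : ℝ) + 1) / 3)), profileS_zero_mul_iteratedDeriv_two]
  have h2 : √2 * √2 = 2 := Real.mul_self_sqrt (by norm_num)
  field_simp
  rw [Real.sq_sqrt (by norm_num)]
  ring

lemma betaQuarter_integrable (n : ℕ) : IntervalIntegrable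
    (fun x : ℝ => (1 - x) ^ ((n : ℝ) / 4) / x ^ ((3 : ℝ) / 4)) volume 0 1 := by
  have h1 : IntervalIntegrable (fun x : ℝ => x ^ (-(3 / 4) : ℝ)) volume 0 1 :=
    intervalIntegral.intervalIntegrable_rpow' (by norm_num)
  have h2 : Continuous (fun x : ℝ => (1 - x) ^ ((n : ℝ) / 4)) :=
    (continuous_const.sub continuous_id).rpow_const fun x => Or.inr (by positivity)
  refine (h1.continuousOn_mul h2.continuousOn).congr_uIoo fun x hx => ?_
  rw [uIoo_of_le zero_le_one] at hx
  simp only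
  rw [Real.rpow_neg hx.1.le, ← div_eq_mul_inv]

lemma betaQuarter_anti {m n : ℕ} (h : m ≤ n) : betaQuarter n ≤ betaQuarter m := by
  refine intervalIntegral.integral_mono_on_of_le_Ioo zero_le_one (betaQuarter_integrable n)
    (betaQuarter_integrable m) fun x hx => ?_
  have h1 : (0 : ℝ) < 1 - x := by linarith [hx.2]
  have h2 : (0 : ℝ) < x := hx.1
  refine div_le_div_of_nonneg_right ?_ (by positivity)
  exact Real.rpow_le_rpow_of_exponent_ge h1 (by linarith) (by gcongr)

/-- Weighted AM-GM under the integral, with 12 = (4/7)·9 + (3/7)·16. The values at 12 and 16 are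
rational, so this bounds the value at 9 from below; monotonicity alone, comparing 9 with 12, would
be too weak to give C₉ > 1. -/
lemma betaQuarter_convex :
    betaQuarter 12 ≤ 4 / 7 * betaQuarter 9 + 3 / 7 * betaQuarter 16 := by
  rw [betaQuarter, betaQuarter, betaQuarter, ← intervalIntegral.integral_const_mul,
    ← intervalIntegral.integral_const_mul, ← intervalIntegral.integral_add
      ((betaQuarter_integrable 9).const_mul _) ((betaQuarter_integrable 16).const_mul _)]
  refine intervalIntegral.integral_mono_on_of_le_Ioo zero_le_one (betaQuarter_integrable 12)
    (((betaQuarter_integrable 9).const_mul _).add ((betaQuarter_integrable 16).const_mul _))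
    fun x hx => ?_
  have h1 : (0 : ℝ) < 1 - x := by linarith [hx.2]
  have h2 : (0 : ℝ) < x := hx.1
  rw [← mul_div_assoc, ← mul_div_assoc, ← add_div]
  refine div_le_div_of_nonneg_right ?_ (by positivity)
  have := Real.geom_mean_le_arith_mean2_weighted (w₁ := 4 / 7) (w₂ := 3 / 7)
    (p₁ := (1 - x) ^ (((9 : ℕ) : ℝ) / 4)) (p₂ := (1 - x) ^ (((16 : ℕ) : ℝ) / 4))
    (by norm_num) (by norm_num) (by positivity) (by positivity) (by norm_num)
  rw [← Real.rpow_mul h1.le, ← Real.rpow_mul h1.le, ← Real.rpow_add h1] at this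
  refine le_trans (le_of_eq ?_) this
  congr 1
  norm_num

/-- The functional equation of Γ applied to numerator and denominator. Starting from 0 it makes the
values at multiples of 4 rational. -/
lemma betaQuarter_add_four (n : ℕ) :
    betaQuarter (n + 4) = ((n : ℝ) + 4) / (n + 5) * betaQuarter n := by
  rw [betaQuarter_eq_Gamma, betaQuarter_eq_Gamma]
  push_cast
  have h1 := Real.Gamma_add_one (s := ((n : ℝ) + 4) / 4) (by positivity)
  have h2 := Real.Gamma_add_one (s := ((n : ℝ) + 5) / 4) (by positivity)
  rw [show ((n : ℝ) + 4 + 4) / 4 = ((n : ℝ) + 4) / 4 + 1 by ring,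
    show ((n : ℝ) + 4 + 5) / 4 = ((n : ℝ) + 5) / 4 + 1 by ring, h1, h2]
  have h3 := (Real.Gamma_pos_of_pos (s := ((n : ℝ) + 5) / 4) (by positivity)).ne'
  field_simp

lemma betaQuarter_zero : betaQuarter 0 = 4 := by
  rw [betaQuarter_eq_Gamma]
  have h2 := Real.Gamma_add_one (s := 1 / 4) (by positivity)
  rw [show ((0 : ℕ) + 5 : ℝ) / 4 = 1 / 4 + 1 by norm_num, h2]
  have h3 := (Real.Gamma_pos_of_pos (s := 1 / 4) (by positivity)).ne'
  norm_num
  field_simp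

lemma betaQuarter_four : betaQuarter 4 = 16 / 5 := by
  rw [betaQuarter_add_four 0, betaQuarter_zero]; norm_num

lemma betaQuarter_eight : betaQuarter 8 = 128 / 45 := by
  rw [betaQuarter_add_four 4, betaQuarter_four]; norm_num

lemma betaQuarter_twelve : betaQuarter 12 = 512 / 195 := by
  rw [betaQuarter_add_four 8, betaQuarter_eight]; norm_num

lemma betaQuarter_sixteen : betaQuarter 16 = 8192 / 3315 := by
  rw [betaQuarter_add_four 12, betaQuarter_twelve]; norm_num

lemma six_sqrt_two_pi_bounds : 26.6 < 6 * √2 * π ∧ 6 * √2 * π < 26.7 := by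
  have h1 : 1.414 < √2 := Real.lt_sqrt_of_sq_lt (by norm_num)
  have h2 : √2 < 1.4143 := by
    rw [Real.sqrt_lt' (by norm_num)]; norm_num
  have h3 := Real.pi_gt_d4
  have h4 := Real.pi_lt_d4
  constructor <;> nlinarith

/-- The Beta integral decreases in n, so on each block of four indices it is bounded by its value at
the first one. The products (n+1)·16/5 for n = 7 and 9·128/45 are both 25.6, just below 26.6 < 6√2π.
-/
lemma constC_lt_one {n : ℕ} (hn : n ≤ 8) : constC n < 1 := by
  have hb := six_sqrt_two_pi_bounds.1
  have h0 : betaQuarter n ≤ 4 := betaQuarter_zero ▸ betaQuarter_anti (Nat.zero_le n)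
  rw [constC_eq, div_mul_eq_mul_div, div_lt_one (by linarith)]
  have hn' : (n : ℝ) ≤ 8 := by exact_mod_cast hn
  have hn0 : (0 : ℝ) ≤ n := n.cast_nonneg
  rcases Nat.lt_or_ge n 4 with h | h
  · have : (n : ℝ) ≤ 3 := by exact_mod_cast Nat.le_of_lt_succ h
    nlinarith
  · have h4 : betaQuarter n ≤ 16 / 5 := betaQuarter_four ▸ betaQuarter_anti h
    rcases Nat.lt_or_ge n 8 with h' | h'
    · have : (n : ℝ) ≤ 7 := by exact_mod_cast Nat.le_of_lt_succ h'
      nlinarith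
    · obtain rfl : n = 8 := le_antisymm hn h'
      rw [betaQuarter_eight]
      norm_num
      linarith

lemma constC_gt_one {n : ℕ} (hn : 9 ≤ n) : 1 < constC n := by
  have hb := six_sqrt_two_pi_bounds
  induction n using Nat.strong_induction_on with
  | _ n ih =>
    rw [constC_eq, div_mul_eq_mul_div, one_lt_div (by linarith)]
    rcases Nat.lt_or_ge n 13 with h | h
    · rcases Nat.eq_or_lt_of_le hn with h9 | h9
      · subst h9
        have := betaQuarter_convex
        rw [betaQuarter_twelve, betaQuarter_sixteen] at this
        norm_num at this ⊢
        linarith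
      · have h1 : 512 / 195 ≤ betaQuarter n :=
          betaQuarter_twelve ▸ betaQuarter_anti (Nat.le_of_lt_succ h)
        have h2 : (10 : ℝ) ≤ n := by exact_mod_cast h9
        nlinarith
    · obtain ⟨m, rfl⟩ : ∃ m, n = m + 4 := ⟨n - 4, by omega⟩
      have hm := ih m (by omega) (by omega)
      rw [constC_eq, div_mul_eq_mul_div, one_lt_div (by linarith)] at hm
      -- The ratio C_{m+4}/C_m is (m+4)/(m+1), which exceeds 1, so the four cases 9, 10, 11, 12
      -- suffice.
      refine hm.trans_le ?_
      rw [betaQuarter_add_four, ← mul_assoc]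
      have hp : 0 ≤ betaQuarter m := by
        by_contra hneg
        have : (0 : ℝ) ≤ (m : ℝ) + 1 := by positivity
        nlinarith
      refine mul_le_mul_of_nonneg_right ?_ hp
      push_cast
      rw [mul_div_assoc', le_div_iff₀ (by positivity)]
      nlinarith

lemma constC_ne_one (n : ℕ) : constC n ≠ 1 := by
  rcases Nat.lt_or_ge n 9 with h | h
  · exact (constC_lt_one (Nat.le_of_lt_succ h)).ne
  · exact (constC_gt_one h).ne'

end ThinFilm
end

/-! ### Taylor remainders, congruence modulo τ^K, and expansion of the kernel integrals. -/

noncomputable section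

namespace ThinFilm

attribute [local instance] Measure.Subtype.measureSpace

open Polynomial

/-- Induction on K: the derivative of the remainder is the remainder of Φ', and the mean value
inequality contributes one more factor |w|. The missing 1/K! is harmless. The base point a is kept
free so that C may depend on it, which later carries the decay at a = -η. -/
lemma abs_sub_taylor_sum_le {Φ : ℝ → ℝ} (hΦ : ContDiff ℝ ∞ Φ) (K : ℕ) {a r C : ℝ}
    (hC : ∀ y, |y - a| ≤ r → |iteratedDeriv K Φ y| ≤ C) {w : ℝ} (hw : |w| ≤ r) :
    |Φ (a + w) - ∑ j ∈ Finset.range K, iteratedDeriv j Φ a / j.factorial * w ^ j| ≤ C * |w| ^ K := by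
  induction K generalizing Φ w with
  | zero => simpa using hC (a + w) (by simpa using hw)
  | succ K ih =>
    have hΦ' : ContDiff ℝ ∞ (deriv Φ) := (contDiff_infty_iff_deriv.mp hΦ).2
    have ih' := fun {v : ℝ} (hv : |v| ≤ r) => ih hΦ' (w := v)
      (fun y hy => by rw [← iteratedDeriv_succ']; exact hC y hy) hv
    set F : ℝ → ℝ := fun w => Φ (a + w) -
      ∑ j ∈ Finset.range (K + 1), iteratedDeriv j Φ a / j.factorial * w ^ j with hF
    have hder : ∀ v, HasDerivAt F (deriv Φ (a + v) -
        ∑ j ∈ Finset.range K, iteratedDeriv j (deriv Φ) a / j.factorial * v ^ j) v := by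
      intro v
      refine HasDerivAt.sub ?_ ?_
      · exact ((hΦ.differentiable (by simp)) (a + v)).hasDerivAt.comp_const_add a v
      · have h1 : ∀ j ∈ Finset.range (K + 1), HasDerivAt
            (fun w : ℝ => iteratedDeriv j Φ a / j.factorial * w ^ j)
            (iteratedDeriv j Φ a / j.factorial * (j * v ^ (j - 1))) v :=
          fun j _ => (hasDerivAt_pow j v).const_mul _
        refine (HasDerivAt.fun_sum h1).congr_deriv ?_
        rw [Finset.sum_range_succ']
        simp only [Nat.cast_zero, zero_mul, mul_zero, add_zero]
        refine Finset.sum_congr rfl fun j _ => ?_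
        rw [iteratedDeriv_succ', Nat.factorial_succ]
        have : (j.factorial : ℝ) ≠ 0 := by positivity
        push_cast

        field_simp
    have hF0 : F 0 = 0 := by
      simp [hF, Finset.sum_range_succ']
    have hC0 : 0 ≤ C := (abs_nonneg _).trans (hC a (by simpa using (abs_nonneg w).trans hw))
    have hb := (convex_Icc (-|w|) |w|).norm_image_sub_le_of_norm_hasDerivWithin_le
      (f := F) (C := C * |w| ^ K) (x := 0) (y := w)
      (fun v _ => (hder v).hasDerivWithinAt)
      (fun v hv => by
        have hv' : |v| ≤ |w| := abs_le.mpr hv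
        refine (ih' (hv'.trans hw)).trans ?_
        gcongr) (by simp) (abs_le.mp le_rfl)
    rw [hF0, sub_zero, sub_zero, Real.norm_eq_abs, Real.norm_eq_abs] at hb
    rw [pow_succ, ← mul_assoc]
    exact hb

/-- The Taylor polynomial of `Φ` at `0` of degree `< K`. -/
def taylorPoly (Φ : ℝ → ℝ) (K : ℕ) : ℝ[X] :=
  ∑ j ∈ Finset.range K, C (iteratedDeriv j Φ 0 / j.factorial) * X ^ j

lemma taylorPoly_eval (Φ : ℝ → ℝ) (K : ℕ) (w : ℝ) : (taylorPoly Φ K).eval w =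
    ∑ j ∈ Finset.range K, iteratedDeriv j Φ 0 / j.factorial * w ^ j := by
  simp [taylorPoly, eval_finsetSum]

lemma taylorPoly_coeff (Φ : ℝ → ℝ) {K j : ℕ} (h : j < K) :
    (taylorPoly Φ K).coeff j = iteratedDeriv j Φ 0 / j.factorial := by
  simp [taylorPoly, coeff_X_pow, h]

lemma exists_taylorPoly_bound {Φ : ℝ → ℝ} (hΦ : ContDiff ℝ ∞ Φ) (K : ℕ) (r : ℝ) :
    ∃ C, 0 ≤ C ∧ ∀ w, |w| ≤ r → |Φ w - (taylorPoly Φ K).eval w| ≤ C * |w| ^ K := by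
  have hc : Continuous (iteratedDeriv K Φ) :=
    hΦ.continuous_iteratedDeriv K (by exact_mod_cast le_top)
  obtain ⟨C, hC⟩ := (isCompact_Icc (a := -r) (b := r)).exists_bound_of_continuousOn hc.continuousOn
  refine ⟨max C 0, le_max_right _ _, fun w hw => ?_⟩
  rw [taylorPoly_eval]
  have := abs_sub_taylor_sum_le hΦ K (a := 0) (r := r) (C := max C 0)
    (fun y hy => (hC y (abs_le.mp (by simpa using hy))).trans (le_max_left _ _)) hw
  simpa using this

/-- `f τ = P(τ) + O(τ^K)` as `τ → 0+`. -/
def EqMod (K : ℕ) (f : ℝ → ℝ) (P : ℝ[X]) : Prop :=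
  (fun τ => f τ - P.eval τ) =O[𝓝[>] 0] (fun τ : ℝ => τ ^ K)

namespace EqMod

variable {K : ℕ} {f f' : ℝ → ℝ} {P P' : ℝ[X]}

lemma add (h : EqMod K f P) (h' : EqMod K f' P') : EqMod K (fun τ => f τ + f' τ) (P + P') := by
  refine (IsBigO.add h h').congr_left fun τ => ?_
  rw [eval_add]; ring

lemma sub (h : EqMod K f P) (h' : EqMod K f' P') : EqMod K (fun τ => f τ - f' τ) (P - P') := by
  refine (IsBigO.sub h h').congr_left fun τ => ?_
  rw [eval_sub]; ring

lemma isBigO_one (Q : ℝ[X]) : (fun τ => Q.eval τ) =O[𝓝[>] 0] (fun _ : ℝ => (1 : ℝ)) :=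
  ((Q.continuous.tendsto 0).isBigO_one ℝ).mono nhdsWithin_le_nhds

lemma poly_mul (Q : ℝ[X]) (h : EqMod K f P) : EqMod K (fun τ => Q.eval τ * f τ) (Q * P) := by
  refine ((isBigO_one Q).mul h).congr (fun τ => ?_) fun τ => one_mul _
  rw [eval_mul]; ring

lemma poly (Q : ℝ[X]) : EqMod K (fun τ => Q.eval τ) Q := by
  simp only [EqMod, sub_self]
  exact isBigO_zero _ _

lemma congr (h : EqMod K f P) (hf : ∀ τ, 0 < τ → f' τ = f τ) : EqMod K f' P := by
  refine IsBigO.congr' h ?_ EventuallyEq.rfl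
  filter_upwards [self_mem_nhdsWithin] with τ hτ
  rw [hf τ hτ]

end EqMod

lemma isBigO_pow_of_le {m n : ℕ} (h : m ≤ n) :
    (fun τ : ℝ => τ ^ n) =O[𝓝[>] 0] (fun τ : ℝ => τ ^ m) :=
  IsBigO.of_bound 1 <| by
    filter_upwards [Ioc_mem_nhdsGT (zero_lt_one (α := ℝ))] with τ hτ
    rw [one_mul, Real.norm_eq_abs, Real.norm_eq_abs, abs_of_nonneg (pow_nonneg hτ.1.le _),
      abs_of_nonneg (pow_nonneg hτ.1.le _)]
    exact pow_le_pow_of_le_one hτ.1.le hτ.2 h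

/-- Strip the powers of X one at a time: after dividing by τ^m the quotient still tends to 0, so its
constant term vanishes. -/
lemma X_pow_dvd_of_isBigO {P : ℝ[X]} {m : ℕ}
    (h : (fun τ => P.eval τ) =O[𝓝[>] 0] (fun τ : ℝ => τ ^ m)) : X ^ m ∣ P := by
  induction m with
  | zero => simp
  | succ m ih =>
    obtain ⟨Q, rfl⟩ := ih (h.trans (isBigO_pow_of_le m.le_succ))
    have hQ : (fun τ => Q.eval τ) =O[𝓝[>] 0] (fun τ : ℝ => τ) := by
      have h1 : (fun τ : ℝ => (τ ^ m)⁻¹) =O[𝓝[>] 0] (fun τ : ℝ => (τ ^ m)⁻¹) := isBigO_refl _ _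
      refine (h1.mul h).congr' ?_ ?_
      · filter_upwards [self_mem_nhdsWithin] with τ hτ
        have : τ ≠ 0 := ne_of_gt hτ
        simp [field]
      · filter_upwards [self_mem_nhdsWithin] with τ hτ
        have : τ ≠ 0 := ne_of_gt hτ
        rw [pow_succ]
        field_simp
    have ht : Tendsto (fun τ : ℝ => Q.eval τ) (𝓝[>] 0) (𝓝 0) :=
      hQ.trans_tendsto (tendsto_id.mono_left nhdsWithin_le_nhds)
    have ht' : Tendsto (fun τ : ℝ => Q.eval τ) (𝓝[>] 0) (𝓝 (Q.eval 0)) :=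
      (Q.continuous.tendsto 0).mono_left nhdsWithin_le_nhds
    have h0 := tendsto_nhds_unique ht' ht
    rw [pow_succ]
    refine mul_dvd_mul_left _ (X_dvd_iff.mpr ?_)
    rwa [coeff_zero_eq_eval_zero]

lemma isBigO_of_X_pow_dvd {P : ℝ[X]} {m : ℕ} (h : X ^ m ∣ P) :
    (fun τ => P.eval τ) =O[𝓝[>] 0] (fun τ : ℝ => τ ^ m) := by
  obtain ⟨Q, rfl⟩ := h
  refine ((isBigO_refl (fun τ : ℝ => τ ^ m) _).mul (EqMod.isBigO_one Q)).congr (fun τ => ?_)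
    fun τ => mul_one _
  simp

/-- The bridge from asymptotics to algebra: below the precision K, the vanishing order of f is read
off the polynomial. -/
lemma EqMod.isBigO_iff {K m : ℕ} {f : ℝ → ℝ} {P : ℝ[X]} (h : EqMod K f P) (hm : m ≤ K) :
    f =O[𝓝[>] 0] (fun τ : ℝ => τ ^ m) ↔ X ^ m ∣ P := by
  have h' := IsBigO.trans h (isBigO_pow_of_le hm)
  constructor
  · intro hf
    refine X_pow_dvd_of_isBigO ((hf.sub h').congr_left fun τ => ?_)
    ring
  · intro hP
    refine ((isBigO_of_X_pow_dvd hP).add h').congr_left fun τ => ?_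
    ring

/-- Bounded continuous functions on `(0,1)`, the coefficient algebra of the expansions. -/
def UnitFun : Type := BoundedContinuousFunction (Ioo (0 : ℝ) 1) ℝ

namespace UnitFun

instance : CommRing UnitFun :=
  inferInstanceAs (CommRing (BoundedContinuousFunction (Ioo (0 : ℝ) 1) ℝ))

instance : Algebra ℝ UnitFun :=
  inferInstanceAs (Algebra ℝ (BoundedContinuousFunction (Ioo (0 : ℝ) 1) ℝ))

instance : FunLike UnitFun (Ioo (0 : ℝ) 1) ℝ :=
  inferInstanceAs (FunLike (BoundedContinuousFunction (Ioo (0 : ℝ) 1) ℝ) (Ioo (0 : ℝ) 1) ℝ)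

@[ext] lemma ext {f g : UnitFun} (h : ∀ x, f x = g x) : f = g := DFunLike.ext f g h

lemma add_apply (f g : UnitFun) (x : Ioo (0 : ℝ) 1) : (f + g) x = f x + g x := rfl

lemma one_apply (x : Ioo (0 : ℝ) 1) : (1 : UnitFun) x = 1 := rfl

lemma smul_apply (c : ℝ) (f : UnitFun) (x : Ioo (0 : ℝ) 1) : (c • f) x = c * f x := rfl

lemma continuous (f : UnitFun) : Continuous f := BoundedContinuousFunction.continuous f

lemma exists_bound (f : UnitFun) : ∃ C, 0 ≤ C ∧ ∀ x, |f x| ≤ C :=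
  ⟨_, norm_nonneg _, BoundedContinuousFunction.norm_coe_le_norm f⟩

/-- A continuous function on `(0,1)` bounded by `C`. -/
def mk (f : Ioo (0 : ℝ) 1 → ℝ) (hf : Continuous f) (C : ℝ) (hC : ∀ x, |f x| ≤ C) : UnitFun :=
  BoundedContinuousFunction.ofNormedAddCommGroup f hf C hC

end UnitFun

/-- Evaluation of a bounded continuous function at a point, as an algebra homomorphism. -/
def evalPt (x : Ioo (0 : ℝ) 1) : UnitFun →ₐ[ℝ] ℝ where
  toFun f := f x
  map_one' := rfl
  map_mul' _ _ := rfl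
  map_zero' := rfl
  map_add' _ _ := rfl
  commutes' c := by
    rw [Algebra.algebraMap_eq_smul_one]
    exact mul_one c

lemma evalPt_apply (x : Ioo (0 : ℝ) 1) (f : UnitFun) : evalPt x f = f x := rfl

/-- Evaluation of a polynomial in `τ` with coefficients in `UnitFun` at `(τ, x)`. -/
def ev (τ : ℝ) (x : Ioo (0 : ℝ) 1) : UnitFun[X] →ₐ[ℝ] ℝ :=
  eval₂AlgHom (evalPt x) τ fun _ => Commute.all _ _

lemma ev_monomial (τ : ℝ) (x : Ioo (0 : ℝ) 1) (n : ℕ) (f : UnitFun) :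
    ev τ x (monomial n f) = f x * τ ^ n := by
  simp [ev, evalPt_apply]

lemma ev_aeval (τ : ℝ) (x : Ioo (0 : ℝ) 1) (Z : UnitFun[X]) (T : ℝ[X]) :
    ev τ x (aeval Z T) = T.eval (ev τ x Z) := by
  rw [← aeval_algHom_apply, coe_aeval_eq_eval]

lemma continuous_ev (τ : ℝ) (Q : UnitFun[X]) : Continuous fun x => ev τ x Q := by
  induction Q using Polynomial.induction_on' with
  | add p q hp hq => simpa only [map_add] using Continuous.fun_add hp hq
  | monomial n a => simpa only [ev_monomial] using a.continuous.fun_mul continuous_const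

lemma exists_ev_bound (Q : UnitFun[X]) :
    ∃ C, 0 ≤ C ∧ ∀ τ ∈ Ioc (0 : ℝ) 1, ∀ x, |ev τ x Q| ≤ C := by
  induction Q using Polynomial.induction_on' with
  | add p q hp hq =>
    obtain ⟨C, hC0, hC⟩ := hp
    obtain ⟨D, hD0, hD⟩ := hq
    refine ⟨C + D, add_nonneg hC0 hD0, fun τ hτ x => ?_⟩
    rw [map_add]
    exact (abs_add_le _ _).trans (add_le_add (hC τ hτ x) (hD τ hτ x))
  | monomial n a =>
    obtain ⟨C, hC0, hC⟩ := a.exists_bound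
    refine ⟨C, hC0, fun τ hτ x => ?_⟩
    rw [ev_monomial, abs_mul, abs_pow, abs_of_pos hτ.1]
    exact mul_le_of_le_one_right hC0 (pow_le_one₀ hτ.1.le hτ.2) |>.trans' <|
      mul_le_mul_of_nonneg_right (hC x) (pow_nonneg hτ.1.le _)

lemma exists_ev_bound_of_X_dvd {Q : UnitFun[X]} (h : X ∣ Q) :
    ∃ C, 0 ≤ C ∧ ∀ τ ∈ Ioc (0 : ℝ) 1, ∀ x, |ev τ x Q| ≤ C * τ := by
  obtain ⟨R, rfl⟩ := h
  obtain ⟨C, hC0, hC⟩ := exists_ev_bound R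
  refine ⟨C, hC0, fun τ hτ x => ?_⟩
  rw [map_mul, show (X : UnitFun[X]) = monomial 1 1 from rfl, ev_monomial, abs_mul]
  simp only [UnitFun.one_apply, one_mul, pow_one, abs_of_pos hτ.1]
  rw [mul_comm]
  exact mul_le_mul_of_nonneg_right (hC τ hτ x) hτ.1.le

lemma integrable_weight_mul {ρ : Ioo (0 : ℝ) 1 → ℝ} (hρ : Integrable ρ) {f : Ioo (0 : ℝ) 1 → ℝ}
    (hf : Continuous f) {C : ℝ} (hC : ∀ x, |f x| ≤ C) : Integrable fun x => ρ x * f x := by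
  refine (hρ.bdd_mul (c := C) hf.aestronglyMeasurable (Eventually.of_forall hC)).congr ?_
  exact Eventually.of_forall fun x => mul_comm _ _

/-- Integration against an integrable weight. -/
def weightedIntegral {ρ : Ioo (0 : ℝ) 1 → ℝ} (hρ : Integrable ρ) : UnitFun →ₗ[ℝ] ℝ where
  toFun f := ∫ x, ρ x * f x
  map_add' f g := by
    obtain ⟨C, -, hC⟩ := f.exists_bound
    obtain ⟨D, -, hD⟩ := g.exists_bound
    simp only [UnitFun.add_apply, mul_add]
    exact integral_add (integrable_weight_mul hρ f.continuous hC)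
      (integrable_weight_mul hρ g.continuous hD)
  map_smul' c f := by
    simp only [UnitFun.smul_apply, smul_eq_mul, RingHom.id_apply,
      ← integral_const_mul]
    congr 1
    ext x
    ring

/-- Apply a linear functional to every coefficient of a polynomial. -/
def mapCoeff (L : UnitFun →ₗ[ℝ] ℝ) : UnitFun[X] →ₗ[ℝ] ℝ[X] :=
  lsum fun n => (monomial n).comp L

lemma mapCoeff_monomial (L : UnitFun →ₗ[ℝ] ℝ) (n : ℕ) (f : UnitFun) :
    mapCoeff L (monomial n f) = monomial n (L f) := by
  simp [mapCoeff, lsum_apply]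

lemma coeff_mapCoeff (L : UnitFun →ₗ[ℝ] ℝ) (Q : UnitFun[X]) (n : ℕ) :
    (mapCoeff L Q).coeff n = L (Q.coeff n) := by
  induction Q using Polynomial.induction_on' with
  | add p q hp hq => simp [hp, hq]
  | monomial m a =>
    rw [mapCoeff_monomial, coeff_monomial, coeff_monomial]
    split_ifs <;> simp

lemma X_pow_dvd_mapCoeff (L : UnitFun →ₗ[ℝ] ℝ) {Q : UnitFun[X]} {m : ℕ} (h : X ^ m ∣ Q) :
    X ^ m ∣ mapCoeff L Q := by
  rw [X_pow_dvd_iff] at h ⊢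
  intro d hd
  rw [coeff_mapCoeff, h d hd, map_zero]

lemma eval_mapCoeff_weightedIntegral {ρ : Ioo (0 : ℝ) 1 → ℝ} (hρ : Integrable ρ)
    (Q : UnitFun[X]) {τ : ℝ} (hτ : τ ∈ Ioc (0 : ℝ) 1) :
    (mapCoeff (weightedIntegral hρ) Q).eval τ = ∫ x, ρ x * ev τ x Q := by
  induction Q using Polynomial.induction_on' with
  | add p q hp hq =>
    obtain ⟨C, -, hC⟩ := exists_ev_bound p
    obtain ⟨D, -, hD⟩ := exists_ev_bound q
    rw [map_add, eval_add, hp, hq, ← integral_add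
      (integrable_weight_mul hρ (continuous_ev τ p) (hC τ hτ))
      (integrable_weight_mul hρ (continuous_ev τ q) (hD τ hτ))]
    simp only [map_add, mul_add]
  | monomial n a =>
    rw [mapCoeff_monomial, eval_monomial]
    simp only [ev_monomial, ← mul_assoc, integral_mul_const]
    rfl

/-- Because X divides Z, |Z| ≤ cτ uniformly in x. The Taylor remainder of Φ is therefore O(τ^K)
uniformly in x, and integrating it against the integrable weight preserves the bound. -/
lemma kernel_expansion {ρ : Ioo (0 : ℝ) 1 → ℝ} (hρ : Integrable ρ) {Φ : ℝ → ℝ}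
    (hΦ : ContDiff ℝ ∞ Φ) {Z : UnitFun[X]} (hZ : X ∣ Z) (B : UnitFun[X]) (K : ℕ) :
    EqMod K (fun τ => ∫ x, ρ x * (Φ (ev τ x Z) * ev τ x B))
      (mapCoeff (weightedIntegral hρ) (aeval Z (taylorPoly Φ K) * B)) := by
  obtain ⟨c, hc0, hc⟩ := exists_ev_bound_of_X_dvd hZ
  obtain ⟨D, hD0, hD⟩ := exists_ev_bound B
  obtain ⟨C, hC0, hC⟩ := exists_taylorPoly_bound hΦ K c
  obtain ⟨E, -, hE⟩ := exists_ev_bound (aeval Z (taylorPoly Φ K) * B)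
  refine IsBigO.of_bound ((∫ x, |ρ x|) * (C * c ^ K * D)) ?_
  filter_upwards [Ioc_mem_nhdsGT (zero_lt_one (α := ℝ))] with τ hτ
  have hz : ∀ x, |ev τ x Z| ≤ c := fun x =>
    (hc τ hτ x).trans (mul_le_of_le_one_right hc0 hτ.2)
  have hdiff : ∀ x, |Φ (ev τ x Z) * ev τ x B - ev τ x (aeval Z (taylorPoly Φ K) * B)| ≤
      C * c ^ K * D * τ ^ K := by
    intro x
    rw [map_mul, ev_aeval, ← sub_mul, abs_mul]
    calc _ ≤ (C * |ev τ x Z| ^ K) * D :=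
          mul_le_mul (hC _ (hz x)) (hD τ hτ x) (abs_nonneg _) (by positivity)
      _ ≤ (C * (c * τ) ^ K) * D := by
          gcongr
          exact hc τ hτ x
      _ = _ := by rw [mul_pow]; ring
  have hcont : Continuous fun x => Φ (ev τ x Z) * ev τ x B :=
    (hΦ.continuous.comp (continuous_ev τ Z)).mul (continuous_ev τ B)
  have i1 : Integrable fun x => ρ x * (Φ (ev τ x Z) * ev τ x B) := by
    refine integrable_weight_mul hρ hcont (C := C * c ^ K * D * τ ^ K + E) fun x => ?_
    have h1 := hdiff x
    have h2 := hE τ hτ x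
    calc _ ≤ |Φ (ev τ x Z) * ev τ x B - ev τ x (aeval Z (taylorPoly Φ K) * B)| +
          |ev τ x (aeval Z (taylorPoly Φ K) * B)| := by
            simpa using abs_add_le (Φ (ev τ x Z) * ev τ x B -
              ev τ x (aeval Z (taylorPoly Φ K) * B)) (ev τ x (aeval Z (taylorPoly Φ K) * B))
      _ ≤ _ := add_le_add h1 h2
  have i2 := integrable_weight_mul hρ (continuous_ev τ (aeval Z (taylorPoly Φ K) * B)) (hE τ hτ)
  rw [eval_mapCoeff_weightedIntegral hρ _ hτ, ← integral_sub i1 i2]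
  calc _ ≤ ∫ x, |ρ x| * (C * c ^ K * D * τ ^ K) := by
        refine norm_integral_le_of_norm_le (hρ.abs.mul_const _) (Eventually.of_forall fun x => ?_)
        rw [← mul_sub, norm_mul]
        exact mul_le_mul_of_nonneg_left (hdiff x) (abs_nonneg _)
    _ = _ := by
        rw [integral_mul_const, Real.norm_eq_abs, abs_of_nonneg (pow_nonneg hτ.1.le _)]
        ring

lemma comp_expansion {Φ : ℝ → ℝ} (hΦ : ContDiff ℝ ∞ Φ) {w : ℝ[X]} (hw : X ∣ w) (K : ℕ) :
    EqMod K (fun τ => Φ (w.eval τ)) (aeval w (taylorPoly Φ K)) := by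
  obtain ⟨C, hC0, hC⟩ := exists_taylorPoly_bound hΦ K 1
  have hwO : (fun τ => w.eval τ) =O[𝓝[>] 0] (fun τ : ℝ => τ) := by
    simpa using isBigO_of_X_pow_dvd (m := 1) (by simpa using hw)
  have hwt : Tendsto (fun τ => w.eval τ) (𝓝[>] 0) (𝓝 0) :=
    hwO.trans_tendsto (tendsto_id.mono_left nhdsWithin_le_nhds)
  refine IsBigO.trans (IsBigO.of_bound C ?_) (hwO.pow K)
  have hev : ∀ᶠ τ in 𝓝[>] (0 : ℝ), |w.eval τ| ≤ 1 := by
    have := hwt.abs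
    rw [abs_zero] at this
    exact this.eventually_le_const zero_lt_one
  filter_upwards [hev] with τ hτ
  have h1 : (aeval w (taylorPoly Φ K)).eval τ = (taylorPoly Φ K).eval (w.eval τ) := by
    rw [← coe_aeval_eq_eval, ← aeval_algHom_apply]
    simp [coe_aeval_eq_eval]
  rw [h1]
  simpa using hC _ hτ

end ThinFilm
end

/-! ### Expansion of the integrals against the initial datum. -/

noncomputable section

namespace ThinFilm

open scoped SchwartzMap
open Polynomial

/-- The `k`-th Taylor coefficient at `0` of a function on the half-line. -/
def halfTaylor (u₀ : ℝ → ℝ) (k : ℕ) : ℝ := iteratedDerivWithin k u₀ (Ici 0) 0 / k.factorial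

/-- Taylor's theorem is used only on [0,1]. Beyond 1 no pointwise growth of u₀ is assumed, so |u₀ y|
itself stays in the bound, to be integrated later through temperedness. -/
lemma exists_halfTaylor_bound {u₀ : ℝ → ℝ} (hu : ContDiffOn ℝ ∞ u₀ (Ici 0)) (n : ℕ) :
    ∃ C, 0 ≤ C ∧ ∀ y, 0 ≤ y →
      |u₀ y - ∑ k ∈ Finset.range (n + 1), halfTaylor u₀ k * y ^ k| ≤
        C * y ^ (n + 1) + if 1 < y then |u₀ y| else 0 := by
  obtain ⟨C, hC⟩ := exists_taylor_mean_remainder_bound (f := u₀) (a := 0) (b := 1) (n := n)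
    zero_le_one ((hu.mono Icc_subset_Ici_self).of_le (by exact_mod_cast le_top))
  -- The two sets coincide near 0.
  have hset : ∀ k, iteratedDerivWithin k u₀ (Icc 0 1) 0 = iteratedDerivWithin k u₀ (Ici 0) 0 := by
    intro k
    rw [iteratedDerivWithin_eq_iteratedFDerivWithin, iteratedDerivWithin_eq_iteratedFDerivWithin]
    congr 1
    refine iteratedFDerivWithin_congr_set ?_ k
    filter_upwards [Iio_mem_nhds (zero_lt_one (α := ℝ))] with y hy
    simp only [eq_iff_iff]
    exact ⟨fun h => h.1, fun h => ⟨h, le_of_lt hy⟩⟩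
  have htay : ∀ y, taylorWithinEval u₀ n (Icc 0 1) 0 y =
      ∑ k ∈ Finset.range (n + 1), halfTaylor u₀ k * y ^ k := by
    intro y
    rw [taylor_within_apply]
    refine Finset.sum_congr rfl fun k _ => ?_
    rw [hset, halfTaylor, sub_zero, smul_eq_mul]
    ring
  set D := ∑ k ∈ Finset.range (n + 1), |halfTaylor u₀ k| with hD
  have hD0 : 0 ≤ D := Finset.sum_nonneg fun _ _ => abs_nonneg _
  refine ⟨max C 0 + D, add_nonneg (le_max_right _ _) hD0, fun y hy => ?_⟩
  rcases le_or_gt y 1 with h | h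
  · have h1 := hC y ⟨hy, h⟩
    rw [htay, sub_zero, Real.norm_eq_abs] at h1
    rw [if_neg (not_lt.mpr h), add_zero]
    refine h1.trans (mul_le_mul_of_nonneg_right ?_ (by positivity))
    linarith [le_max_left C 0]
  · rw [if_pos h]
    have h1 : |∑ k ∈ Finset.range (n + 1), halfTaylor u₀ k * y ^ k| ≤ D * y ^ (n + 1) := by
      rw [hD, Finset.sum_mul]
      refine (Finset.abs_sum_le_sum_abs _ _).trans (Finset.sum_le_sum fun k hk => ?_)
      rw [abs_mul, abs_of_nonneg (pow_nonneg hy k)]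
      exact mul_le_mul_of_nonneg_left
        (pow_le_pow_right₀ h.le (Finset.mem_range.mp hk).le) (abs_nonneg _)
    have h2 := abs_sub (u₀ y) (∑ k ∈ Finset.range (n + 1), halfTaylor u₀ k * y ^ k)
    have h3 : 0 ≤ max C 0 * y ^ (n + 1) := mul_nonneg (le_max_right _ _) (by positivity)
    rw [add_mul]
    linarith

/-- For |w| ≤ 1 one has 1 + η ≤ 2(1 + |w - η|), so the Schwartz decay in η is uniform in the shift.
-/
lemma exists_schwartz_shift_bound (Φ : 𝓢(ℝ, ℝ)) (m : ℕ) :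
    ∃ C, 0 ≤ C ∧ ∀ w η : ℝ, |w| ≤ 1 → 0 ≤ η → |Φ (w - η)| * (1 + η) ^ m ≤ C := by
  have h := fun x => SchwartzMap.one_add_le_sup_seminorm_apply (𝕜 := ℝ) (m := (m, 0))
    (le_refl m) (le_refl 0) Φ x
  simp only [norm_iteratedFDeriv_zero] at h
  set E := 2 ^ m * (((Finset.Iic ((m, 0) : ℕ × ℕ)).sup
    fun m => SchwartzMap.seminorm ℝ m.1 m.2) Φ) with hE
  have hE0 : 0 ≤ E := by rw [hE]; positivity
  refine ⟨2 ^ m * E, by positivity, fun w η hw hη => ?_⟩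
  have h1 : 1 + η ≤ 2 * (1 + ‖w - η‖) := by
    rw [Real.norm_eq_abs]
    have := neg_abs_le (w - η)
    have := neg_abs_le w
    have := abs_nonneg (w - η)
    have := le_abs_self w
    linarith
  calc |Φ (w - η)| * (1 + η) ^ m ≤ |Φ (w - η)| * (2 * (1 + ‖w - η‖)) ^ m := by gcongr
    _ = 2 ^ m * ((1 + ‖w - η‖) ^ m * ‖Φ (w - η)‖) := by
      rw [mul_pow, Real.norm_eq_abs (Φ _)]; ring
    _ ≤ 2 ^ m * E := by gcongr; exact h _

/-- Two powers of decay are traded for the integrable majorant 1/(1+η²). -/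
lemma inv_one_add_sq_bound {η : ℝ} (hη : 0 ≤ η) {a C : ℝ} {m k : ℕ} (hmk : k + 2 ≤ m)
    (h : |a| * (1 + η) ^ m ≤ C) : |a| * (1 + η) ^ k ≤ C * (1 + η ^ 2)⁻¹ := by
  have h1 : (1 + η ^ 2) * (1 + η) ^ k ≤ (1 + η) ^ m := by
    calc (1 + η ^ 2) * (1 + η) ^ k ≤ (1 + η) ^ 2 * (1 + η) ^ k := by
          gcongr; nlinarith
      _ = (1 + η) ^ (k + 2) := by ring
      _ ≤ (1 + η) ^ m := pow_le_pow_right₀ (by linarith) hmk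
  rw [← div_eq_mul_inv, le_div_iff₀ (by positivity), mul_assoc, mul_comm _ (1 + η ^ 2)]
  exact (mul_le_mul_of_nonneg_left h1 (abs_nonneg a)).trans h

lemma integrableOn_schwartz_shift (Φ : 𝓢(ℝ, ℝ)) (k : ℕ) :
    IntegrableOn (fun η => Φ (-η) * η ^ k) (Ioi 0) := by
  obtain ⟨C, -, hC⟩ := exists_schwartz_shift_bound Φ (k + 2)
  refine Integrable.mono' (integrable_inv_one_add_sq.const_mul C).integrableOn ?_ ?_
  · have := Φ.continuous
    exact Continuous.aestronglyMeasurable (by fun_prop)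
  · refine (ae_restrict_iff' measurableSet_Ioi).mpr (Eventually.of_forall fun η hη => ?_)
    have hη0 : (0 : ℝ) ≤ η := le_of_lt hη
    have h1 := hC 0 η (by simp) hη0
    rw [zero_sub] at h1
    refine le_trans ?_ (inv_one_add_sq_bound hη0 le_rfl h1)
    rw [norm_mul, norm_pow, Real.norm_eq_abs, Real.norm_eq_abs, abs_of_nonneg hη0]
    gcongr
    linarith

/-- The scaled moment `(1/j!) ∫_0^∞ Φ^{(j)}(-η) η^k dη`. -/
def moment (Φ : 𝓢(ℝ, ℝ)) (j k : ℕ) : ℝ :=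
  (∫ η in Ioi (0 : ℝ), iterDerivS j Φ (-η) * η ^ k) / j.factorial

/-- The expansion of `∫_0^∞ Φ(w - η) u₀(τη) dη` in powers of `τ`. -/
def dataPoly (u₀ : ℝ → ℝ) (Φ : 𝓢(ℝ, ℝ)) (K : ℕ) (w : ℝ[X]) : ℝ[X] :=
  ∑ k ∈ Finset.range K, C (halfTaylor u₀ k) * X ^ k *
    aeval w (∑ j ∈ Finset.range K, C (moment Φ j k) * X ^ j)

lemma dataPoly_eval (u₀ : ℝ → ℝ) (Φ : 𝓢(ℝ, ℝ)) (K : ℕ) (w : ℝ[X]) (τ : ℝ) :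
    (dataPoly u₀ Φ K w).eval τ = ∫ η in Ioi (0 : ℝ), ∑ k ∈ Finset.range K,
      halfTaylor u₀ k * τ ^ k * η ^ k *
        ∑ j ∈ Finset.range K, iterDerivS j Φ (-η) / j.factorial * (w.eval τ) ^ j := by
  have hi : ∀ k j, IntegrableOn (fun η => halfTaylor u₀ k * τ ^ k * (w.eval τ) ^ j / j.factorial *
      (iterDerivS j Φ (-η) * η ^ k)) (Ioi 0) :=
    fun k j => (integrableOn_schwartz_shift (iterDerivS j Φ) k).const_mul _
  have he : ∀ η : ℝ, (∑ k ∈ Finset.range K, halfTaylor u₀ k * τ ^ k * η ^ k *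
        ∑ j ∈ Finset.range K, iterDerivS j Φ (-η) / j.factorial * (w.eval τ) ^ j) =
      ∑ k ∈ Finset.range K, ∑ j ∈ Finset.range K,
        halfTaylor u₀ k * τ ^ k * (w.eval τ) ^ j / j.factorial *
          (iterDerivS j Φ (-η) * η ^ k) := by
    intro η
    refine Finset.sum_congr rfl fun k _ => ?_
    rw [Finset.mul_sum]
    refine Finset.sum_congr rfl fun j _ => ?_
    ring
  simp only [he]
  rw [integral_finsetSum _ fun k _ => integrable_finsetSum _ fun j _ => hi k j]
  simp only [dataPoly, eval_finsetSum, eval_mul, eval_C, eval_pow, eval_X, map_sum, map_mul,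
    map_pow, aeval_X, aeval_C, Polynomial.algebraMap_eq]
  refine Finset.sum_congr rfl fun k _ => ?_
  rw [integral_finsetSum _ fun j _ => hi k j, Finset.mul_sum]
  refine Finset.sum_congr rfl fun j _ => ?_
  rw [integral_const_mul, moment]
  ring

lemma data_integrableOn {u₀ : ℝ → ℝ} (hu : ContinuousOn u₀ (Ici 0)) {K₀ : ℕ}
    (hK₀ : IntegrableOn (fun x : ℝ => u₀ x / (1 + x) ^ K₀) (Ioi 0)) (Φ : 𝓢(ℝ, ℝ)) {τ w : ℝ}
    (hτ : τ ∈ Ioc (0 : ℝ) 1) (hw : |w| ≤ 1) :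
    IntegrableOn (fun η => Φ (w - η) * u₀ (τ * η)) (Ioi 0) := by
  obtain ⟨C, hC0, hC⟩ := exists_schwartz_shift_bound Φ K₀
  have hU : IntegrableOn (fun η => u₀ (τ * η) / (1 + τ * η) ^ K₀) (Ioi 0) := by
    have := (integrableOn_Ioi_comp_mul_left_iff (fun x : ℝ => u₀ x / (1 + x) ^ K₀) 0 hτ.1).mpr
    rw [mul_zero] at this
    exact this hK₀
  refine Integrable.mono' (hU.norm.const_mul C) ?_ ?_
  · refine ContinuousOn.aestronglyMeasurable (ContinuousOn.mul ?_ ?_) measurableSet_Ioi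
    · have := Φ.continuous
      exact Continuous.continuousOn (by fun_prop)
    · exact hu.comp (by fun_prop) fun η hη => mul_nonneg hτ.1.le (le_of_lt hη)
  · refine (ae_restrict_iff' measurableSet_Ioi).mpr (Eventually.of_forall fun η hη => ?_)
    have hη0 : (0 : ℝ) ≤ η := le_of_lt hη
    have h1 := hC w η hw hη0
    have hp : 0 < 1 + τ * η := by have := mul_nonneg hτ.1.le hη0; linarith
    have h2 : 1 + τ * η ≤ 1 + η := by nlinarith [hτ.2]
    rw [norm_mul, norm_div, norm_pow, Real.norm_eq_abs, Real.norm_eq_abs, Real.norm_eq_abs,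
      abs_of_pos hp, mul_div_assoc', le_div_iff₀ (by positivity)]
    calc |Φ (w - η)| * |u₀ (τ * η)| * (1 + τ * η) ^ K₀
        ≤ |Φ (w - η)| * |u₀ (τ * η)| * (1 + η) ^ K₀ := by gcongr
      _ = |Φ (w - η)| * (1 + η) ^ K₀ * |u₀ (τ * η)| := by ring
      _ ≤ C * |u₀ (τ * η)| := by gcongr

/-- There are two errors, from expanding u₀(τη) at 0 and Φ(w - η) at -η. Each is τ^K times an
integrable function of η, apart from the region τη > 1, where rapid decay of Φ beats the tempered
growth of u₀. -/
lemma data_expansion {u₀ : ℝ → ℝ} (hu : ContDiffOn ℝ ∞ u₀ (Ici 0)) {K₀ : ℕ}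
    (hK₀ : IntegrableOn (fun x : ℝ => u₀ x / (1 + x) ^ K₀) (Ioi 0)) (Φ : 𝓢(ℝ, ℝ)) {w : ℝ[X]}
    (hw : X ∣ w) (n : ℕ) :
    EqMod (n + 1) (fun τ => ∫ η in Ioi (0 : ℝ), Φ (w.eval τ - η) * u₀ (τ * η))
      (dataPoly u₀ Φ (n + 1) w) := by
  set K := n + 1 with hK
  obtain ⟨cu, hcu0, hcu⟩ := exists_halfTaylor_bound hu n
  obtain ⟨c1, hc10, hc1⟩ := exists_schwartz_shift_bound Φ (K + 2)
  -- The exponent K₀ absorbs the tempered weight. The exponent K + 1, rather than K, compensates the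
  -- factor 1/τ produced by rescaling the integral of |U(τη)|.
  obtain ⟨c2, hc20, hc2⟩ := exists_schwartz_shift_bound Φ (K₀ + (K + 1))
  obtain ⟨c3, hc30, hc3⟩ := exists_schwartz_shift_bound (iterDerivS K Φ) (K + 2)
  set D := ∑ k ∈ Finset.range K, |halfTaylor u₀ k| with hD
  have hD0 : 0 ≤ D := Finset.sum_nonneg fun _ _ => abs_nonneg _
  have hwO : (fun τ => w.eval τ) =O[𝓝[>] 0] (fun τ : ℝ => τ) := by
    simpa using isBigO_of_X_pow_dvd (m := 1) (by simpa using hw)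
  have hwt : Tendsto (fun τ => w.eval τ) (𝓝[>] 0) (𝓝 0) :=
    hwO.trans_tendsto (tendsto_id.mono_left nhdsWithin_le_nhds)
  obtain ⟨cw, hcw0, hcw⟩ := hwO.exists_nonneg
  rw [isBigOWith_iff] at hcw
  set U : ℝ → ℝ := fun x => u₀ x / (1 + x) ^ K₀ with hUdef
  refine IsBigO.of_bound ((c1 * cu + c3 * cw ^ K * D) * (∫ η in Ioi (0 : ℝ), (1 + η ^ 2)⁻¹) +
    c2 * ∫ y in Ioi (0 : ℝ), |U y|) ?_
  have hev : ∀ᶠ τ in 𝓝[>] (0 : ℝ), |w.eval τ| ≤ 1 := by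
    have := hwt.abs
    rw [abs_zero] at this
    exact this.eventually_le_const zero_lt_one
  filter_upwards [Ioc_mem_nhdsGT (zero_lt_one (α := ℝ)), hev, hcw] with τ hτ hw1 hwτ
  rw [Real.norm_eq_abs, Real.norm_eq_abs, abs_of_pos hτ.1] at hwτ
  have hUi : IntegrableOn (fun η => U (τ * η)) (Ioi 0) := by
    have := (integrableOn_Ioi_comp_mul_left_iff U 0 hτ.1).mpr
    rw [mul_zero] at this
    exact this hK₀
  have i1 := data_integrableOn hu.continuousOn hK₀ Φ hτ hw1
  have i2 : IntegrableOn (fun η : ℝ => ∑ k ∈ Finset.range K, halfTaylor u₀ k * τ ^ k * η ^ k *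
        ∑ j ∈ Finset.range K, iterDerivS j Φ (-η) / j.factorial * (w.eval τ) ^ j) (Ioi 0) := by
    simp only [Finset.mul_sum]
    refine integrable_finsetSum _ fun k _ => integrable_finsetSum _ fun j _ => ?_
    refine ((integrableOn_schwartz_shift (iterDerivS j Φ) k).const_mul
      (halfTaylor u₀ k * τ ^ k * (w.eval τ) ^ j / j.factorial)).congr
      (Eventually.of_forall fun η => ?_)
    simp only
    ring
  rw [dataPoly_eval, ← integral_sub i1 i2]
  have i3 : IntegrableOn (fun η : ℝ => τ ^ K * (c1 * cu + c3 * cw ^ K * D) * (1 + η ^ 2)⁻¹ +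
      c2 * τ ^ (K + 1) * |U (τ * η)|) (Ioi 0) :=
    (integrable_inv_one_add_sq.const_mul _).integrableOn.add (hUi.abs.const_mul _)
  refine (norm_integral_le_of_norm_le i3 ((ae_restrict_iff' measurableSet_Ioi).mpr
    (Eventually.of_forall fun η hη => ?_))).trans (le_of_eq ?_)
  · have hη0 : (0 : ℝ) ≤ η := le_of_lt hη
    have hτη : 0 ≤ τ * η := mul_nonneg hτ.1.le hη0
    set P := ∑ k ∈ Finset.range K, halfTaylor u₀ k * (τ * η) ^ k with hP
    set S := ∑ j ∈ Finset.range K, iterDerivS j Φ (-η) / j.factorial * (w.eval τ) ^ j with hS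
    have hsum : ∑ k ∈ Finset.range K, halfTaylor u₀ k * τ ^ k * η ^ k * S = P * S := by
      rw [hP, Finset.sum_mul]
      exact Finset.sum_congr rfl fun k _ => by rw [mul_pow]; ring
    rw [hsum]
    have hPb : |P| ≤ D * (1 + η) ^ K := by
      rw [hP, hD, Finset.sum_mul]
      refine (Finset.abs_sum_le_sum_abs _ _).trans (Finset.sum_le_sum fun k hk => ?_)
      rw [abs_mul, abs_of_nonneg (pow_nonneg hτη k)]
      refine mul_le_mul_of_nonneg_left ?_ (abs_nonneg _)
      calc (τ * η) ^ k ≤ (1 + η) ^ k := by gcongr; nlinarith [hτ.2]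
        _ ≤ (1 + η) ^ K := pow_le_pow_right₀ (by linarith) (Finset.mem_range.mp hk).le
    have hTay : |Φ (w.eval τ - η) - S| * (1 + η) ^ (K + 2) ≤ c3 * (cw ^ K * τ ^ K) := by
      have h1 := abs_sub_taylor_sum_le (Φ.smooth ⊤) K (a := -η) (r := 1)
        (C := c3 / (1 + η) ^ (K + 2)) (fun y hy => by
          rw [← coe_iterDerivS, le_div_iff₀ (by positivity)]
          have := hc3 (y + η) η (by simpa using hy) hη0
          simpa using this) hw1
      simp only [← coe_iterDerivS] at h1
      rw [neg_add_eq_sub, ← hS, div_mul_eq_mul_div, le_div_iff₀ (by positivity)] at h1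
      refine h1.trans (mul_le_mul_of_nonneg_left ?_ hc30)
      rw [← mul_pow]
      gcongr
    have h1 : |(Φ (w.eval τ - η) - S)| * |P| ≤ τ ^ K * (c3 * cw ^ K * D) * (1 + η ^ 2)⁻¹ := by
      have := inv_one_add_sq_bound hη0 le_rfl hTay
      calc _ ≤ |(Φ (w.eval τ - η) - S)| * (D * (1 + η) ^ K) := by gcongr
        _ = D * (|(Φ (w.eval τ - η) - S)| * (1 + η) ^ K) := by ring
        _ ≤ D * (c3 * (cw ^ K * τ ^ K) * (1 + η ^ 2)⁻¹) := by gcongr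
        _ = _ := by ring
    have h2 : |Φ (w.eval τ - η)| * |u₀ (τ * η) - P| ≤
        τ ^ K * (c1 * cu) * (1 + η ^ 2)⁻¹ + c2 * τ ^ (K + 1) * |U (τ * η)| := by
      have hu1 := hcu (τ * η) hτη
      rw [← hK, ← hP] at hu1
      have ha : |Φ (w.eval τ - η)| * (cu * (τ * η) ^ K) ≤
          τ ^ K * (c1 * cu) * (1 + η ^ 2)⁻¹ := by
        have := inv_one_add_sq_bound hη0 le_rfl (hc1 _ η hw1 hη0)
        calc _ = cu * τ ^ K * (|Φ (w.eval τ - η)| * η ^ K) := by rw [mul_pow]; ring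
          _ ≤ cu * τ ^ K * (|Φ (w.eval τ - η)| * (1 + η) ^ K) := by
            have : 0 < τ := hτ.1
            gcongr
            linarith
          _ ≤ cu * τ ^ K * (c1 * (1 + η ^ 2)⁻¹) := by
            have : 0 < τ := hτ.1
            gcongr
          _ = _ := by ring
      have hb : |Φ (w.eval τ - η)| * (if 1 < τ * η then |u₀ (τ * η)| else 0) ≤
          c2 * τ ^ (K + 1) * |U (τ * η)| := by
        have hτ0 : 0 < τ := hτ.1
        split_ifs with hlt
        · have hp : 0 < 1 + τ * η := by linarith
          rw [hUdef]
          simp only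
          rw [abs_div, abs_of_pos (pow_pos hp K₀), mul_div_assoc', le_div_iff₀ (by positivity)]
          have h3 := hc2 _ η hw1 hη0
          rw [pow_add] at h3
          have h4 : (1 + τ * η) ^ K₀ ≤ (1 + η) ^ K₀ := by
            gcongr
            nlinarith [hτ.2]
          -- Where τη > 1, powers of τ are bought with powers of 1 + η.
          have h5 : 1 ≤ τ ^ (K + 1) * (1 + η) ^ (K + 1) := by
            rw [← mul_pow]
            exact one_le_pow₀ (by nlinarith)
          calc |Φ (w.eval τ - η)| * |u₀ (τ * η)| * (1 + τ * η) ^ K₀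
              ≤ |Φ (w.eval τ - η)| * |u₀ (τ * η)| * (1 + η) ^ K₀ * 1 := by
                rw [mul_one]; gcongr
            _ ≤ |Φ (w.eval τ - η)| * |u₀ (τ * η)| * (1 + η) ^ K₀ *
                  (τ ^ (K + 1) * (1 + η) ^ (K + 1)) := by gcongr
            _ = |Φ (w.eval τ - η)| * ((1 + η) ^ K₀ * (1 + η) ^ (K + 1)) *
                  (τ ^ (K + 1) * |u₀ (τ * η)|) := by ring
            _ ≤ c2 * (τ ^ (K + 1) * |u₀ (τ * η)|) := by gcongr
            _ = _ := by ring
        · rw [mul_zero]; positivity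
      calc _ ≤ |Φ (w.eval τ - η)| * (cu * (τ * η) ^ K +
            if 1 < τ * η then |u₀ (τ * η)| else 0) := by gcongr
        _ ≤ _ := by rw [mul_add]; exact add_le_add ha hb
    have h3 : Φ (w.eval τ - η) * u₀ (τ * η) - P * S =
        Φ (w.eval τ - η) * (u₀ (τ * η) - P) + (Φ (w.eval τ - η) - S) * P := by ring
    rw [h3, Real.norm_eq_abs]
    refine (abs_add_le _ _).trans ?_
    rw [abs_mul, abs_mul]
    refine (add_le_add h2 h1).trans (le_of_eq ?_)
    ring
  · rw [integral_add (integrable_inv_one_add_sq.const_mul _).integrableOn (hUi.abs.const_mul _),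
      integral_const_mul, integral_const_mul]
    have := integral_comp_mul_left_Ioi (fun y => |U y|) 0 hτ.1
    rw [mul_zero] at this
    rw [this, smul_eq_mul, Real.norm_eq_abs, abs_of_pos (pow_pos hτ.1 K)]
    have hτ0 : τ ≠ 0 := hτ.1.ne'
    rw [pow_succ]
    field_simp
    ring

end ThinFilm
end

/-! ### Self-similar scaling and polynomial expansion of the two residuals. -/

noncomputable section

namespace ThinFilm

attribute [local instance] Measure.Subtype.measureSpace

open Polynomial

/-- The substitution k → σk. Writing the time as a fourth power keeps fractional exponents out of
the scaling law. -/
lemma green_pow_four {σ : ℝ} (hσ : 0 < σ) :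
    green (σ ^ 4) = fun x => σ⁻¹ * profileS (σ⁻¹ * x) := by
  ext x
  rw [← profile_eq_profileS]
  have h := integral_comp_mul_left_Ioi
    (fun k : ℝ => Real.exp (-1 * k ^ 4) * Real.cos (k * (σ⁻¹ * x))) 0 hσ
  simp only [mul_zero, smul_eq_mul] at h
  simp only [profile, green]
  rw [mul_left_comm, ← h]
  congr 2
  ext k
  congr 2
  · ring
  · field_simp

lemma deriv_green_pow_four {σ : ℝ} (hσ : 0 < σ) (x : ℝ) :
    deriv (green (σ ^ 4)) x = σ⁻¹ ^ 2 * iterDerivS 1 profileS (σ⁻¹ * x) := by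
  rw [green_pow_four hσ]
  have h := ((hasDerivAt_iterDerivS 0 profileS (σ⁻¹ * x)).comp x
    ((hasDerivAt_id x).const_mul σ⁻¹)).const_mul σ⁻¹
  rw [iterDerivS_zero] at h
  refine h.deriv.trans ?_
  simp only [zero_add]
  ring

lemma iteratedDeriv_two_green_pow_four {σ : ℝ} (hσ : 0 < σ) (x : ℝ) :
    iteratedDeriv 2 (green (σ ^ 4)) x = σ⁻¹ ^ 3 * iterDerivS 2 profileS (σ⁻¹ * x) := by
  rw [iteratedDeriv_succ, iteratedDeriv_one, funext (deriv_green_pow_four hσ)]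
  have h := ((hasDerivAt_iterDerivS 1 profileS (σ⁻¹ * x)).comp x
    ((hasDerivAt_id x).const_mul σ⁻¹)).const_mul (σ⁻¹ ^ 2)
  refine h.deriv.trans ?_
  simp only [Nat.reduceAdd]
  ring

/-- The antiderivative of the profile vanishing at `0`. -/
def profilePrim (z : ℝ) : ℝ := ∫ y in (0 : ℝ)..z, profileS y

lemma hasDerivAt_profilePrim (z : ℝ) : HasDerivAt profilePrim (profileS z) z :=
  (profileS.continuous).integral_hasStrictDerivAt 0 z |>.hasDerivAt

lemma contDiff_profilePrim : ContDiff ℝ ∞ profilePrim := by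
  rw [contDiff_infty_iff_deriv, funext fun z => (hasDerivAt_profilePrim z).deriv]
  exact ⟨fun z => (hasDerivAt_profilePrim z).differentiableAt, profileS.smooth ⊤⟩

lemma greenPrim_pow_four {σ : ℝ} (hσ : 0 < σ) (x : ℝ) :
    greenPrim (σ ^ 4) x = profilePrim (σ⁻¹ * x) := by
  rw [greenPrim, green_pow_four hσ, profilePrim, intervalIntegral.integral_const_mul]
  have := intervalIntegral.integral_comp_mul_left (a := 0) (b := x) (fun y => profileS y)
    (inv_ne_zero hσ.ne')
  rw [this, mul_zero, inv_inv, smul_eq_mul]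
  field_simp

/-- The function `x ↦ x^{n/4}` on `(0,1)`. -/
def powQ (n : ℕ) : UnitFun :=
  UnitFun.mk (fun x => (x : ℝ) ^ ((n : ℝ) / 4))
    (Continuous.rpow_const continuous_subtype_val fun x => Or.inr (by positivity)) 1 fun x => by
      rw [abs_of_nonneg (Real.rpow_nonneg x.2.1.le _)]
      exact Real.rpow_le_one x.2.1.le x.2.2.le (by positivity)

lemma powQ_apply (n : ℕ) (x : Ioo (0 : ℝ) 1) : powQ n x = (x : ℝ) ^ ((n : ℝ) / 4) := rfl

/-- The fourth root of `1 - x`. -/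
def rootGap (x : Ioo (0 : ℝ) 1) : ℝ := (1 - (x : ℝ)) ^ (1 / 4 : ℝ)

lemma rootGap_pos (x : Ioo (0 : ℝ) 1) : 0 < rootGap x :=
  Real.rpow_pos_of_pos (sub_pos.mpr x.2.2) _

lemma rootGap_pow_four (x : Ioo (0 : ℝ) 1) : rootGap x ^ 4 = 1 - x := by
  rw [rootGap, ← Real.rpow_natCast, ← Real.rpow_mul (sub_pos.mpr x.2.2).le]
  norm_num

lemma rootGap_le_one (x : Ioo (0 : ℝ) 1) : rootGap x ≤ 1 :=
  Real.rpow_le_one (sub_pos.mpr x.2.2).le (by linarith [x.2.1]) (by norm_num)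

lemma continuous_rootGap : Continuous rootGap :=
  Continuous.rpow_const (by fun_prop) fun x => Or.inr (by norm_num)

/-- The normalized displacement `(1 - x^{n/4+1}) / ((n/4+1)(1-x)^{1/4})` on `(0,1)`. -/
def dispQ (n : ℕ) : UnitFun :=
  UnitFun.mk
    (fun x => 4 / ((n : ℝ) + 4) * (1 - (x : ℝ) ^ (((n : ℝ) + 4) / 4)) / rootGap x)
    (((continuous_const.mul (continuous_const.sub
      (Continuous.rpow_const continuous_subtype_val fun x => Or.inr (by positivity))))).div
        continuous_rootGap fun x => (rootGap_pos x).ne') 1 fun x => by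
      have hp := rootGap_pos x
      have h1 : (x : ℝ) ^ (((n : ℝ) + 4) / 4) ≤ 1 :=
        Real.rpow_le_one x.2.1.le x.2.2.le (by positivity)
      -- Bernoulli's inequality bounds the numerator by 1 - x, which is at most (1-x)^(1/4) on
      -- (0,1); this yields the bound 1.
      have h2 := one_add_mul_self_le_rpow_one_add (s := (x : ℝ) - 1) (by linarith [x.2.1])
        (p := ((n : ℝ) + 4) / 4) (by linarith [n.cast_nonneg (α := ℝ)])
      rw [add_sub_cancel] at h2
      have h3 : 4 / ((n : ℝ) + 4) * (1 - (x : ℝ) ^ (((n : ℝ) + 4) / 4)) ≤ 1 - x := by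
        rw [div_mul_eq_mul_div, div_le_iff₀ (by positivity)]
        linarith
      have h4 : (1 - x : ℝ) ≤ rootGap x := by
        rw [← rootGap_pow_four]
        exact pow_le_of_le_one hp.le (rootGap_le_one x) (by norm_num)
      rw [abs_of_nonneg
        (div_nonneg (mul_nonneg (by positivity) (sub_nonneg.mpr h1)) hp.le), div_le_one hp]
      exact h3.trans h4

lemma dispQ_apply (n : ℕ) (x : Ioo (0 : ℝ) 1) :
    dispQ n x = 4 / ((n : ℝ) + 4) * (1 - (x : ℝ) ^ (((n : ℝ) + 4) / 4)) / rootGap x := rfl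

/-- Attach to the coefficients of a real polynomial a sequence of functions on `(0,1)`. -/
def liftPoly (f : ℕ → UnitFun) : ℝ[X] →ₗ[ℝ] UnitFun[X] :=
  lsum fun n => ((monomial n : UnitFun →ₗ[UnitFun] UnitFun[X]).restrictScalars ℝ).comp
    (LinearMap.toSpanSingleton ℝ UnitFun (f n))

lemma liftPoly_monomial (f : ℕ → UnitFun) (n : ℕ) (a : ℝ) :
    liftPoly f (monomial n a) = monomial n (a • f n) := by
  simp [liftPoly, lsum_apply]

lemma coeff_liftPoly (f : ℕ → UnitFun) (p : ℝ[X]) (n : ℕ) :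
    (liftPoly f p).coeff n = p.coeff n • f n := by
  induction p using Polynomial.induction_on' with
  | add p q hp hq => simp [hp, hq, add_smul]
  | monomial m a =>
    rw [liftPoly_monomial, coeff_monomial, coeff_monomial]
    split_ifs with h
    · rw [h]
    · simp

lemma X_pow_dvd_liftPoly (f : ℕ → UnitFun) {p : ℝ[X]} {m : ℕ} (h : X ^ m ∣ p) :
    X ^ m ∣ liftPoly f p := by
  rw [X_pow_dvd_iff] at h ⊢
  intro d hd
  rw [coeff_liftPoly, h d hd, zero_smul]

/-- The scaled displacement at the final time, as a power series in `τ`. -/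
def dispPoly : ℝ[X] →ₗ[ℝ] ℝ[X] :=
  lsum fun n => (monomial (n + 3)).comp ((4 / ((n : ℝ) + 4)) • LinearMap.id)

lemma dispPoly_monomial (n : ℕ) (a : ℝ) :
    dispPoly (monomial n a) = monomial (n + 3) (4 / ((n : ℝ) + 4) * a) := by
  simp [dispPoly, lsum_apply]

/-- The function of `t` given by a polynomial in `t^{1/4}`. -/
def fracPoly (p : ℝ[X]) (t : ℝ) : ℝ := p.eval (t ^ (1 / 4 : ℝ))

lemma rpow_quarter_pow {t : ℝ} (ht : 0 ≤ t) (n : ℕ) :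
    (t ^ (1 / 4 : ℝ)) ^ n = t ^ ((n : ℝ) / 4) := by
  rw [← Real.rpow_natCast, ← Real.rpow_mul ht]
  congr 1
  ring

lemma pow_four_rpow {τ : ℝ} (hτ : 0 ≤ τ) (r : ℝ) : (τ ^ 4) ^ r = τ ^ (4 * r) := by
  rw [← Real.rpow_natCast, ← Real.rpow_mul hτ]
  norm_num

lemma pow_four_rpow_quarter {τ : ℝ} (hτ : 0 ≤ τ) : (τ ^ 4) ^ (1 / 4 : ℝ) = τ := by
  rw [pow_four_rpow hτ]; norm_num

lemma fracPoly_pow_four (p : ℝ[X]) {τ : ℝ} (hτ : 0 ≤ τ) : fracPoly p (τ ^ 4) = p.eval τ := by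
  rw [fracPoly, pow_four_rpow_quarter hτ]

lemma continuous_fracPoly (p : ℝ[X]) : Continuous (fracPoly p) :=
  p.continuous.comp (Real.continuous_rpow_const (by norm_num))

/-- Integrating t^(n/4) gives 4/(n+4) times τ^(n+4). One factor τ is split off as the spatial scale,
which leaves the shift by 3 in `dispPoly`. -/
lemma displ_fracPoly (q : ℝ[X]) {t : ℝ} (ht : 0 ≤ t) :
    displ (fracPoly q) t = t ^ (1 / 4 : ℝ) * (dispPoly q).eval (t ^ (1 / 4 : ℝ)) := by
  induction q using Polynomial.induction_on' with
  | add p q hp hq =>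
    rw [map_add, eval_add, mul_add, ← hp, ← hq, displ, displ, displ,
      ← intervalIntegral.integral_add ((continuous_fracPoly p).intervalIntegrable _ _)
        ((continuous_fracPoly q).intervalIntegrable _ _)]
    simp [fracPoly]
  | monomial n a =>
    rw [displ, dispPoly_monomial, eval_monomial]
    have h1 : ∫ s in (0 : ℝ)..t, fracPoly (monomial n a) s =
        ∫ s in (0 : ℝ)..t, a * s ^ ((n : ℝ) / 4) := by
      refine intervalIntegral.integral_congr fun s hs => ?_
      rw [uIcc_of_le ht] at hs
      simp only [fracPoly, eval_monomial, rpow_quarter_pow hs.1]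
    rw [h1, intervalIntegral.integral_const_mul, integral_rpow
      (Or.inl (by linarith [show (0 : ℝ) ≤ (n : ℝ) / 4 by positivity])),
      Real.zero_rpow (by positivity), mul_left_comm, ← pow_succ', rpow_quarter_pow ht]
    push_cast
    rw [show ((n : ℝ) + 3 + 1) / 4 = (n : ℝ) / 4 + 1 by ring]
    field_simp
    ring

lemma ev_liftPoly_powQ (p : ℝ[X]) {τ : ℝ} (hτ : 0 ≤ τ) (x : Ioo (0 : ℝ) 1) :
    ev τ x (liftPoly powQ p) = fracPoly p (τ ^ 4 * x) := by
  induction p using Polynomial.induction_on' with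
  | add p q hp hq => rw [map_add, map_add, hp, hq]; simp [fracPoly]
  | monomial n a =>
    rw [liftPoly_monomial, ev_monomial, fracPoly, eval_monomial,
      Real.mul_rpow (by positivity) x.2.1.le, pow_four_rpow_quarter hτ, mul_pow,
      rpow_quarter_pow x.2.1.le, UnitFun.smul_apply, powQ_apply]
    ring

/-- The similarity variable `(W(t) - W(s)) / (t - s)^{1/4}`, as a polynomial in `τ`. -/
def simVar (q : ℝ[X]) : UnitFun[X] := X ^ 3 * liftPoly dispQ q

lemma ev_X (τ : ℝ) (x : Ioo (0 : ℝ) 1) : ev τ x X = τ := by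
  rw [show (X : UnitFun[X]) = monomial 1 1 from rfl, ev_monomial, UnitFun.one_apply,
    one_mul, pow_one]

/-- Here τ · `rootGap x` is (t-s)^(1/4), exactly the length by which the kernel at time t - s
rescales its argument, so the profile is evaluated at `simVar`. -/
lemma displ_sub_displ (q : ℝ[X]) {τ : ℝ} (hτ : 0 ≤ τ) (x : Ioo (0 : ℝ) 1) :
    displ (fracPoly q) (τ ^ 4) - displ (fracPoly q) (τ ^ 4 * x) =
      τ * rootGap x * ev τ x (simVar q) := by
  have hx : (0 : ℝ) ≤ x := x.2.1.le
  rw [displ_fracPoly q (by positivity), displ_fracPoly q (by positivity),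
    Real.mul_rpow (by positivity) hx, pow_four_rpow_quarter hτ, simVar, map_mul, map_pow, ev_X]
  induction q using Polynomial.induction_on' with
  | add p q hp hq =>
    simp only [map_add, eval_add]
    linear_combination hp + hq
  | monomial n a =>
    rw [dispPoly_monomial, liftPoly_monomial, ev_monomial, eval_monomial, eval_monomial,
      UnitFun.smul_apply, dispQ_apply]
    have h1 : (x : ℝ) ^ (((n : ℝ) + 4) / 4) =
        ((x : ℝ) ^ (1 / 4 : ℝ)) * ((x : ℝ) ^ (1 / 4 : ℝ)) ^ (n + 3) := by
      rw [← pow_succ', rpow_quarter_pow hx]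
      push_cast
      congr 1
      ring
    rw [h1]
    have := (rootGap_pos x).ne'
    field_simp
    ring

/-- The polynomial in `τ` representing `τ⁴ β'(τ⁴ x)`. -/
def derivLift (p : ℝ[X]) : UnitFun[X] := liftPoly (fun n => ((n : ℝ) / 4) • powQ (n - 4)) p

/-- The gap in the series removes the terms t^(n/4) with 0 < n < 4, whose derivatives are unbounded
at 0; what remains has bounded coefficients on (0,1). -/
lemma ev_derivLift {p : ℝ[X]} (h1 : p.coeff 1 = 0) (h2 : p.coeff 2 = 0) (h3 : p.coeff 3 = 0)
    {τ : ℝ} (hτ : 0 < τ) (x : Ioo (0 : ℝ) 1) :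
    ev τ x (derivLift p) = τ ^ 4 * deriv (fracPoly p) (τ ^ 4 * x) := by
  have hx : (0 : ℝ) < x := x.2.1
  have hs : 0 < τ ^ 4 * (x : ℝ) := by positivity
  set s := τ ^ 4 * (x : ℝ) with hsd
  have hder : HasDerivAt (fracPoly p) (∑ n ∈ Finset.range (p.natDegree + 1),
      p.coeff n * (((n : ℝ) / 4) * s ^ ((n : ℝ) / 4 - 1))) s := by
    have h : HasDerivAt (fun t : ℝ => ∑ n ∈ Finset.range (p.natDegree + 1),
        p.coeff n * t ^ ((n : ℝ) / 4)) (∑ n ∈ Finset.range (p.natDegree + 1),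
      p.coeff n * (((n : ℝ) / 4) * s ^ ((n : ℝ) / 4 - 1))) s :=
      HasDerivAt.fun_sum fun n _ => (Real.hasDerivAt_rpow_const (Or.inl hs.ne')).const_mul _
    refine h.congr_of_eventuallyEq ?_
    filter_upwards [Ioi_mem_nhds hs] with t ht
    rw [fracPoly, eval_eq_sum_range]
    exact Finset.sum_congr rfl fun n _ => by rw [rpow_quarter_pow (le_of_lt ht)]
  rw [hder.deriv, derivLift]
  conv_lhs => rw [p.as_sum_range]
  rw [map_sum, map_sum, Finset.mul_sum]
  refine Finset.sum_congr rfl fun n _ => ?_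
  rw [liftPoly_monomial, ev_monomial, UnitFun.smul_apply, UnitFun.smul_apply, powQ_apply]
  -- For n < 4 the truncated exponent n - 4 is meaningless but harmless: the coefficient vanishes,
  -- through the factor n when n = 0 and by the gap otherwise.
  rcases Nat.lt_or_ge n 4 with h | h
  · have : p.coeff n * ((n : ℝ) / 4) = 0 := by
      interval_cases n <;> simp [h1, h2, h3]
    linear_combination ((x : ℝ) ^ (((n - 4 : ℕ) : ℝ) / 4) * τ ^ n -
      τ ^ 4 * s ^ ((n : ℝ) / 4 - 1)) * this
  · obtain ⟨m, rfl⟩ : ∃ m, n = m + 4 := ⟨n - 4, by omega⟩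
    rw [Nat.add_sub_cancel, hsd, Real.mul_rpow (by positivity) hx.le, pow_four_rpow hτ.le]
    push_cast
    rw [show ((m : ℝ) + 4) / 4 - 1 = (m : ℝ) / 4 by ring,
      show 4 * ((m : ℝ) / 4) = ((m : ℕ) : ℝ) by ring, Real.rpow_natCast]
    ring

/-- The weight `(1-x)^{-a/4}`. -/
def weight (a : ℕ) (x : Ioo (0 : ℝ) 1) : ℝ := (rootGap x)⁻¹ ^ a

lemma weight_eq (a : ℕ) (x : Ioo (0 : ℝ) 1) :
    weight a x = (1 - (x : ℝ)) ^ (-((a : ℝ) / 4)) := by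
  have hx : (0 : ℝ) ≤ 1 - x := (sub_pos.mpr x.2.2).le
  rw [weight, rootGap, inv_pow, rpow_quarter_pow hx, Real.rpow_neg hx]

lemma integral_unit (F : ℝ → ℝ) : ∫ x : Ioo (0 : ℝ) 1, F x = ∫ x in (0 : ℝ)..1, F x := by
  rw [integral_subtype measurableSet_Ioo, intervalIntegral.integral_of_le zero_le_one,
    integral_Ioc_eq_integral_Ioo]

lemma intervalIntegrable_one_sub_rpow {r : ℝ} (hr : -1 < r) :
    IntervalIntegrable (fun x : ℝ => (1 - x) ^ r) volume 0 1 := by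
  have h := (intervalIntegral.intervalIntegrable_rpow' (a := 0) (b := 1) hr).comp_sub_left 1
  simpa using h.symm

lemma integrable_weight {a : ℕ} (ha : a < 4) : Integrable (weight a) := by
  have ha' : (a : ℝ) < 4 := by exact_mod_cast ha
  have h := intervalIntegrable_one_sub_rpow (r := -((a : ℝ) / 4)) (by linarith)
  rw [intervalIntegrable_iff_integrableOn_Ioo_of_le zero_le_one,
    integrableOn_iff_comap_subtypeVal measurableSet_Ioo] at h
  exact h.congr (Eventually.of_forall fun x => (weight_eq a x).symm)

lemma integral_zero_pow_four (F : ℝ → ℝ) {τ : ℝ} (hτ : 0 < τ) :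
    ∫ s in (0 : ℝ)..τ ^ 4, F s = τ ^ 4 * ∫ x : Ioo (0 : ℝ) 1, F (τ ^ 4 * x) := by
  rw [integral_unit fun x => F (τ ^ 4 * x),
    intervalIntegral.integral_comp_mul_left F (by positivity), mul_zero, mul_one, smul_eq_mul]
  have : τ ^ 4 ≠ 0 := by positivity
  field_simp

lemma gap_eq (τ : ℝ) (x : Ioo (0 : ℝ) 1) : τ ^ 4 - τ ^ 4 * x = (τ * rootGap x) ^ 4 := by
  rw [mul_pow, rootGap_pow_four]; ring

/-- The substitution s = τ⁴x contributes τ⁴, while the second derivative of the kernel contributes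
(τ(1-x)^(1/4))^(-3). Fewer derivatives leave more powers of τ and a milder weight, as in the next
integrals. -/
lemma integral_iteratedDeriv_two_green (q : ℝ[X]) (b : ℝ → ℝ) {τ : ℝ} (hτ : 0 < τ) :
    ∫ s in (0 : ℝ)..τ ^ 4, iteratedDeriv 2 (green (τ ^ 4 - s))
      (displ (fracPoly q) (τ ^ 4) - displ (fracPoly q) s) * b s =
    τ * ∫ x, weight 3 x * (iterDerivS 2 profileS (ev τ x (simVar q)) * b (τ ^ 4 * x)) := by
  rw [integral_zero_pow_four _ hτ, ← integral_const_mul, ← integral_const_mul]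
  refine integral_congr_ae (Eventually.of_forall fun x => ?_)
  have hp := rootGap_pos x
  simp only
  rw [gap_eq, displ_sub_displ q hτ.le, iteratedDeriv_two_green_pow_four (by positivity),
    inv_mul_cancel_left₀ (by positivity), weight]
  field_simp

lemma integral_deriv_green (q : ℝ[X]) {τ : ℝ} (hτ : 0 < τ) :
    ∫ s in (0 : ℝ)..τ ^ 4, deriv (green (τ ^ 4 - s))
      (displ (fracPoly q) (τ ^ 4) - displ (fracPoly q) s) =
    τ ^ 2 * ∫ x, weight 2 x * (iterDerivS 1 profileS (ev τ x (simVar q)) * 1) := by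
  rw [integral_zero_pow_four _ hτ, ← integral_const_mul, ← integral_const_mul]
  refine integral_congr_ae (Eventually.of_forall fun x => ?_)
  have hp := rootGap_pos x
  simp only
  rw [gap_eq, displ_sub_displ q hτ.le, deriv_green_pow_four (by positivity),
    inv_mul_cancel_left₀ (by positivity), weight]
  field_simp

lemma integral_green (q : ℝ[X]) (b : ℝ → ℝ) {τ : ℝ} (hτ : 0 < τ) :
    ∫ s in (0 : ℝ)..τ ^ 4, green (τ ^ 4 - s)
      (displ (fracPoly q) (τ ^ 4) - displ (fracPoly q) s) * b s =
    τ ^ 3 * ∫ x, weight 1 x * (profileS (ev τ x (simVar q)) * b (τ ^ 4 * x)) := by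
  rw [integral_zero_pow_four _ hτ, ← integral_const_mul, ← integral_const_mul]
  refine integral_congr_ae (Eventually.of_forall fun x => ?_)
  have hp := rootGap_pos x
  simp only
  rw [gap_eq, displ_sub_displ q hτ.le, green_pow_four (by positivity)]
  simp only
  rw [inv_mul_cancel_left₀ (by positivity), weight]
  field_simp

lemma integral_greenPrim {p q : ℝ[X]} (h1 : p.coeff 1 = 0) (h2 : p.coeff 2 = 0)
    (h3 : p.coeff 3 = 0) {τ : ℝ} (hτ : 0 < τ) :
    ∫ s in (0 : ℝ)..τ ^ 4, greenPrim (τ ^ 4 - s)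
      (displ (fracPoly q) (τ ^ 4) - displ (fracPoly q) s) * deriv (fracPoly p) s =
    ∫ x, weight 0 x * (profilePrim (ev τ x (simVar q)) * ev τ x (derivLift p)) := by
  rw [integral_zero_pow_four _ hτ, ← integral_const_mul]
  refine integral_congr_ae (Eventually.of_forall fun x => ?_)
  have hp := rootGap_pos x
  simp only
  rw [gap_eq, displ_sub_displ q hτ.le, greenPrim_pow_four (by positivity),
    inv_mul_cancel_left₀ (by positivity), weight, ev_derivLift h1 h2 h3 hτ]
  ring

lemma displ_pow_four (q : ℝ[X]) {τ : ℝ} (hτ : 0 < τ) :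
    displ (fracPoly q) (τ ^ 4) = τ * (dispPoly q).eval τ := by
  rw [displ_fracPoly q (by positivity), pow_four_rpow_quarter hτ.le]

lemma integral_data_comp (F : ℝ → ℝ) (u₀ : ℝ → ℝ) (w : ℝ) {τ : ℝ} (hτ : 0 < τ) :
    ∫ y in Ioi (0 : ℝ), F (τ⁻¹ * (τ * w - y)) * u₀ y =
      τ * ∫ η in Ioi (0 : ℝ), F (w - η) * u₀ (τ * η) := by
  have h := integral_comp_mul_left_Ioi (fun y => F (τ⁻¹ * (τ * w - y)) * u₀ y) 0 hτ
  rw [mul_zero, smul_eq_mul] at h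
  rw [eq_comm, ← eq_inv_mul_iff_mul_eq₀ hτ.ne', ← h]
  congr 1
  ext η
  congr 2
  field_simp

lemma integral_green_data (u₀ : ℝ → ℝ) (q : ℝ[X]) {τ : ℝ} (hτ : 0 < τ) :
    ∫ y in Ioi (0 : ℝ), green (τ ^ 4) (displ (fracPoly q) (τ ^ 4) - y) * u₀ y =
      ∫ η in Ioi (0 : ℝ), profileS ((dispPoly q).eval τ - η) * u₀ (τ * η) := by
  rw [green_pow_four hτ, displ_pow_four q hτ]
  simp only [mul_assoc]
  rw [integral_const_mul, integral_data_comp _ _ _ hτ, inv_mul_cancel_left₀ hτ.ne']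

/-- The differentiated kernel costs 1/τ after y = τη. This is why the second residual is always
expanded after multiplication by τ. -/
lemma integral_deriv_green_data (u₀ : ℝ → ℝ) (q : ℝ[X]) {τ : ℝ} (hτ : 0 < τ) :
    τ * ∫ y in Ioi (0 : ℝ), deriv (green (τ ^ 4)) (displ (fracPoly q) (τ ^ 4) - y) * u₀ y =
      ∫ η in Ioi (0 : ℝ), iterDerivS 1 profileS ((dispPoly q).eval τ - η) * u₀ (τ * η) := by
  rw [displ_pow_four q hτ]
  simp only [deriv_green_pow_four hτ, mul_assoc]
  rw [integral_const_mul, integral_data_comp _ _ _ hτ]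
  field_simp

/-- The expansion of the first residual modulo `τ^K`. -/
def polyA (u₀ : ℝ → ℝ) (p q : ℝ[X]) (K : ℕ) : ℝ[X] :=
  -(X * mapCoeff (weightedIntegral (integrable_weight (a := 3) (by norm_num)))
      (aeval (simVar q) (taylorPoly (iterDerivS 2 profileS) K) * liftPoly powQ p))
  - (dataPoly u₀ profileS K (dispPoly q)
      - C (1 / 2) * (X ^ 2 * mapCoeff (weightedIntegral (integrable_weight (a := 2) (by norm_num)))
          (aeval (simVar q) (taylorPoly (iterDerivS 1 profileS) K) * 1)))

/-- The expansion of `τ` times the second residual modulo `τ^K`. -/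
def polyB (u₀ : ℝ → ℝ) (p q : ℝ[X]) (K : ℕ) : ℝ[X] :=
  X * p + C (2 * p.coeff 0) * X * aeval (dispPoly q) (taylorPoly profilePrim K)
  + C 2 * X * mapCoeff (weightedIntegral (integrable_weight (a := 0) (by norm_num)))
      (aeval (simVar q) (taylorPoly profilePrim K) * derivLift p)
  - C 2 * q * X ^ 4 * mapCoeff (weightedIntegral (integrable_weight (a := 1) (by norm_num)))
      (aeval (simVar q) (taylorPoly profileS K) * liftPoly powQ p)
  - (C 2 * dataPoly u₀ (iterDerivS 1 profileS) K (dispPoly q)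
      - X ^ 2 * mapCoeff (weightedIntegral (integrable_weight (a := 3) (by norm_num)))
          (aeval (simVar q) (taylorPoly (iterDerivS 2 profileS) K) * 1))

lemma X_pow_three_dvd_dispPoly (q : ℝ[X]) : X ^ 3 ∣ dispPoly q := by
  induction q using Polynomial.induction_on' with
  | add p q hp hq => rw [map_add]; exact dvd_add hp hq
  | monomial n a =>
    rw [dispPoly_monomial, ← C_mul_X_pow_eq_monomial, pow_add]
    exact ⟨C (4 / ((n : ℝ) + 4) * a) * X ^ n, by ring⟩

lemma eqMod_residualA {u₀ : ℝ → ℝ} (hu : ContDiffOn ℝ ∞ u₀ (Ici 0)) {K₀ : ℕ}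
    (hK₀ : IntegrableOn (fun x : ℝ => u₀ x / (1 + x) ^ K₀) (Ioi 0)) (p q : ℝ[X]) (n : ℕ) :
    EqMod (n + 1) (fun τ => residualA u₀ (fracPoly q) (fracPoly p) (τ ^ 4))
      (polyA u₀ p q (n + 1)) := by
  have hZ : X ∣ simVar q := (dvd_pow_self X three_ne_zero).trans (Dvd.intro _ rfl)
  have hw : X ∣ dispPoly q := (dvd_pow_self X three_ne_zero).trans (X_pow_three_dvd_dispPoly q)
  have e1 := (kernel_expansion (integrable_weight (a := 3) (by norm_num))
    ((iterDerivS 2 profileS).smooth ⊤) hZ (liftPoly powQ p) (n + 1)).poly_mul (-X)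
  have e2 := data_expansion hu hK₀ profileS hw n
  have e3 := ((kernel_expansion (integrable_weight (a := 2) (by norm_num))
    ((iterDerivS 1 profileS).smooth ⊤) hZ 1 (n + 1)).poly_mul (X ^ 2)).poly_mul (C (1 / 2))
  have e := e1.sub (e2.sub e3)
  rw [polyA, ← neg_mul]
  refine e.congr fun τ hτ => ?_
  rw [residualA, integral_iteratedDeriv_two_green q _ hτ, integral_deriv_green q hτ,
    integral_green_data u₀ q hτ]
  simp only [ev_liftPoly_powQ _ hτ.le, map_one, eval_neg, eval_X, eval_C, eval_pow]
  ring

lemma eqMod_residualB {u₀ : ℝ → ℝ} (hu : ContDiffOn ℝ ∞ u₀ (Ici 0)) {K₀ : ℕ}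
    (hK₀ : IntegrableOn (fun x : ℝ => u₀ x / (1 + x) ^ K₀) (Ioi 0)) {p : ℝ[X]} (q : ℝ[X])
    (h1 : p.coeff 1 = 0) (h2 : p.coeff 2 = 0) (h3 : p.coeff 3 = 0) (n : ℕ) :
    EqMod (n + 1) (fun τ => τ * residualB u₀ (fracPoly q) (fracPoly p) (τ ^ 4))
      (polyB u₀ p q (n + 1)) := by
  have hZ : X ∣ simVar q := (dvd_pow_self X three_ne_zero).trans (Dvd.intro _ rfl)
  have hw : X ∣ dispPoly q := (dvd_pow_self X three_ne_zero).trans (X_pow_three_dvd_dispPoly q)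
  have e1 := EqMod.poly (K := n + 1) (X * p)
  have e2 := (comp_expansion contDiff_profilePrim hw (n + 1)).poly_mul (C (2 * p.coeff 0) * X)
  have e3 := (kernel_expansion (integrable_weight (a := 0) (by norm_num))
    contDiff_profilePrim hZ (derivLift p) (n + 1)).poly_mul (C 2 * X)
  have e4 := (kernel_expansion (integrable_weight (a := 1) (by norm_num))
    (profileS.smooth ⊤) hZ (liftPoly powQ p) (n + 1)).poly_mul (C 2 * q * X ^ 4)
  have e5 := (data_expansion hu hK₀ (iterDerivS 1 profileS) hw n).poly_mul (C 2)
  have e6 := (kernel_expansion (integrable_weight (a := 3) (by norm_num))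
    ((iterDerivS 2 profileS).smooth ⊤) hZ 1 (n + 1)).poly_mul (X ^ 2)
  refine ((((e1.add e2).add e3).sub e4).sub (e5.sub e6)).congr fun τ hτ => ?_
  have h7 := integral_iteratedDeriv_two_green q (fun _ => 1) hτ
  simp only [mul_one] at h7
  rw [residualB, h7, integral_green q _ hτ, integral_greenPrim h1 h2 h3 hτ,
    ← integral_deriv_green_data u₀ q hτ, greenPrim_pow_four hτ, displ_pow_four q hτ,
    inv_mul_cancel_left₀ hτ.ne', fracPoly_pow_four p hτ.le, fracPoly_pow_four q hτ.le]
  have h0 : fracPoly p 0 = p.coeff 0 := by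
    rw [fracPoly, Real.zero_rpow (by norm_num), coeff_zero_eq_eval_zero]
  simp only [h0, ev_liftPoly_powQ _ hτ.le, map_one, mul_one, eval_X, eval_C, eval_pow, eval_mul]
  ring

end ThinFilm
end

/-! ### Algebra of leading coefficients and congruences modulo powers of X. -/

noncomputable section

namespace ThinFilm

attribute [local instance] Measure.Subtype.measureSpace

open Polynomial
open scoped SchwartzMap

section Leading

variable {R : Type*} [CommRing R]

/-- `P` vanishes to order `m` at the origin, with coefficient `c` at order `m`. -/
def Lead (m : ℕ) (P : R[X]) (c : R) : Prop := X ^ m ∣ P ∧ P.coeff m = c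

namespace Lead

variable {m k : ℕ} {P Q : R[X]} {c d : R}

lemma of_dvd (h : X ^ m ∣ P) : Lead m P (P.coeff m) := ⟨h, rfl⟩

lemma of_dvd_succ (h : X ^ (m + 1) ∣ P) : Lead m P 0 :=
  ⟨(pow_dvd_pow X m.le_succ).trans h, X_pow_dvd_iff.mp h m m.lt_succ_self⟩

lemma dvd_succ (h : Lead m P 0) : X ^ (m + 1) ∣ P := by
  rw [X_pow_dvd_iff]
  intro i hi
  rcases Nat.lt_succ_iff_lt_or_eq.mp hi with h' | rfl
  · exact X_pow_dvd_iff.mp h.1 i h'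
  · exact h.2

lemma add (h : Lead m P c) (h' : Lead m Q d) : Lead m (P + Q) (c + d) :=
  ⟨dvd_add h.1 h'.1, by rw [coeff_add, h.2, h'.2]⟩

lemma sub (h : Lead m P c) (h' : Lead m Q d) : Lead m (P - Q) (c - d) :=
  ⟨dvd_sub h.1 h'.1, by rw [coeff_sub, h.2, h'.2]⟩

lemma neg (h : Lead m P c) : Lead m (-P) (-c) :=
  ⟨(dvd_neg).mpr h.1, by rw [coeff_neg, h.2]⟩

lemma mul (h : Lead m P c) (h' : Lead k Q d) : Lead (m + k) (P * Q) (c * d) := by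
  obtain ⟨⟨P, rfl⟩, hc⟩ := h
  obtain ⟨⟨Q, rfl⟩, hd⟩ := h'
  have he : X ^ m * P * (X ^ k * Q) = X ^ (m + k) * (P * Q) := by ring
  refine ⟨⟨P * Q, he⟩, ?_⟩
  rw [← hc, ← hd, he]
  have h0 : ∀ (j : ℕ) (S : R[X]), (X ^ j * S).coeff j = S.coeff 0 := fun j S => by
    simpa using coeff_X_pow_mul S j 0
  rw [h0, h0, h0, mul_coeff_zero]

lemma constMul (a : R) (h : Lead m P c) : Lead m (C a * P) (a * c) :=
  ⟨h.1.mul_left _, by rw [coeff_C_mul, h.2]⟩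

lemma X_pow_mul (j : ℕ) (h : Lead m P c) : Lead (j + m) (X ^ j * P) c := by
  have := mul (m := j) (P := X ^ j) (c := 1) ⟨dvd_rfl, by simp⟩ h
  rwa [one_mul] at this

lemma sum {ι : Type*} {s : Finset ι} {P : ι → R[X]} {c : ι → R}
    (h : ∀ i ∈ s, Lead m (P i) (c i)) : Lead m (∑ i ∈ s, P i) (∑ i ∈ s, c i) :=
  ⟨Finset.dvd_sum fun i hi => (h i hi).1, by
    rw [finsetSum_coeff]; exact Finset.sum_congr rfl fun i hi => (h i hi).2⟩

end Lead

/-- Congruence of polynomials modulo `X ^ N`. -/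
def CongX (N : ℕ) (P Q : R[X]) : Prop := X ^ N ∣ P - Q

namespace CongX

variable {N M : ℕ} {P Q S P' Q' : R[X]}

lemma refl (P : R[X]) : CongX N P P := by simp [CongX]

lemma trans (h : CongX N P Q) (h' : CongX N Q S) : CongX N P S := by
  have := dvd_add h h'
  rwa [sub_add_sub_cancel] at this

lemma add (h : CongX N P Q) (h' : CongX N P' Q') : CongX N (P + P') (Q + Q') := by
  have := dvd_add h h'
  rwa [sub_add_sub_comm] at this

lemma sub (h : CongX N P Q) (h' : CongX N P' Q') : CongX N (P - P') (Q - Q') := by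
  have := dvd_sub h h'
  rwa [sub_sub_sub_comm] at this

lemma neg (h : CongX N P Q) : CongX N (-P) (-Q) := by
  have := (dvd_neg).mpr h
  rwa [neg_sub', ] at this

lemma mul (h : CongX N P Q) (h' : CongX N P' Q') : CongX N (P * P') (Q * Q') := by
  have : P * P' - Q * Q' = (P - Q) * P' + Q * (P' - Q') := by ring
  rw [CongX, this]
  exact dvd_add (h.mul_right _) (h'.mul_left _)

lemma mono (h : CongX N P Q) (hMN : M ≤ N) : CongX M P Q := (pow_dvd_pow X hMN).trans h

lemma X_pow_mul (j : ℕ) (h : CongX N P Q) : CongX (j + N) (X ^ j * P) (X ^ j * Q) := by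
  rw [CongX, ← mul_sub, pow_add]
  exact mul_dvd_mul_left _ h

end CongX

/-- Linearization: the difference of two powers of exponent at least 2 contains Z' - Z and a further
factor divisible by d, so only the linear coefficient of T survives modulo d·e. -/
lemma mul_dvd_aeval_sub_aeval [Algebra ℝ R] {Z Z' d e : R} (hZ : d ∣ Z) (hZ' : d ∣ Z')
    (he : e ∣ Z' - Z) (T : ℝ[X]) :
    d * e ∣ aeval Z' T - aeval Z T - algebraMap ℝ R (T.coeff 1) * (Z' - Z) := by
  induction T using Polynomial.induction_on' with
  | add p q hp hq =>
    have := dvd_add hp hq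
    simp only [map_add, coeff_add]
    convert this using 1
    ring
  | monomial n a =>
    rw [aeval_monomial, aeval_monomial, coeff_monomial]
    rcases n with _ | _ | n
    · simp
    · simp [mul_sub]
    · rw [if_neg (by omega), map_zero, zero_mul, sub_zero, ← mul_sub]
      refine Dvd.dvd.mul_left ?_ _
      have : Z' ^ (n + 1 + 1) - Z ^ (n + 1 + 1) =
          Z' ^ (n + 1) * (Z' - Z) + Z * (Z' ^ (n + 1) - Z ^ (n + 1)) := by ring
      rw [this]
      exact dvd_add (mul_dvd_mul (dvd_pow hZ' (by omega)) he)
        (mul_dvd_mul hZ (he.trans (sub_dvd_pow_sub_pow _ _ _)))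

lemma sub_dvd_aeval_sub_aeval [Algebra ℝ R] {Z Z' e : R} (he : e ∣ Z' - Z) (T : ℝ[X]) :
    e ∣ aeval Z' T - aeval Z T := by
  have h := mul_dvd_aeval_sub_aeval (one_dvd Z) (one_dvd Z') he T
  rw [one_mul] at h
  have := dvd_add h (he.mul_left (algebraMap ℝ R (T.coeff 1)))
  rwa [sub_add_cancel] at this

lemma dvd_aeval_of_coeff_zero [Algebra ℝ R] {Z d : R} (hZ : d ∣ Z) {T : ℝ[X]}
    (hT : T.coeff 0 = 0) : d ∣ aeval Z T := by
  have h := sub_dvd_aeval_sub_aeval (Z := 0) (Z' := Z) (by simpa using hZ) T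
  rw [aeval_zero_eq, hT, map_zero, sub_zero] at h
  exact h
where
  aeval_zero_eq : aeval (0 : R) T = algebraMap ℝ R (T.coeff 0) := by
    rw [← coeff_zero_eq_aeval_zero']

end Leading

lemma coeff_zero_aeval {R : Type*} [CommRing R] [Algebra ℝ R] {Z : R[X]} (hZ : X ∣ Z) (T : ℝ[X]) :
    (aeval Z T).coeff 0 = algebraMap ℝ R (T.coeff 0) := by
  have h := sub_dvd_aeval_sub_aeval (Z := 0) (Z' := Z) (by simpa using hZ) T
  rw [← coeff_zero_eq_aeval_zero', X_dvd_iff, coeff_sub, sub_eq_zero] at h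
  rw [h, Polynomial.algebraMap_apply, coeff_C_zero]

/-- Quadratic and higher terms in Z start at X⁶. -/
lemma aeval_congX {R : Type*} [CommRing R] [Algebra ℝ R] {Z : R[X]} (hZ : X ^ 3 ∣ Z) (T : ℝ[X]) :
    CongX 6 (aeval Z T) (C (algebraMap ℝ R (T.coeff 0)) + C (algebraMap ℝ R (T.coeff 1)) * Z) := by
  have h := mul_dvd_aeval_sub_aeval (dvd_zero (X ^ 3)) hZ (by simpa using hZ) T
  rw [← coeff_zero_eq_aeval_zero', ← pow_add, sub_zero] at h
  rw [CongX, ← sub_sub]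
  simpa [Polynomial.algebraMap_apply] using h

lemma Lead.mapCoeff {m : ℕ} {P : UnitFun[X]} {c : UnitFun} (L : UnitFun →ₗ[ℝ] ℝ)
    (h : Lead m P c) : Lead m (mapCoeff L P) (L c) :=
  ⟨X_pow_dvd_mapCoeff L h.1, by rw [coeff_mapCoeff, h.2]⟩

lemma CongX.mapCoeff {N : ℕ} {P Q : UnitFun[X]} (L : UnitFun →ₗ[ℝ] ℝ)
    (h : CongX N P Q) : CongX N (mapCoeff L P) (mapCoeff L Q) := by
  rw [CongX, ← map_sub]
  exact X_pow_dvd_mapCoeff L h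

lemma mapCoeff_C (L : UnitFun →ₗ[ℝ] ℝ) (f : UnitFun) : mapCoeff L (C f) = C (L f) :=
  mapCoeff_monomial L 0 f

lemma coeff_dispPoly_add_three (q : ℝ[X]) (n : ℕ) :
    (dispPoly q).coeff (n + 3) = 4 / ((n : ℝ) + 4) * q.coeff n := by
  induction q using Polynomial.induction_on' with
  | add p q hp hq => rw [map_add, coeff_add, hp, hq, coeff_add]; ring
  | monomial m a =>
    rw [dispPoly_monomial, coeff_monomial, coeff_monomial]
    by_cases h : m = n
    · simp [h]
    · rw [if_neg (by omega), if_neg h, mul_zero]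

lemma X_pow_dvd_dispPoly {q : ℝ[X]} {m : ℕ} (h : X ^ m ∣ q) : X ^ (m + 3) ∣ dispPoly q := by
  rw [X_pow_dvd_iff]
  intro d hd
  rcases Nat.lt_or_ge d 3 with h3 | h3
  · exact X_pow_dvd_iff.mp (X_pow_three_dvd_dispPoly q) d h3
  · obtain ⟨k, rfl⟩ : ∃ k, d = k + 3 := ⟨d - 3, by omega⟩
    rw [coeff_dispPoly_add_three, X_pow_dvd_iff.mp h k (by omega), mul_zero]

lemma X_pow_three_dvd_simVar (q : ℝ[X]) : X ^ 3 ∣ simVar q := Dvd.intro _ rfl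

lemma X_pow_dvd_simVar_sub {q q' : ℝ[X]} {m : ℕ} (h : X ^ m ∣ q' - q) :
    X ^ (3 + m) ∣ simVar q' - simVar q := by
  rw [simVar, simVar, ← mul_sub, ← map_sub, pow_add]
  exact mul_dvd_mul_left _ (X_pow_dvd_liftPoly _ h)

lemma X_dvd_derivLift (p : ℝ[X]) : X ∣ derivLift p := by
  rw [X_dvd_iff, derivLift, coeff_liftPoly]
  simp

end ThinFilm
end

/-! ### Moments, and first-order response of the expansions to new coefficients. -/

noncomputable section

namespace ThinFilm

attribute [local instance] Measure.Subtype.measureSpace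

open Polynomial
open scoped SchwartzMap

lemma taylorPoly_coeff_zero (Φ : ℝ → ℝ) {K : ℕ} (h : 0 < K) : (taylorPoly Φ K).coeff 0 = Φ 0 := by
  rw [taylorPoly_coeff Φ h]; simp

lemma taylorPoly_coeff_one (Φ : ℝ → ℝ) {K : ℕ} (h : 1 < K) :
    (taylorPoly Φ K).coeff 1 = deriv Φ 0 := by
  rw [taylorPoly_coeff Φ h]; simp

lemma deriv_iterDerivS (n : ℕ) (Φ : 𝓢(ℝ, ℝ)) (x : ℝ) :
    deriv (iterDerivS n Φ) x = iterDerivS (n + 1) Φ x :=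
  (hasDerivAt_iterDerivS n Φ x).deriv

lemma taylorPoly_curvature_coeff_one {K : ℕ} (h : 1 < K) :
    (taylorPoly (iterDerivS 2 profileS) K).coeff 1 = 0 := by
  rw [taylorPoly_coeff_one _ h, deriv_iterDerivS, iterDerivS_three_profileS]
  simp

lemma taylorPoly_slope_coeff_zero {K : ℕ} (h : 0 < K) :
    (taylorPoly (iterDerivS 1 profileS) K).coeff 0 = 0 := by
  rw [taylorPoly_coeff_zero _ h, deriv_profileS_zero]

lemma taylorPoly_profilePrim_coeff_zero {K : ℕ} (h : 0 < K) :
    (taylorPoly profilePrim K).coeff 0 = 0 := by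
  rw [taylorPoly_coeff_zero _ h, profilePrim, intervalIntegral.integral_same]

lemma taylorPoly_profilePrim_coeff_one {K : ℕ} (h : 1 < K) :
    (taylorPoly profilePrim K).coeff 1 = profileS 0 := by
  rw [taylorPoly_coeff_one _ h, (hasDerivAt_profilePrim 0).deriv]

/-- Integration against `(1-x)^{-a/4}`. -/
def quarterIntegral (a : ℕ) (ha : a < 4) : UnitFun →ₗ[ℝ] ℝ := weightedIntegral (integrable_weight ha)

lemma quarterIntegral_apply {a : ℕ} (ha : a < 4) (f : UnitFun) :
    quarterIntegral a ha f = ∫ x, weight a x * f x := rfl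

lemma powQ_zero : powQ 0 = 1 := by
  ext x
  rw [powQ_apply, UnitFun.one_apply]
  simp

lemma quarterIntegral_powQ (n : ℕ) : quarterIntegral 3 (by norm_num) (powQ n) = betaQuarter n := by
  rw [quarterIntegral_apply]
  have h1 : ∀ x : Ioo (0 : ℝ) 1, weight 3 x * powQ n x =
      (fun y : ℝ => (1 - (1 - y)) ^ ((n : ℝ) / 4) / (1 - y) ^ ((3 : ℝ) / 4)) x := by
    intro x
    have hx : (0 : ℝ) ≤ 1 - x := (sub_pos.mpr x.2.2).le
    simp only [sub_sub_cancel]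
    rw [weight_eq, powQ_apply, Real.rpow_neg hx, ← div_eq_inv_mul]
    norm_num
  simp only [h1]
  rw [integral_unit fun y : ℝ => (1 - (1 - y)) ^ ((n : ℝ) / 4) / (1 - y) ^ ((3 : ℝ) / 4),
    intervalIntegral.integral_comp_sub_left
      (fun y : ℝ => (1 - y) ^ ((n : ℝ) / 4) / y ^ ((3 : ℝ) / 4)) 1]
  simp [betaQuarter]

lemma quarterIntegral_three_one : quarterIntegral 3 (by norm_num) 1 = 4 := by
  rw [← powQ_zero, quarterIntegral_powQ, betaQuarter_zero]

lemma quarterIntegral_one_one : quarterIntegral 1 (by norm_num) 1 = 4 / 3 := by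
  rw [quarterIntegral_apply]
  simp only [UnitFun.one_apply, mul_one, weight_eq]
  rw [integral_unit fun y : ℝ => (1 - y) ^ (-(((1 : ℕ) : ℝ) / 4)),
    intervalIntegral.integral_comp_sub_left (fun y : ℝ => y ^ (-(((1 : ℕ) : ℝ) / 4))) 1,
    integral_rpow (Or.inl (by norm_num))]
  rw [sub_self, sub_zero, Real.zero_rpow (by norm_num), Real.one_rpow]
  norm_num

/-- Evenness of g; it turns the moments taken at -η into the half-line integrals already computed.
-/
lemma iterDerivS_profileS_neg (n : ℕ) (x : ℝ) :
    iterDerivS n profileS (-x) = (-1) ^ n * iterDerivS n profileS x := by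
  have h := iteratedDeriv_comp_neg n profileS (-x)
  rw [funext profileS_neg] at h
  simpa [coe_iterDerivS] using h

lemma moment_iterDerivS_profileS (i j k : ℕ) : moment (iterDerivS i profileS) j k =
    (-1) ^ (j + i) * (∫ η in Ioi (0 : ℝ), η ^ k * iterDerivS (j + i) profileS η) / j.factorial := by
  rw [moment, ← integral_const_mul]
  congr 2
  ext η
  rw [iterDerivS_add, iterDerivS_profileS_neg]
  ring

lemma moment_profileS (j k : ℕ) : moment profileS j k =
    (-1) ^ j * (∫ η in Ioi (0 : ℝ), η ^ k * iterDerivS j profileS η) / j.factorial :=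
  moment_iterDerivS_profileS 0 j k

lemma moment_profileS_zero_one : moment profileS 0 1 = -4 * iterDerivS 2 profileS 0 := by
  rw [moment_profileS, iterDerivS_zero, integral_Ioi_mul_profileS]
  simp

lemma moment_profileS_zero_two : moment profileS 0 2 = 0 := by
  rw [moment_profileS, iterDerivS_zero, integral_Ioi_sq_mul_profileS]
  simp

lemma moment_profileS_zero_four : moment profileS 0 4 = -12 := by
  rw [moment_profileS, iterDerivS_zero, integral_Ioi_pow_four_mul_profileS]
  simp

lemma moment_profileS_one_one : moment profileS 1 1 = 1 / 2 := by
  rw [moment_profileS, integral_Ioi_pow_mul_deriv 0]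
  simp [integral_Ioi_profileS]

lemma moment_slope_zero_one : moment (iterDerivS 1 profileS) 0 1 = 1 / 2 := by
  rw [moment_iterDerivS_profileS, integral_Ioi_pow_mul_deriv 0]
  simp [integral_Ioi_profileS]

lemma moment_slope_zero_two :
    moment (iterDerivS 1 profileS) 0 2 = -8 * iterDerivS 2 profileS 0 := by
  rw [moment_iterDerivS_profileS, integral_Ioi_pow_mul_deriv 1, integral_Ioi_mul_profileS]
  simp
  ring

lemma moment_slope_zero_four : moment (iterDerivS 1 profileS) 0 4 = -32 * profileS 0 := by
  rw [moment_iterDerivS_profileS, integral_Ioi_pow_mul_deriv 3, integral_Ioi_cube_mul_profileS]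
  simp
  ring

lemma moment_slope_one_one : moment (iterDerivS 1 profileS) 1 1 = profileS 0 := by
  rw [moment_iterDerivS_profileS, iterDerivS_succ 1, integral_Ioi_pow_mul_deriv 0]
  simp [integral_Ioi_iterDerivS_one]

/-- Only the linear Taylor term of u₀ responds at order m + 1: the constant term is zero, and higher
ones carry an extra power of X. Within that term only the part linear in the displacement counts,
since w and w' are divisible by X³. -/
lemma lead_dataPoly_sub {u₀ : ℝ → ℝ} (h0 : halfTaylor u₀ 0 = 0) (Φ : 𝓢(ℝ, ℝ)) {K m : ℕ}
    (hK : 1 < K) {w w' : ℝ[X]} (hw : X ^ 3 ∣ w) (hw' : X ^ 3 ∣ w') (hd : X ^ m ∣ w' - w) :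
    Lead (m + 1) (dataPoly u₀ Φ K w' - dataPoly u₀ Φ K w)
      (halfTaylor u₀ 1 * moment Φ 1 1 * (w' - w).coeff m) := by
  have hsum : halfTaylor u₀ 1 * moment Φ 1 1 * (w' - w).coeff m = ∑ k ∈ Finset.range K,
      if k = 1 then halfTaylor u₀ 1 * moment Φ 1 1 * (w' - w).coeff m else 0 := by
    rw [Finset.sum_ite_eq' (Finset.range K) 1]
    simp [hK]
  rw [hsum, dataPoly, dataPoly, ← Finset.sum_sub_distrib]
  refine Lead.sum fun k _ => ?_
  set T : ℝ[X] := ∑ j ∈ Finset.range K, C (moment Φ j k) * X ^ j with hT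
  rw [← mul_sub, mul_assoc]
  rcases k with _ | _ | k
  · rw [h0, if_neg (by norm_num), C_0, zero_mul]
    exact Lead.of_dvd_succ (dvd_zero _)
  · rw [if_pos rfl]
    have h1 := mul_dvd_aeval_sub_aeval hw hw' hd T
    have h2 : T.coeff 1 = moment Φ 1 1 := by
      rw [hT, finsetSum_coeff]
      simp [coeff_X_pow, hK]
    rw [h2] at h1
    have h3 : Lead m (aeval w' T - aeval w T) (moment Φ 1 1 * (w' - w).coeff m) := by
      have h4 := Lead.of_dvd_succ (m := m) (((by rw [← pow_add]; exact pow_dvd_pow X (by omega) :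
        (X : ℝ[X]) ^ (m + 1) ∣ X ^ 3 * X ^ m)).trans h1)
      have h5 := h4.add ((Lead.of_dvd hd).constMul (moment Φ 1 1))
      rwa [zero_add, Polynomial.algebraMap_eq, sub_add_cancel] at h5
    have h6 := (h3.X_pow_mul 1).constMul (halfTaylor u₀ 1)
    rw [add_comm 1 m, ← mul_assoc] at h6
    rw [← mul_assoc, mul_assoc (halfTaylor u₀ 1), zero_add]
    exact h6
  · rw [if_neg (by omega)]
    refine Lead.of_dvd_succ (Dvd.dvd.mul_left ?_ _)
    rw [show m + 1 + 1 = 2 + m by ring, pow_add, pow_add X k 2, mul_comm (X ^ k), mul_assoc]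
    exact mul_dvd_mul_left _ ((sub_dvd_aeval_sub_aeval hd T).mul_left _)

lemma coeff_sub_of_Lead_liftPoly (f : ℕ → UnitFun) {p p' : ℝ[X]} {m : ℕ} (h : X ^ m ∣ p' - p) :
    Lead m (liftPoly f p' - liftPoly f p) ((p' - p).coeff m • f m) := by
  rw [← map_sub]
  exact ⟨X_pow_dvd_liftPoly f h, coeff_liftPoly f _ m⟩

lemma X_dvd_simVar (q : ℝ[X]) : X ∣ simVar q :=
  (dvd_pow_self X three_ne_zero).trans (X_pow_three_dvd_simVar q)

/-- Effect on the first expansion of changing the coefficients of orders `n+4` and `n+1`. -/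
lemma lead_polyA_sub {u₀ : ℝ → ℝ} (h0 : halfTaylor u₀ 0 = 0) {p p' q q' : ℝ[X]} {n K : ℕ}
    (hK : 1 < K) (hp : X ^ (n + 4) ∣ p' - p) (hq : X ^ (n + 1) ∣ q' - q) :
    Lead (n + 5) (polyA u₀ p' q' K - polyA u₀ p q K)
      (-(iterDerivS 2 profileS 0 * betaQuarter (n + 4) * (p' - p).coeff (n + 4)) -
        halfTaylor u₀ 1 * (1 / 2) * (4 / ((n : ℝ) + 5) * (q' - q).coeff (n + 1))) := by
  have hZ := X_pow_dvd_simVar_sub hq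
  rw [show 3 + (n + 1) = n + 4 by ring] at hZ
  have hw : X ^ (n + 4) ∣ dispPoly q' - dispPoly q := by
    rw [← map_sub]; exact X_pow_dvd_dispPoly hq
  have e1 : Lead (n + 4) (aeval (simVar q') (taylorPoly (iterDerivS 2 profileS) K) *
        liftPoly powQ p' - aeval (simVar q) (taylorPoly (iterDerivS 2 profileS) K) *
        liftPoly powQ p)
      ((iterDerivS 2 profileS 0 * (p' - p).coeff (n + 4)) • powQ (n + 4)) := by
    -- Since g'''(0) = 0, changing the similarity variable affects g'' only at order n + 7, so the
    -- curvature integral responds to the change of p alone.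
    have h1 := mul_dvd_aeval_sub_aeval (X_pow_three_dvd_simVar q) (X_pow_three_dvd_simVar q') hZ
      (taylorPoly (iterDerivS 2 profileS) K)
    rw [taylorPoly_curvature_coeff_one hK, map_zero, zero_mul, sub_zero, ← pow_add] at h1
    have h2 : Lead (n + 4) ((aeval (simVar q') (taylorPoly (iterDerivS 2 profileS) K) -
        aeval (simVar q) (taylorPoly (iterDerivS 2 profileS) K)) * liftPoly powQ p') 0 :=
      Lead.of_dvd_succ (((pow_dvd_pow X (by omega)).trans h1).mul_right _)
    have h3 := (Lead.of_dvd (m := 0) (P := aeval (simVar q)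
      (taylorPoly (iterDerivS 2 profileS) K)) (by simp)).mul (coeff_sub_of_Lead_liftPoly powQ hp)
    rw [coeff_zero_aeval (X_dvd_simVar q), taylorPoly_coeff_zero _ (by omega), zero_add] at h3
    have h4 := h2.add h3
    rw [zero_add, ← Algebra.smul_def, smul_smul] at h4
    convert h4 using 1
    ring
  have e2 := ((e1.mapCoeff (quarterIntegral 3 (by norm_num))).X_pow_mul 1).neg
  rw [map_smul, quarterIntegral_powQ, smul_eq_mul, map_sub] at e2
  have e3 := lead_dataPoly_sub h0 profileS hK (X_pow_three_dvd_dispPoly q)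
    (X_pow_three_dvd_dispPoly q') hw
  have hw3 : (dispPoly q' - dispPoly q).coeff (n + 4) =
      4 / ((n : ℝ) + 5) * (q' - q).coeff (n + 1) := by
    rw [← map_sub, show n + 4 = n + 1 + 3 by ring, coeff_dispPoly_add_three]
    push_cast
    rw [show (n : ℝ) + 1 + 4 = n + 5 by ring]
  rw [hw3, moment_profileS_one_one] at e3
  have e4 : Lead (n + 5) (C (1 / 2) * (X ^ 2 * mapCoeff (quarterIntegral 2 (by norm_num))
      (aeval (simVar q') (taylorPoly (iterDerivS 1 profileS) K) * 1 -
        aeval (simVar q) (taylorPoly (iterDerivS 1 profileS) K) * 1))) 0 := by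
    refine Lead.of_dvd_succ (Dvd.dvd.mul_left ?_ _)
    rw [show n + 5 + 1 = 2 + (n + 4) by ring, pow_add]
    refine mul_dvd_mul_left _ (X_pow_dvd_mapCoeff _ ?_)
    rw [mul_one, mul_one]
    exact sub_dvd_aeval_sub_aeval hZ _
  rw [map_sub] at e4
  rw [show 1 + (n + 4) = n + 5 by ring] at e2
  have e := e2.sub (e3.sub e4)
  simp only [polyA]
  convert e using 1
  · simp only [quarterIntegral]
    ring
  · ring

/-- Effect on the second expansion of changing the coefficients of orders `n+4` and `n+1`. -/
lemma lead_polyB_sub {u₀ : ℝ → ℝ} (h0 : halfTaylor u₀ 0 = 0) {p p' q q' : ℝ[X]} {n K : ℕ}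
    (hK : 1 < K) (hp : X ^ (n + 4) ∣ p' - p) (hq : X ^ (n + 1) ∣ q' - q)
    (hp0 : p.coeff 0 = halfTaylor u₀ 1) :
    Lead (n + 5) (polyB u₀ p' q' K - polyB u₀ p q K)
      ((p' - p).coeff (n + 4) -
        8 / 3 * profileS 0 * halfTaylor u₀ 1 * (q' - q).coeff (n + 1)) := by
  have hZ := X_pow_dvd_simVar_sub hq
  rw [show 3 + (n + 1) = n + 4 by ring] at hZ
  have hw : X ^ (n + 4) ∣ dispPoly q' - dispPoly q := by
    rw [← map_sub]; exact X_pow_dvd_dispPoly hq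
  have hp0' : p'.coeff 0 = halfTaylor u₀ 1 := by
    have := X_pow_dvd_iff.mp hp 0 (by omega)
    rw [coeff_sub] at this
    linarith
  have e1 := (Lead.of_dvd hp).X_pow_mul 1
  have e2 : Lead (n + 5) (C (2 * halfTaylor u₀ 1) * (X ^ 1 *
      (aeval (dispPoly q') (taylorPoly profilePrim K) -
        aeval (dispPoly q) (taylorPoly profilePrim K))))
      (2 * halfTaylor u₀ 1 * (profileS 0 * (dispPoly q' - dispPoly q).coeff (n + 4))) := by
    have h1 := mul_dvd_aeval_sub_aeval (X_pow_three_dvd_dispPoly q) (X_pow_three_dvd_dispPoly q') hw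
      (taylorPoly profilePrim K)
    rw [taylorPoly_profilePrim_coeff_one hK, ← pow_add] at h1
    have h2 := (Lead.of_dvd_succ (m := n + 4) ((pow_dvd_pow X (by omega)).trans h1)).add
      ((Lead.of_dvd hw).constMul (profileS 0))
    rw [zero_add, Polynomial.algebraMap_eq, sub_add_cancel] at h2
    have h3 := (h2.X_pow_mul 1).constMul (2 * halfTaylor u₀ 1)
    rwa [show 1 + (n + 4) = n + 5 by ring] at h3
  have e3 : Lead (n + 5) (C 2 * (X ^ 1 * mapCoeff (quarterIntegral 0 (by norm_num))
      (aeval (simVar q') (taylorPoly profilePrim K) * derivLift p' -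
        aeval (simVar q) (taylorPoly profilePrim K) * derivLift p))) 0 := by
    refine Lead.of_dvd_succ (Dvd.dvd.mul_left ?_ _)
    rw [show n + 5 + 1 = 1 + (n + 5) by ring, pow_add _ 1]
    refine mul_dvd_mul_left _ (X_pow_dvd_mapCoeff _ ?_)
    have h1 : aeval (simVar q') (taylorPoly profilePrim K) * derivLift p' -
        aeval (simVar q) (taylorPoly profilePrim K) * derivLift p =
        (aeval (simVar q') (taylorPoly profilePrim K) -
          aeval (simVar q) (taylorPoly profilePrim K)) * derivLift p' +
        (derivLift p' - derivLift p) * aeval (simVar q) (taylorPoly profilePrim K) := by ring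
    rw [h1, pow_succ]
    refine dvd_add (mul_dvd_mul (sub_dvd_aeval_sub_aeval hZ _) (X_dvd_derivLift p'))
      (mul_dvd_mul ?_ (dvd_aeval_of_coeff_zero (X_dvd_simVar q)
        (taylorPoly_profilePrim_coeff_zero (by omega))))
    rw [derivLift, derivLift, ← map_sub]
    exact X_pow_dvd_liftPoly _ hp
  have e4 : Lead (n + 5) (C 2 * ((q' - q) * (X ^ 4 * mapCoeff (quarterIntegral 1 (by norm_num))
      (aeval (simVar q') (taylorPoly profileS K) * liftPoly powQ p'))))
      (2 * ((q' - q).coeff (n + 1) * (4 / 3 * (profileS 0 * halfTaylor u₀ 1)))) := by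
    have h1 := ((Lead.of_dvd (m := 0) (P := aeval (simVar q') (taylorPoly profileS K) *
      liftPoly powQ p') (by simp)).mapCoeff (quarterIntegral 1 (by norm_num))).X_pow_mul 4
    rw [mul_coeff_zero, coeff_zero_aeval (X_dvd_simVar q'), taylorPoly_coeff_zero _ (by omega),
      coeff_liftPoly, hp0', powQ_zero, ← Algebra.smul_def, map_smul, map_smul,
      quarterIntegral_one_one, smul_eq_mul, smul_eq_mul] at h1
    have h2 := ((Lead.of_dvd hq).mul h1).constMul 2
    rw [show n + 1 + (4 + 0) = n + 5 by ring] at h2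
    convert h2 using 1
    ring
  have e5 : Lead (n + 5) (C 2 * (q * (X ^ 4 * mapCoeff (quarterIntegral 1 (by norm_num))
      (aeval (simVar q') (taylorPoly profileS K) * liftPoly powQ p' -
        aeval (simVar q) (taylorPoly profileS K) * liftPoly powQ p)))) 0 := by
    refine Lead.of_dvd_succ (Dvd.dvd.mul_left (Dvd.dvd.mul_left ?_ _) _)
    refine (pow_dvd_pow X (show n + 5 + 1 ≤ 4 + (n + 4) by omega)).trans ?_
    rw [pow_add]
    refine mul_dvd_mul_left _ (X_pow_dvd_mapCoeff _ ?_)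
    have h1 : aeval (simVar q') (taylorPoly profileS K) * liftPoly powQ p' -
        aeval (simVar q) (taylorPoly profileS K) * liftPoly powQ p =
        (aeval (simVar q') (taylorPoly profileS K) -
          aeval (simVar q) (taylorPoly profileS K)) * liftPoly powQ p' +
        (liftPoly powQ p' - liftPoly powQ p) * aeval (simVar q) (taylorPoly profileS K) := by ring
    rw [h1]
    refine dvd_add ((sub_dvd_aeval_sub_aeval hZ _).mul_right _) (Dvd.dvd.mul_right ?_ _)
    exact (coeff_sub_of_Lead_liftPoly powQ hp).1
  have e6 := (lead_dataPoly_sub h0 (iterDerivS 1 profileS) hK (X_pow_three_dvd_dispPoly q)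
    (X_pow_three_dvd_dispPoly q') hw).constMul 2
  rw [moment_slope_one_one] at e6
  have e7 : Lead (n + 5) (X ^ 2 * mapCoeff (quarterIntegral 3 (by norm_num))
      (aeval (simVar q') (taylorPoly (iterDerivS 2 profileS) K) * 1 -
        aeval (simVar q) (taylorPoly (iterDerivS 2 profileS) K) * 1)) 0 := by
    refine Lead.of_dvd_succ ?_
    rw [show n + 5 + 1 = 2 + (n + 4) by ring, pow_add]
    refine mul_dvd_mul_left _ (X_pow_dvd_mapCoeff _ ?_)
    rw [mul_one, mul_one]
    exact sub_dvd_aeval_sub_aeval hZ _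
  rw [map_sub] at e3 e5 e7
  rw [show 1 + (n + 4) = n + 5 by ring] at e1
  -- The contributions `e2` (from H_t) and `e6` (from the datum) cancel, because β(0) equals the
  -- slope of u₀ at 0 and both carry g(0). The response to q comes only from the explicit prefactor
  -- V in `e4`.
  have e := ((((e1.add e2).add e3).sub e4).sub e5).sub (e6.sub e7)
  simp only [polyB, hp0, hp0']
  convert e using 1
  · simp only [quarterIntegral]
    ring
  · ring

end ThinFilm
end

/-! ### The base orders through τ⁴ and the determinant of the recursion. -/

noncomputable section

namespace ThinFilm

attribute [local instance] Measure.Subtype.measureSpace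

open Polynomial
open scoped SchwartzMap

lemma CongX.sum {R ι : Type*} [CommRing R] {N : ℕ} {s : Finset ι} {P Q : ι → R[X]}
    (h : ∀ i ∈ s, CongX N (P i) (Q i)) : CongX N (∑ i ∈ s, P i) (∑ i ∈ s, Q i) := by
  rw [CongX, ← Finset.sum_sub_distrib]
  exact Finset.dvd_sum h

lemma CongX.of_dvd {R : Type*} [CommRing R] {N : ℕ} {P : R[X]} (h : X ^ N ∣ P) : CongX N P 0 := by
  rwa [CongX, sub_zero]

lemma CongX.of_eq {R : Type*} [CommRing R] {N : ℕ} {P Q : R[X]} (h : P = Q) : CongX N P Q :=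
  h ▸ CongX.refl P

lemma dispPoly_congX (q : ℝ[X]) : CongX 4 (dispPoly q) (C (q.coeff 0) * X ^ 3) := by
  rw [CongX, X_pow_dvd_iff]
  intro d hd
  rw [coeff_sub, coeff_C_mul, coeff_X_pow]
  rcases Nat.lt_or_ge d 3 with h | h
  · rw [X_pow_dvd_iff.mp (X_pow_three_dvd_dispPoly q) d h, if_neg (by omega)]
    ring
  · obtain rfl : d = 0 + 3 := by omega
    rw [coeff_dispPoly_add_three]
    norm_num

/-- The displacement starts at X³, so it is visible below X⁵ only in the linear term of u₀. -/
lemma dataPoly_congX {u₀ : ℝ → ℝ} (h0 : halfTaylor u₀ 0 = 0) (h3 : halfTaylor u₀ 3 = 0)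
    (Φ : 𝓢(ℝ, ℝ)) {K : ℕ} (hK : 5 ≤ K) (q : ℝ[X]) :
    CongX 5 (dataPoly u₀ Φ K (dispPoly q))
      (C (halfTaylor u₀ 1) * X ^ 1 * (C (moment Φ 0 1) + C (moment Φ 1 1) * (C (q.coeff 0) * X ^ 3))
        + C (halfTaylor u₀ 2) * X ^ 2 * C (moment Φ 0 2)
        + C (halfTaylor u₀ 4) * X ^ 4 * C (moment Φ 0 4)) := by
  have hT : ∀ k, CongX 4 (aeval (dispPoly q) (∑ j ∈ Finset.range K, C (moment Φ j k) * X ^ j))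
      (C (moment Φ 0 k) + C (moment Φ 1 k) * (C (q.coeff 0) * X ^ 3)) := by
    intro k
    have h := (aeval_congX (X_pow_three_dvd_dispPoly q)
      (∑ j ∈ Finset.range K, C (moment Φ j k) * X ^ j)).mono (show 4 ≤ 6 by norm_num)
    have hc : ∀ i < K, (∑ j ∈ Finset.range K, C (moment Φ j k) * X ^ j).coeff i = moment Φ i k := by
      intro i hi
      rw [finsetSum_coeff]
      simp [coeff_X_pow, hi]
    rw [hc 0 (by omega), hc 1 (by omega)] at h
    exact h.trans ((CongX.refl _).add ((CongX.refl _).mul (dispPoly_congX q)))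
  have hT1 : ∀ k, CongX 1 (aeval (dispPoly q) (∑ j ∈ Finset.range K, C (moment Φ j k) * X ^ j))
      (C (moment Φ 0 k)) := by
    intro k
    refine ((hT k).mono (show 1 ≤ 4 by norm_num)).trans ?_
    rw [CongX, add_sub_cancel_left]
    exact Dvd.dvd.mul_left (Dvd.dvd.mul_left (pow_dvd_pow X (by norm_num)) _) _
  have hT3 : ∀ k, CongX 3 (aeval (dispPoly q) (∑ j ∈ Finset.range K, C (moment Φ j k) * X ^ j))
      (C (moment Φ 0 k)) := by
    intro k
    refine ((hT k).mono (show 3 ≤ 4 by norm_num)).trans ?_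
    rw [CongX, add_sub_cancel_left]
    exact Dvd.dvd.mul_left (Dvd.dvd.mul_left (pow_dvd_pow X (by norm_num)) _) _
  set Q : ℕ → ℝ[X] := fun k => if k = 1 then C (halfTaylor u₀ 1) * X ^ 1 *
      (C (moment Φ 0 1) + C (moment Φ 1 1) * (C (q.coeff 0) * X ^ 3)) else
    if k = 2 then C (halfTaylor u₀ 2) * X ^ 2 * C (moment Φ 0 2) else
    if k = 4 then C (halfTaylor u₀ 4) * X ^ 4 * C (moment Φ 0 4) else 0 with hQ
  have hsum : ∑ k ∈ Finset.range K, Q k = Q 1 + Q 2 + Q 4 := by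
    rw [← Finset.sum_subset (Finset.range_mono hK)]
    · simp [Finset.sum_range_succ, hQ]
    · intro k _ hk
      rw [Finset.mem_range, not_lt] at hk
      simp only [hQ]
      rw [if_neg (by omega), if_neg (by omega), if_neg (by omega)]
  have hgoal : CongX 5 (dataPoly u₀ Φ K (dispPoly q)) (∑ k ∈ Finset.range K, Q k) := by
    refine CongX.sum fun k _ => ?_
    rw [mul_assoc]
    by_cases hk1 : k = 1
    · subst hk1
      have : Q 1 = C (halfTaylor u₀ 1) * (X ^ 1 *
        (C (moment Φ 0 1) + C (moment Φ 1 1) * (C (q.coeff 0) * X ^ 3))) := by simp [hQ, mul_assoc]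
      rw [this]
      exact (CongX.refl _).mul ((hT 1).X_pow_mul 1)
    by_cases hk2 : k = 2
    · subst hk2
      have : Q 2 = C (halfTaylor u₀ 2) * (X ^ 2 * C (moment Φ 0 2)) := by simp [hQ, mul_assoc]
      rw [this]
      exact (CongX.refl _).mul ((hT3 2).X_pow_mul 2)
    by_cases hk4 : k = 4
    · subst hk4
      have : Q 4 = C (halfTaylor u₀ 4) * (X ^ 4 * C (moment Φ 0 4)) := by simp [hQ, mul_assoc]
      rw [this]
      exact (CongX.refl _).mul ((hT1 4).X_pow_mul 4)
    have hQk : Q k = 0 := by simp [hQ, hk1, hk2, hk4]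
    rw [hQk]
    apply CongX.of_dvd
    by_cases hk5 : 5 ≤ k
    · exact Dvd.dvd.mul_left (Dvd.dvd.mul_right (pow_dvd_pow X hk5) _) _
    · have : k = 0 ∨ k = 3 := by omega
      rcases this with rfl | rfl
      · rw [h0]; simp
      · rw [h3]; simp
  rw [hsum] at hgoal
  simpa [hQ] using hgoal

lemma congX_const_of_gap {p : ℝ[X]} (h1 : p.coeff 1 = 0) (h2 : p.coeff 2 = 0)
    (h3 : p.coeff 3 = 0) : CongX 4 p (C (p.coeff 0)) := by
  rw [CongX, X_pow_dvd_iff]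
  intro d hd
  rw [coeff_sub, coeff_C]
  interval_cases d <;> simp [h1, h2, h3]

lemma liftPoly_congX {p : ℝ[X]} (h1 : p.coeff 1 = 0) (h2 : p.coeff 2 = 0) (h3 : p.coeff 3 = 0) :
    CongX 4 (liftPoly powQ p) (C (p.coeff 0 • 1)) := by
  have h : liftPoly powQ (C (p.coeff 0)) = C (p.coeff 0 • 1) := by
    rw [← powQ_zero]; exact liftPoly_monomial powQ 0 _
  rw [CongX, ← h, ← map_sub]
  exact X_pow_dvd_liftPoly _ (congX_const_of_gap h1 h2 h3)

lemma aeval_curvature_congX {K : ℕ} (hK : 1 < K) (q : ℝ[X]) :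
    CongX 6 (aeval (simVar q) (taylorPoly (iterDerivS 2 profileS) K))
      (C (algebraMap ℝ UnitFun (iterDerivS 2 profileS 0))) := by
  have h := aeval_congX (X_pow_three_dvd_simVar q) (taylorPoly (iterDerivS 2 profileS) K)
  rwa [taylorPoly_curvature_coeff_one hK, taylorPoly_coeff_zero _ (by omega),
    (algebraMap ℝ UnitFun).map_zero, C_0, zero_mul, add_zero] at h

/-- Order τ² is absent because the second half-line moment of g is zero, and order τ³ because
u₀'''(0) = 0. The remaining orders τ and τ⁴ each determine one unknown. -/
lemma polyA_congX {u₀ : ℝ → ℝ} (h0 : halfTaylor u₀ 0 = 0) (hu3 : halfTaylor u₀ 3 = 0)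
    {p : ℝ[X]} (h1 : p.coeff 1 = 0) (h2 : p.coeff 2 = 0) (h3 : p.coeff 3 = 0) (q : ℝ[X])
    {K : ℕ} (hK : 5 ≤ K) :
    CongX 5 (polyA u₀ p q K)
      (C (4 * iterDerivS 2 profileS 0 * (halfTaylor u₀ 1 - p.coeff 0)) * X +
        C (12 * halfTaylor u₀ 4 - halfTaylor u₀ 1 * q.coeff 0 / 2) * X ^ 4) := by
  have e1 : CongX 5 (-(X ^ 1 * mapCoeff (quarterIntegral 3 (by norm_num))
      (aeval (simVar q) (taylorPoly (iterDerivS 2 profileS) K) * liftPoly powQ p)))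
      (-(X ^ 1 * C (iterDerivS 2 profileS 0 * (p.coeff 0 * 4)))) := by
    have h := ((((aeval_curvature_congX (show 1 < K by omega) q).mono
      (show 4 ≤ 6 by norm_num)).mul (liftPoly_congX h1 h2 h3)).mapCoeff
        (quarterIntegral 3 (by norm_num))).X_pow_mul 1
    rw [← C_mul, mapCoeff_C, ← Algebra.smul_def, LinearMap.map_smul, LinearMap.map_smul,
      quarterIntegral_three_one, smul_eq_mul, smul_eq_mul] at h
    exact h.neg
  have e2 := dataPoly_congX h0 hu3 profileS hK q
  rw [moment_profileS_zero_one, moment_profileS_one_one, moment_profileS_zero_two,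
    moment_profileS_zero_four] at e2
  have e3 : CongX 5 (C (1 / 2) * (X ^ 2 * mapCoeff (quarterIntegral 2 (by norm_num))
      (aeval (simVar q) (taylorPoly (iterDerivS 1 profileS) K) * 1))) (C (1 / 2) * 0) := by
    refine (CongX.refl _).mul (CongX.of_dvd ?_)
    rw [show 5 = 2 + 3 by norm_num, pow_add]
    refine mul_dvd_mul_left _ (X_pow_dvd_mapCoeff _ ?_)
    rw [mul_one]
    exact dvd_aeval_of_coeff_zero (X_pow_three_dvd_simVar q)
      (taylorPoly_slope_coeff_zero (by omega))
  have e := e1.sub (e2.sub e3)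
  have hpoly : polyA u₀ p q K = -(X ^ 1 * mapCoeff (quarterIntegral 3 (by norm_num))
      (aeval (simVar q) (taylorPoly (iterDerivS 2 profileS) K) * liftPoly powQ p)) -
      (dataPoly u₀ profileS K (dispPoly q) -
        C (1 / 2) * (X ^ 2 * mapCoeff (quarterIntegral 2 (by norm_num))
          (aeval (simVar q) (taylorPoly (iterDerivS 1 profileS) K) * 1))) := by
    simp only [polyA, quarterIntegral]
    ring
  rw [← hpoly] at e
  refine CongX.trans e (CongX.of_eq ?_)
  refine Polynomial.funext fun r => ?_
  simp only [eval_add, eval_sub, eval_neg, eval_mul, eval_C, eval_pow, eval_X, eval_zero]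
  ring

/-- The compatibility of the two equations. Order τ cancels by the value of β₀, and order τ² is
4g''(0)(1 + 4·`halfTaylor u₀ 2`), which explains the condition u₀''(0) = -1/2. Order τ⁴ is a
multiple of the relation already imposed on V₀ by the first equation. -/
lemma polyB_congX {u₀ : ℝ → ℝ} (h0 : halfTaylor u₀ 0 = 0) (hu2 : halfTaylor u₀ 2 = -1 / 4)
    (hu3 : halfTaylor u₀ 3 = 0) {p q : ℝ[X]} (h1 : p.coeff 1 = 0) (h2 : p.coeff 2 = 0)
    (h3 : p.coeff 3 = 0) (hp : p.coeff 0 = halfTaylor u₀ 1)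
    (hq : halfTaylor u₀ 1 * q.coeff 0 = 24 * halfTaylor u₀ 4) {K : ℕ} (hK : 5 ≤ K) :
    X ^ 5 ∣ polyB u₀ p q K := by
  have hw := dispPoly_congX q
  have e1 := (congX_const_of_gap h1 h2 h3).X_pow_mul 1
  have e2 : CongX 5 (C (2 * p.coeff 0) * (X ^ 1 * aeval (dispPoly q) (taylorPoly profilePrim K)))
      (C (2 * p.coeff 0) * (X ^ 1 * (C (profileS 0) * (C (q.coeff 0) * X ^ 3)))) := by
    have h := (aeval_congX (X_pow_three_dvd_dispPoly q) (taylorPoly profilePrim K)).mono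
      (show 4 ≤ 6 by norm_num)
    rw [taylorPoly_profilePrim_coeff_zero (by omega), taylorPoly_profilePrim_coeff_one (by omega),
      (algebraMap ℝ ℝ).map_zero, C_0, zero_add] at h
    exact (CongX.refl _).mul ((h.trans ((CongX.refl _).mul hw)).X_pow_mul 1)
  have e3 : CongX 5 (C 2 * (X ^ 1 * mapCoeff (quarterIntegral 0 (by norm_num))
      (aeval (simVar q) (taylorPoly profilePrim K) * derivLift p))) (C 2 * 0) := by
    refine (CongX.refl _).mul (CongX.of_dvd ?_)
    rw [show 5 = 1 + 4 by norm_num, pow_add]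
    refine mul_dvd_mul_left _ (X_pow_dvd_mapCoeff _ ?_)
    rw [pow_succ]
    exact mul_dvd_mul (dvd_aeval_of_coeff_zero (X_pow_three_dvd_simVar q)
      (taylorPoly_profilePrim_coeff_zero (by omega))) (X_dvd_derivLift p)
  have e4 : CongX 5 (C 2 * (X ^ 4 * (q * mapCoeff (quarterIntegral 1 (by norm_num))
      (aeval (simVar q) (taylorPoly profileS K) * liftPoly powQ p))))
      (C 2 * (X ^ 4 * (C (q.coeff 0) * C (profileS 0 * (p.coeff 0 * (4 / 3)))))) := by
    have hc : ∀ {R : Type} [CommRing R] (P : R[X]), CongX 1 P (C (P.coeff 0)) := by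
      intro R _ P
      rw [CongX, pow_one, X_dvd_iff]
      simp
    have h := (hc (aeval (simVar q) (taylorPoly profileS K) * liftPoly powQ p)).mapCoeff
      (quarterIntegral 1 (by norm_num))
    rw [mul_coeff_zero, coeff_zero_aeval (X_dvd_simVar q), taylorPoly_coeff_zero _ (by omega),
      coeff_liftPoly, powQ_zero, mapCoeff_C, ← Algebra.smul_def, LinearMap.map_smul,
      LinearMap.map_smul, quarterIntegral_one_one, smul_eq_mul, smul_eq_mul] at h
    exact (CongX.refl _).mul (((hc q).mul h).X_pow_mul 4)
  have e5 := dataPoly_congX h0 hu3 (iterDerivS 1 profileS) hK q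
  rw [moment_slope_zero_one, moment_slope_one_one, moment_slope_zero_two,
    moment_slope_zero_four] at e5
  have e6 : CongX 5 (X ^ 2 * mapCoeff (quarterIntegral 3 (by norm_num))
      (aeval (simVar q) (taylorPoly (iterDerivS 2 profileS) K) * 1))
      (X ^ 2 * C (iterDerivS 2 profileS 0 * 4)) := by
    have h := (((aeval_curvature_congX (show 1 < K by omega) q).mapCoeff
        (quarterIntegral 3 (by norm_num))).X_pow_mul 2).mono (show 5 ≤ 2 + 6 by norm_num)
    rw [mapCoeff_C, Algebra.algebraMap_eq_smul_one, LinearMap.map_smul,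
      quarterIntegral_three_one, smul_eq_mul] at h
    rwa [mul_one]
  have e := ((((e1.add e2).add e3).sub e4).sub (((CongX.refl (C 2)).mul e5).sub e6))
  have hpoly : polyB u₀ p q K = X ^ 1 * p +
      C (2 * p.coeff 0) * (X ^ 1 * aeval (dispPoly q) (taylorPoly profilePrim K)) +
      C 2 * (X ^ 1 * mapCoeff (quarterIntegral 0 (by norm_num))
        (aeval (simVar q) (taylorPoly profilePrim K) * derivLift p)) -
      C 2 * (X ^ 4 * (q * mapCoeff (quarterIntegral 1 (by norm_num))
        (aeval (simVar q) (taylorPoly profileS K) * liftPoly powQ p))) -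
      (C 2 * dataPoly u₀ (iterDerivS 1 profileS) K (dispPoly q) -
        X ^ 2 * mapCoeff (quarterIntegral 3 (by norm_num))
          (aeval (simVar q) (taylorPoly (iterDerivS 2 profileS) K) * 1)) := by
    simp only [polyB, quarterIntegral]
    ring
  rw [← hpoly] at e
  have h := CongX.trans e (CongX.of_eq (Q := 0) ?_)
  · rwa [CongX, sub_zero] at h
  refine Polynomial.funext fun r => ?_
  simp only [eval_add, eval_sub, eval_mul, eval_C, eval_pow, eval_X, eval_zero]
  rw [hp, hu2]
  linear_combination (-8 / 3 * profileS 0 * r ^ 4) * hq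

lemma iterDerivS_two_profileS_ne_zero : iterDerivS 2 profileS 0 ≠ 0 := by
  rw [coe_iterDerivS, iteratedDeriv_two_profileS_zero]
  have := Real.Gamma_pos_of_pos (s := 3 / 4) (by norm_num)
  have : 0 < Real.Gamma (3 / 4) / (4 * π) := by positivity
  linarith

lemma X_pow_five_dvd_polyA_iff {u₀ : ℝ → ℝ} (h0 : halfTaylor u₀ 0 = 0) (hu3 : halfTaylor u₀ 3 = 0)
    {p : ℝ[X]} (h1 : p.coeff 1 = 0) (h2 : p.coeff 2 = 0) (h3 : p.coeff 3 = 0) (q : ℝ[X])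
    {K : ℕ} (hK : 5 ≤ K) :
    X ^ 5 ∣ polyA u₀ p q K ↔
      p.coeff 0 = halfTaylor u₀ 1 ∧ halfTaylor u₀ 1 * q.coeff 0 = 24 * halfTaylor u₀ 4 := by
  have h := polyA_congX h0 hu3 h1 h2 h3 q hK
  rw [CongX] at h
  have hiff := dvd_iff_dvd_of_dvd_sub h
  rw [hiff]
  constructor
  · intro hd
    have hc := X_pow_dvd_iff.mp hd
    have c1 := hc 1 (by norm_num)
    have c4 := hc 4 (by norm_num)
    rw [coeff_add, coeff_C_mul, coeff_C_mul, coeff_X, coeff_X_pow] at c1 c4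
    norm_num [iterDerivS_two_profileS_ne_zero] at c1 c4
    constructor <;> linarith
  · rintro ⟨ha, hb⟩
    rw [ha, sub_self, mul_zero, C_0, zero_mul, zero_add,
      show 12 * halfTaylor u₀ 4 - halfTaylor u₀ 1 * q.coeff 0 / 2 = 0 by linarith, C_0, zero_mul]
    exact dvd_zero _

/-- The linear system for the coefficients of orders `n+4` and `n+1` is nondegenerate. -/
lemma system_det_ne_zero {c : ℝ} (hc : c ≠ 0) (n : ℕ) :
    8 / 3 * profileS 0 * iterDerivS 2 profileS 0 * betaQuarter (n + 4) * c + 2 * c / ((n : ℝ) + 5)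
      ≠ 0 := by
  have h := constC_ne_one (n + 4)
  rw [constC_eq_profileS, ← coe_iterDerivS] at h
  push_cast at h
  have hn : (n : ℝ) + 5 ≠ 0 := by positivity
  intro h'
  apply h
  -- After clearing denominators the bracket is 6(1 - C_{n+4}).
  have h2 : c * (8 * profileS 0 * iterDerivS 2 profileS 0 * betaQuarter (n + 4) * (n + 5) + 6) =
      0 := by
    field_simp at h'
    linear_combination h'
  linear_combination (-1 / 6) * (mul_eq_zero.mp h2).resolve_left hc

end ThinFilm
end

/-! ### Formal solutions as compatible polynomial truncations: existence and uniqueness. -/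

noncomputable section

namespace ThinFilm

open Polynomial
open scoped SchwartzMap

/-- The partial sum `∑_{n ≤ M} c_n τ^n` as a polynomial. -/
def truncPoly (c : ℕ → ℝ) (M : ℕ) : ℝ[X] := ∑ n ∈ Finset.range (M + 1), C (c n) * X ^ n

lemma coeff_truncPoly (c : ℕ → ℝ) {M n : ℕ} (h : n ≤ M) : (truncPoly c M).coeff n = c n := by
  simp [truncPoly, coeff_C_mul, coeff_X_pow, Nat.lt_succ_of_le h]

lemma partialSum_eq_fracPoly (c : ℕ → ℝ) (M : ℕ) {t : ℝ} (ht : 0 ≤ t) :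
    partialSum c M t = fracPoly (truncPoly c M) t := by
  simp only [partialSum, fracPoly, truncPoly, eval_finsetSum, eval_mul, eval_C, eval_pow, eval_X,
    rpow_quarter_pow ht]

lemma displ_congr {V V' : ℝ → ℝ} (h : ∀ t, 0 ≤ t → V t = V' t) {t : ℝ} (ht : 0 ≤ t) :
    displ V t = displ V' t := by
  refine intervalIntegral.integral_congr fun s hs => h s ?_
  rw [uIcc_of_le ht] at hs
  exact hs.1

lemma residualA_congr (u₀ : ℝ → ℝ) {V V' β β' : ℝ → ℝ} (hV : ∀ t, 0 ≤ t → V t = V' t)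
    (hβ : ∀ t, 0 ≤ t → β t = β' t) {t : ℝ} (ht : 0 ≤ t) :
    residualA u₀ V β t = residualA u₀ V' β' t := by
  have h1 : (∫ s in (0 : ℝ)..t, iteratedDeriv 2 (green (t - s)) (displ V t - displ V s) * β s) =
      ∫ s in (0 : ℝ)..t, iteratedDeriv 2 (green (t - s)) (displ V' t - displ V' s) * β' s := by
    refine intervalIntegral.integral_congr fun s hs => ?_
    rw [uIcc_of_le ht] at hs
    simp only [displ_congr hV ht, displ_congr hV hs.1, hβ s hs.1]
  have h2 : (∫ s in (0 : ℝ)..t, deriv (green (t - s)) (displ V t - displ V s)) =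
      ∫ s in (0 : ℝ)..t, deriv (green (t - s)) (displ V' t - displ V' s) := by
    refine intervalIntegral.integral_congr fun s hs => ?_
    rw [uIcc_of_le ht] at hs
    simp only [displ_congr hV ht, displ_congr hV hs.1]
  rw [residualA, residualA, h1, h2, displ_congr hV ht]

lemma residualB_congr (u₀ : ℝ → ℝ) {V V' β β' : ℝ → ℝ} (hV : ∀ t, 0 ≤ t → V t = V' t)
    (hβ : ∀ t, 0 ≤ t → β t = β' t) {t : ℝ} (ht : 0 ≤ t) :
    residualB u₀ V β t = residualB u₀ V' β' t := by
  have h1 : (∫ s in (0 : ℝ)..t, greenPrim (t - s) (displ V t - displ V s) * deriv β s) =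
      ∫ s in (0 : ℝ)..t, greenPrim (t - s) (displ V' t - displ V' s) * deriv β' s := by
    -- Agreement is known only for nonnegative times, so the derivatives are compared on the open
    -- interval, leaving out the endpoint 0.
    refine intervalIntegral.integral_congr_Ioo_of_le ht fun s hs => ?_
    have hd : deriv β s = deriv β' s := by
      refine Filter.EventuallyEq.deriv_eq ?_
      filter_upwards [Ioi_mem_nhds hs.1] with r hr using hβ r (le_of_lt hr)
    simp only [displ_congr hV ht, displ_congr hV hs.1.le, hd]
  have h2 : (∫ s in (0 : ℝ)..t, green (t - s) (displ V t - displ V s) * β s) =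
      ∫ s in (0 : ℝ)..t, green (t - s) (displ V' t - displ V' s) * β' s := by
    refine intervalIntegral.integral_congr fun s hs => ?_
    rw [uIcc_of_le ht] at hs
    simp only [displ_congr hV ht, displ_congr hV hs.1, hβ s hs.1]
  have h3 : (∫ s in (0 : ℝ)..t, iteratedDeriv 2 (green (t - s)) (displ V t - displ V s)) =
      ∫ s in (0 : ℝ)..t, iteratedDeriv 2 (green (t - s)) (displ V' t - displ V' s) := by
    refine intervalIntegral.integral_congr fun s hs => ?_
    rw [uIcc_of_le ht] at hs
    simp only [displ_congr hV ht, displ_congr hV hs.1]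
  rw [residualB, residualB, h1, h2, h3, displ_congr hV ht, hβ t ht, hβ 0 le_rfl, hV t ht]

lemma isBigO_rpow_quarter_iff (f : ℝ → ℝ) (N : ℕ) :
    (f =O[𝓝[>] 0] fun t : ℝ => t ^ ((N : ℝ) / 4)) ↔
      (fun τ => f (τ ^ 4)) =O[𝓝[>] 0] fun τ : ℝ => τ ^ N := by
  constructor
  · intro h
    have ht : Tendsto (fun τ : ℝ => τ ^ 4) (𝓝[>] 0) (𝓝[>] 0) := by
      refine tendsto_nhdsWithin_iff.2 ⟨?_, ?_⟩
      · have : Tendsto (fun τ : ℝ => τ ^ 4) (𝓝 0) (𝓝 (0 ^ 4)) := (continuous_pow 4).tendsto 0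
        rw [zero_pow (by norm_num)] at this
        exact this.mono_left nhdsWithin_le_nhds
      · filter_upwards [self_mem_nhdsWithin] with τ hτ using pow_pos (mem_Ioi.1 hτ) 4
    refine (h.comp_tendsto ht).congr' EventuallyEq.rfl ?_
    filter_upwards [self_mem_nhdsWithin] with τ hτ
    have hτ' : 0 ≤ τ := le_of_lt hτ
    simp only [Function.comp]
    rw [← rpow_quarter_pow (by positivity), pow_four_rpow_quarter hτ']
  · intro h
    have ht : Tendsto (fun t : ℝ => t ^ (1 / 4 : ℝ)) (𝓝[>] 0) (𝓝[>] 0) := by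
      refine tendsto_nhdsWithin_iff.2 ⟨?_, ?_⟩
      · have : Tendsto (fun t : ℝ => t ^ (1 / 4 : ℝ)) (𝓝 0) (𝓝 (0 ^ (1 / 4 : ℝ))) :=
          (Real.continuous_rpow_const (by norm_num)).tendsto 0
        rw [Real.zero_rpow (by norm_num)] at this
        exact this.mono_left nhdsWithin_le_nhds
      · filter_upwards [self_mem_nhdsWithin] with t ht using Real.rpow_pos_of_pos ht _
    refine (h.comp_tendsto ht).congr' ?_ ?_
    · filter_upwards [self_mem_nhdsWithin] with t ht
      have ht' : 0 ≤ t := le_of_lt ht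
      simp only [Function.comp]
      rw [rpow_quarter_pow ht']
      norm_num
    · filter_upwards [self_mem_nhdsWithin] with t ht
      exact rpow_quarter_pow (le_of_lt ht) N

lemma isBigO_pow_succ_iff (f : ℝ → ℝ) (N : ℕ) :
    ((fun τ => τ * f τ) =O[𝓝[>] 0] fun τ : ℝ => τ ^ (N + 1)) ↔
      f =O[𝓝[>] 0] fun τ : ℝ => τ ^ N := by
  constructor
  · intro h
    refine ((isBigO_refl (fun τ : ℝ => τ⁻¹) _).mul h).congr' ?_ ?_ <;>
    · filter_upwards [self_mem_nhdsWithin] with τ hτ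
      have : τ ≠ 0 := ne_of_gt hτ
      simp [field, pow_succ]
  · intro h
    exact ((isBigO_refl (fun τ : ℝ => τ) _).mul h).congr_right fun τ => (pow_succ' τ N).symm

/-- The polynomials `p`, `q` in `τ = t ^ (1/4)`, taken for `β` and `V`, satisfy the first equation
up to `O(τ ^ m)` and the second one up to `O(τ ^ (m - 1))`. -/
def SolvesTo (u₀ : ℝ → ℝ) (m : ℕ) (p q : ℝ[X]) : Prop :=
  (fun τ => residualA u₀ (fracPoly q) (fracPoly p) (τ ^ 4)) =O[𝓝[>] 0] (fun τ : ℝ => τ ^ m) ∧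
  (fun τ => τ * residualB u₀ (fracPoly q) (fracPoly p) (τ ^ 4)) =O[𝓝[>] 0] (fun τ : ℝ => τ ^ m)

lemma SolvesTo.mono {u₀ : ℝ → ℝ} {m n : ℕ} {p q : ℝ[X]} (h : SolvesTo u₀ n p q) (hmn : m ≤ n) :
    SolvesTo u₀ m p q :=
  ⟨h.1.trans (isBigO_pow_of_le hmn), h.2.trans (isBigO_pow_of_le hmn)⟩

lemma isBigO_residualA_partialSum_iff (u₀ : ℝ → ℝ) (b v : ℕ → ℝ) (M N : ℕ) :
    (residualA u₀ (partialSum v M) (partialSum b M) =O[𝓝[>] 0] fun t : ℝ => t ^ ((N : ℝ) / 4)) ↔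
      (fun τ => residualA u₀ (fracPoly (truncPoly v M)) (fracPoly (truncPoly b M)) (τ ^ 4))
        =O[𝓝[>] 0] fun τ : ℝ => τ ^ N := by
  rw [isBigO_rpow_quarter_iff]
  simp only [fun τ : ℝ => residualA_congr u₀ (fun t => partialSum_eq_fracPoly v M)
    (fun t => partialSum_eq_fracPoly b M) (t := τ ^ 4) (by positivity)]

lemma isBigO_residualB_partialSum_iff (u₀ : ℝ → ℝ) (b v : ℕ → ℝ) (M N : ℕ) :
    (residualB u₀ (partialSum v M) (partialSum b M) =O[𝓝[>] 0] fun t : ℝ => t ^ ((N : ℝ) / 4)) ↔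
      (fun τ => τ * residualB u₀ (fracPoly (truncPoly v M)) (fracPoly (truncPoly b M)) (τ ^ 4))
        =O[𝓝[>] 0] fun τ : ℝ => τ ^ (N + 1) := by
  rw [isBigO_rpow_quarter_iff, ← isBigO_pow_succ_iff]
  simp only [fun τ : ℝ => residualB_congr u₀ (fun t => partialSum_eq_fracPoly v M)
    (fun t => partialSum_eq_fracPoly b M) (t := τ ^ 4) (by positivity)]

/-- The factor τ on the second residual shifts its order by one, which is immaterial once all orders
are required. -/
lemma isFormalSolution_iff (u₀ : ℝ → ℝ) (b v : ℕ → ℝ) :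
    IsFormalSolution u₀ b v ↔ (b 1 = 0 ∧ b 2 = 0 ∧ b 3 = 0) ∧
      ∀ n, ∀ᶠ M in atTop, SolvesTo u₀ n (truncPoly b M) (truncPoly v M) := by
  constructor
  · rintro ⟨h, hA, hB⟩
    refine ⟨h, fun n => ?_⟩
    filter_upwards [hA n, hB n] with M hA hB
    exact ⟨(isBigO_residualA_partialSum_iff u₀ b v M n).1 hA,
      ((isBigO_residualB_partialSum_iff u₀ b v M n).1 hB).trans (isBigO_pow_of_le n.le_succ)⟩
  · rintro ⟨h, hn⟩
    refine ⟨h, fun N => ?_, fun N => ?_⟩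
    · filter_upwards [hn N] with M hM using (isBigO_residualA_partialSum_iff u₀ b v M N).2 hM.1
    · filter_upwards [hn (N + 1)] with M hM using
        (isBigO_residualB_partialSum_iff u₀ b v M N).2 hM.2

/-- The conditions on the initial datum: smooth, tempered, and with Taylor coefficients
`0, c ≠ 0, -1/4, 0` at the contact point. -/
structure IsAdmissible (u₀ : ℝ → ℝ) : Prop where
  smooth : ContDiffOn ℝ ∞ u₀ (Ici 0)
  tempered : ∃ K : ℕ, IntegrableOn (fun x : ℝ => u₀ x / (1 + x) ^ K) (Ioi 0)
  zero : halfTaylor u₀ 0 = 0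
  one : halfTaylor u₀ 1 ≠ 0
  two : halfTaylor u₀ 2 = -1 / 4
  three : halfTaylor u₀ 3 = 0

/-- `p` has no terms of degrees `1, 2, 3`. -/
def HasGap (p : ℝ[X]) : Prop := p.coeff 1 = 0 ∧ p.coeff 2 = 0 ∧ p.coeff 3 = 0

lemma coeff_eq_of_X_pow_dvd_sub {p p' : ℝ[X]} {m d : ℕ} (h : X ^ m ∣ p' - p) (hd : d < m) :
    p'.coeff d = p.coeff d := by
  have := X_pow_dvd_iff.1 h d hd
  rwa [coeff_sub, sub_eq_zero] at this

lemma HasGap.congr {p p' : ℝ[X]} (hp : HasGap p) {n : ℕ} (h : X ^ (n + 4) ∣ p' - p) :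
    HasGap p' :=
  ⟨(coeff_eq_of_X_pow_dvd_sub h (by lia)).trans hp.1,
    (coeff_eq_of_X_pow_dvd_sub h (by lia)).trans hp.2.1,
    (coeff_eq_of_X_pow_dvd_sub h (by lia)).trans hp.2.2⟩

variable {u₀ : ℝ → ℝ} {p q p' q' : ℝ[X]}

lemma solvesTo_iff (hu : IsAdmissible u₀) (hp : HasGap p) {m n : ℕ} (hm : m ≤ n + 1) :
    SolvesTo u₀ m p q ↔ X ^ m ∣ polyA u₀ p q (n + 1) ∧ X ^ m ∣ polyB u₀ p q (n + 1) := by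
  obtain ⟨K₀, hK₀⟩ := hu.tempered
  exact and_congr ((eqMod_residualA hu.smooth hK₀ p q n).isBigO_iff hm)
    ((eqMod_residualB hu.smooth hK₀ q hp.1 hp.2.1 hp.2.2 n).isBigO_iff hm)

lemma solvesTo_five_iff (hu : IsAdmissible u₀) (hp : HasGap p) :
    SolvesTo u₀ 5 p q ↔
      p.coeff 0 = halfTaylor u₀ 1 ∧ halfTaylor u₀ 1 * q.coeff 0 = 24 * halfTaylor u₀ 4 := by
  rw [solvesTo_iff hu hp (n := 4) le_rfl,
    X_pow_five_dvd_polyA_iff hu.zero hu.three hp.1 hp.2.1 hp.2.2 q le_rfl]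
  exact ⟨fun h => h.1, fun h => ⟨h, polyB_congX hu.zero hu.two hu.three hp.1 hp.2.1 hp.2.2 h.1 h.2
    le_rfl⟩⟩

/-- Coefficients of degree at least n + 4 in p and n + 1 in q cannot influence orders below n + 5,
so later corrections and longer truncations preserve what is already solved. -/
lemma SolvesTo.congr (hu : IsAdmissible u₀) (hp : HasGap p) (hp0 : p.coeff 0 = halfTaylor u₀ 1)
    {n : ℕ} (hpp : X ^ (n + 4) ∣ p' - p) (hqq : X ^ (n + 1) ∣ q' - q)
    (h : SolvesTo u₀ (n + 5) p q) : SolvesTo u₀ (n + 5) p' q' := by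
  rw [solvesTo_iff hu hp (n := n + 4) le_rfl] at h
  rw [solvesTo_iff hu (hp.congr hpp) (n := n + 4) le_rfl]
  exact ⟨(dvd_iff_dvd_of_dvd_sub (lead_polyA_sub hu.zero (by lia) hpp hqq).1).2 h.1,
    (dvd_iff_dvd_of_dvd_sub (lead_polyB_sub hu.zero (by lia) hpp hqq hp0).1).2 h.2⟩

lemma SolvesTo.exists_succ (hu : IsAdmissible u₀) (hp : HasGap p)
    (hp0 : p.coeff 0 = halfTaylor u₀ 1) {n : ℕ} (h : SolvesTo u₀ (n + 5) p q) :
    ∃ p' q' : ℝ[X], X ^ (n + 4) ∣ p' - p ∧ X ^ (n + 1) ∣ q' - q ∧ SolvesTo u₀ (n + 6) p' q' := by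
  -- The expansions are taken modulo τ^(n+6), one order beyond the assumption, so that their
  -- coefficients at n + 5 are the true obstruction to be removed.
  rw [solvesTo_iff hu hp (n := n + 5) (by lia)] at h
  have hD := system_det_ne_zero hu.one n
  set a := (polyA u₀ p q (n + 6)).coeff (n + 5)
  set b := (polyB u₀ p q (n + 6)).coeff (n + 5)
  set D := 8 / 3 * profileS 0 * iterDerivS 2 profileS 0 * betaQuarter (n + 4) * halfTaylor u₀ 1 +
    2 * halfTaylor u₀ 1 / ((n : ℝ) + 5) with hDdef
  -- Solution of the 2×2 system: c is eliminated through the second equation, and the coefficient of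
  -- d left in the first is `D`.
  set d := (a + iterDerivS 2 profileS 0 * betaQuarter (n + 4) * b) / D with hd
  set c := 8 / 3 * profileS 0 * halfTaylor u₀ 1 * d - b with hc
  have hdD : d * D = a + iterDerivS 2 profileS 0 * betaQuarter (n + 4) * b := div_mul_cancel₀ _ hD
  have hpp : X ^ (n + 4) ∣ (p + C c * X ^ (n + 4)) - p := ⟨C c, by ring⟩
  have hqq : X ^ (n + 1) ∣ (q + C d * X ^ (n + 1)) - q := ⟨C d, by ring⟩
  refine ⟨_, _, hpp, hqq, ?_⟩
  rw [solvesTo_iff hu (hp.congr hpp) (n := n + 5) le_rfl]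
  have hA := (Lead.of_dvd h.1).add (lead_polyA_sub (K := n + 6) hu.zero (by lia) hpp hqq)
  have hB := (Lead.of_dvd h.2).add (lead_polyB_sub (K := n + 6) hu.zero (by lia) hpp hqq hp0)
  simp only [add_sub_cancel, add_sub_cancel_left, coeff_C_mul, coeff_X_pow, if_true,
    mul_one] at hA hB
  constructor
  · refine Lead.dvd_succ ?_
    convert hA using 1
    have : (polyA u₀ p q (n + 5 + 1)).coeff (n + 5) = a := rfl
    rw [this]
    have hn : (n : ℝ) + 5 ≠ 0 := by positivity
    have hdD' : a = d * D - iterDerivS 2 profileS 0 * betaQuarter (n + 4) * b := by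
      rw [hdD]; ring
    rw [hdD', hDdef, hc]
    field_simp
    ring
  · refine Lead.dvd_succ ?_
    convert hB using 1
    have : (polyB u₀ p q (n + 5 + 1)).coeff (n + 5) = b := rfl
    rw [this, hc]
    ring

/-- The next coefficients of the differences satisfy the homogeneous version of the same system,
hence vanish. -/
lemma SolvesTo.dvd_sub_succ (hu : IsAdmissible u₀) (hp : HasGap p)
    (hp0 : p.coeff 0 = halfTaylor u₀ 1) {n : ℕ} (hpp : X ^ (n + 4) ∣ p' - p)
    (hqq : X ^ (n + 1) ∣ q' - q) (h : SolvesTo u₀ (n + 6) p q) (h' : SolvesTo u₀ (n + 6) p' q') :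
    X ^ (n + 5) ∣ p' - p ∧ X ^ (n + 2) ∣ q' - q := by
  rw [solvesTo_iff hu hp (n := n + 5) le_rfl] at h
  rw [solvesTo_iff hu (hp.congr hpp) (n := n + 5) le_rfl] at h'
  have hA := (lead_polyA_sub (K := n + 6) hu.zero (by lia) hpp hqq).2
  have hB := (lead_polyB_sub (K := n + 6) hu.zero (by lia) hpp hqq hp0).2
  rw [X_pow_dvd_iff.1 (dvd_sub h'.1 h.1) _ (by lia)] at hA
  rw [X_pow_dvd_iff.1 (dvd_sub h'.2 h.2) _ (by lia)] at hB
  have hD := system_det_ne_zero hu.one n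
  have hc : (p' - p).coeff (n + 4) = 8 / 3 * profileS 0 * halfTaylor u₀ 1 * (q' - q).coeff (n + 1) := by
    linarith
  rw [hc] at hA
  have hn : (n : ℝ) + 5 ≠ 0 := by positivity
  have hd : (q' - q).coeff (n + 1) = 0 := by
    refine (mul_eq_zero.1 ?_).resolve_left hD
    rw [← neg_eq_zero]
    refine Eq.trans ?_ hA.symm
    field_simp
    ring
  rw [hd, mul_zero] at hc
  exact ⟨Lead.dvd_succ ⟨hpp, hc⟩, Lead.dvd_succ ⟨hqq, hd⟩⟩

lemma exists_isFormalSolution (hu : IsAdmissible u₀) : ∃ b v, IsFormalSolution u₀ b v := by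
  let S : ℕ → ℝ[X] × ℝ[X] → Prop := fun n s =>
    HasGap s.1 ∧ s.1.coeff 0 = halfTaylor u₀ 1 ∧ SolvesTo u₀ (n + 5) s.1 s.2
  have step : ∀ n (s : {s // S n s}), ∃ s' : {s // S (n + 1) s},
      X ^ (n + 4) ∣ s'.1.1 - s.1.1 ∧ X ^ (n + 1) ∣ s'.1.2 - s.1.2 := by
    rintro n ⟨s, hs⟩
    obtain ⟨p', q', hp', hq', h'⟩ := hs.2.2.exists_succ hu hs.1 hs.2.1
    exact ⟨⟨(p', q'), hs.1.congr hp',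
      (coeff_eq_of_X_pow_dvd_sub hp' (by lia)).trans hs.2.1, h'⟩, hp', hq'⟩
  have base : S 0 (C (halfTaylor u₀ 1), C (24 * halfTaylor u₀ 4 / halfTaylor u₀ 1)) := by
    have hg : HasGap (C (halfTaylor u₀ 1)) := by simp [HasGap]
    refine ⟨hg, coeff_C_zero, (solvesTo_five_iff hu hg).2 ⟨coeff_C_zero, ?_⟩⟩
    rw [coeff_C_zero, mul_div_cancel₀ _ hu.one]
  choose f hf using step
  -- Successive pairs agree up to increasing degrees, so they converge coefficientwise, and the
  -- diagonal coefficients form the solution.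
  let s : ∀ n, {s // S n s} := fun n => Nat.rec (motive := fun n => {s // S n s}) ⟨_, base⟩ f n
  have hs : ∀ n, X ^ (n + 4) ∣ (s (n + 1)).1.1 - (s n).1.1 ∧
      X ^ (n + 1) ∣ (s (n + 1)).1.2 - (s n).1.2 := fun n => hf n (s n)
  have hle : ∀ n m, n ≤ m → X ^ (n + 4) ∣ (s m).1.1 - (s n).1.1 ∧
      X ^ (n + 1) ∣ (s m).1.2 - (s n).1.2 := by
    intro n m hnm
    induction m, hnm using Nat.le_induction with
    | base => simp
    | succ m hnm ih =>
      have h1 := dvd_add ((pow_dvd_pow X (by lia)).trans (hs m).1) ih.1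
      have h2 := dvd_add ((pow_dvd_pow X (by lia)).trans (hs m).2) ih.2
      rw [sub_add_sub_cancel] at h1 h2
      exact ⟨h1, h2⟩
  have hb : ∀ n d, d < n + 4 → (s d).1.1.coeff d = (s n).1.1.coeff d := by
    intro n d hd
    rcases le_total n d with h | h
    · exact coeff_eq_of_X_pow_dvd_sub (hle n d h).1 hd
    · exact (coeff_eq_of_X_pow_dvd_sub (hle d n h).1 (by lia)).symm
  have hv : ∀ n d, d < n + 1 → (s d).1.2.coeff d = (s n).1.2.coeff d := by
    intro n d hd
    exact (coeff_eq_of_X_pow_dvd_sub (hle d n (by lia)).2 (by lia)).symm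
  refine ⟨fun d => (s d).1.1.coeff d, fun d => (s d).1.2.coeff d,
    (isFormalSolution_iff _ _ _).2 ⟨⟨(s 1).2.1.1, (s 2).2.1.2.1, (s 3).2.1.2.2⟩, fun n => ?_⟩⟩
  filter_upwards [eventually_ge_atTop (n + 4)] with M hM
  refine SolvesTo.mono (n := n + 5) (SolvesTo.congr hu (s n).2.1 (s n).2.2.1 ?_ ?_ (s n).2.2.2)
    (by lia)
  · refine X_pow_dvd_iff.2 fun d hd => ?_
    rw [coeff_sub, coeff_truncPoly _ (by lia), hb n d hd, sub_self]
  · refine X_pow_dvd_iff.2 fun d hd => ?_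
    rw [coeff_sub, coeff_truncPoly _ (by lia), hv n d hd, sub_self]

lemma HasGap.truncPoly {b : ℕ → ℝ} (h : b 1 = 0 ∧ b 2 = 0 ∧ b 3 = 0) {M : ℕ} (hM : 3 ≤ M) :
    HasGap (truncPoly b M) := by
  refine ⟨?_, ?_, ?_⟩ <;> rw [coeff_truncPoly _ (by lia)]
  exacts [h.1, h.2.1, h.2.2]

/-- A single sufficiently long truncation solving to order five already determines both constants.
-/
lemma IsFormalSolution.leading (hu : IsAdmissible u₀) {b v : ℕ → ℝ}
    (h : IsFormalSolution u₀ b v) :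
    b 0 = halfTaylor u₀ 1 ∧ v 0 = 24 * halfTaylor u₀ 4 / halfTaylor u₀ 1 := by
  obtain ⟨hg, hn⟩ := (isFormalSolution_iff _ _ _).1 h
  obtain ⟨M, hM, hM3⟩ := ((hn 5).and (eventually_ge_atTop 3)).exists
  rw [solvesTo_five_iff hu (HasGap.truncPoly hg hM3), coeff_truncPoly _ M.zero_le,
    coeff_truncPoly _ M.zero_le] at hM
  exact ⟨hM.1, by rw [← hM.2, mul_div_cancel_left₀ _ hu.one]⟩

lemma IsFormalSolution.unique (hu : IsAdmissible u₀) {b v b' v' : ℕ → ℝ}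
    (h : IsFormalSolution u₀ b v) (h' : IsFormalSolution u₀ b' v') : b' = b ∧ v' = v := by
  obtain ⟨hb0, hv0⟩ := h.leading hu
  obtain ⟨hb0', hv0'⟩ := h'.leading hu
  obtain ⟨hg, hn⟩ := (isFormalSolution_iff _ _ _).1 h
  obtain ⟨hg', hn'⟩ := (isFormalSolution_iff _ _ _).1 h'
  -- The index offset matches the recursion: the coefficient of order n + 4 in β is determined
  -- together with that of order n + 1 in V. The base case uses the gap for b and the leading values
  -- for both.
  have key : ∀ n, (∀ d < n + 4, b' d = b d) ∧ ∀ d < n + 1, v' d = v d := by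
    intro n
    induction n with
    | zero =>
      refine ⟨fun d hd => ?_, fun d hd => ?_⟩
      · interval_cases d
        exacts [hb0'.trans hb0.symm, hg'.1.trans hg.1.symm, hg'.2.1.trans hg.2.1.symm,
          hg'.2.2.trans hg.2.2.symm]
      · obtain rfl : d = 0 := by lia
        rw [hv0, hv0']
    | succ n ih =>
      obtain ⟨M, hM, hM', hMn⟩ :=
        ((hn (n + 6)).and ((hn' (n + 6)).and (eventually_ge_atTop (n + 5)))).exists
      have hpp : X ^ (n + 4) ∣ ThinFilm.truncPoly b' M - ThinFilm.truncPoly b M :=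
        X_pow_dvd_iff.2 fun d hd => by
          rw [coeff_sub, coeff_truncPoly _ (by lia), coeff_truncPoly _ (by lia), ih.1 d hd, sub_self]
      have hqq : X ^ (n + 1) ∣ ThinFilm.truncPoly v' M - ThinFilm.truncPoly v M :=
        X_pow_dvd_iff.2 fun d hd => by
          rw [coeff_sub, coeff_truncPoly _ (by lia), coeff_truncPoly _ (by lia), ih.2 d hd, sub_self]
      obtain ⟨hp, hq⟩ := SolvesTo.dvd_sub_succ hu (HasGap.truncPoly hg (by lia))
        (by rw [coeff_truncPoly _ M.zero_le, hb0]) hpp hqq hM hM'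
      refine ⟨fun d hd => ?_, fun d hd => ?_⟩
      · have := coeff_eq_of_X_pow_dvd_sub hp (d := d) (by lia)
        rwa [coeff_truncPoly _ (by lia), coeff_truncPoly _ (by lia)] at this
      · have := coeff_eq_of_X_pow_dvd_sub hq (d := d) (by lia)
        rwa [coeff_truncPoly _ (by lia), coeff_truncPoly _ (by lia)] at this
  exact ⟨funext fun d => (key d).1 d (by lia), funext fun d => (key d).2 d (by lia)⟩

end ThinFilm

end

theorem theorem3 (u₀ : ℝ → ℝ)
    (hsmooth : ContDiffOn ℝ ∞ u₀ (Ici 0))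
    (htempered : ∃ K : ℕ, IntegrableOn (fun x : ℝ => u₀ x / (1 + x) ^ K) (Ioi 0))
    (h0 : u₀ 0 = 0)
    (h1 : iteratedDerivWithin 1 u₀ (Ici 0) 0 ≠ 0)
    (h2 : iteratedDerivWithin 2 u₀ (Ici 0) 0 = -1 / 2)
    (h3 : iteratedDerivWithin 3 u₀ (Ici 0) 0 = 0) :
    (∃ b v : ℕ → ℝ, ThinFilm.IsFormalSolution u₀ b v ∧
      b 0 = iteratedDerivWithin 1 u₀ (Ici 0) 0 ∧
      v 0 = iteratedDerivWithin 4 u₀ (Ici 0) 0 / iteratedDerivWithin 1 u₀ (Ici 0) 0 ∧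
      ∀ b' v' : ℕ → ℝ, ThinFilm.IsFormalSolution u₀ b' v' → b' = b ∧ v' = v) ∧
    (∀ n : ℕ,
      ThinFilm.constC n =
        -(4 * ((n : ℝ) + 1) / 3) * ThinFilm.profile 0 * iteratedDeriv 2 ThinFilm.profile 0
          * (∫ x in (0 : ℝ)..1, (1 - x) ^ ((n : ℝ) / 4) / x ^ ((3 : ℝ) / 4)) ∧
      ThinFilm.constC n ≠ 1) := by
  have e1 : ThinFilm.halfTaylor u₀ 1 = iteratedDerivWithin 1 u₀ (Ici 0) 0 := by
    rw [ThinFilm.halfTaylor, Nat.factorial_one, Nat.cast_one, div_one]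
  have e4 : 24 * ThinFilm.halfTaylor u₀ 4 = iteratedDerivWithin 4 u₀ (Ici 0) 0 := by
    rw [ThinFilm.halfTaylor, show Nat.factorial 4 = 24 from rfl, Nat.cast_ofNat]
    ring
  have hu : ThinFilm.IsAdmissible u₀ :=
    { smooth := hsmooth
      tempered := htempered
      zero := by rw [ThinFilm.halfTaylor, iteratedDerivWithin_zero, h0, zero_div]
      one := e1 ▸ h1
      two := by rw [ThinFilm.halfTaylor, h2, Nat.factorial_two]; norm_num
      three := by rw [ThinFilm.halfTaylor, h3, zero_div] }
  refine ⟨?_, fun n => ⟨?_, ThinFilm.constC_ne_one n⟩⟩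
  · obtain ⟨b, v, h⟩ := ThinFilm.exists_isFormalSolution hu
    obtain ⟨hb, hv⟩ := h.leading hu
    exact ⟨b, v, h, hb.trans e1, by rw [hv, e4, e1], fun b' v' h' => h.unique hu h'⟩
  · rw [ThinFilm.constC_eq_profileS, ThinFilm.profile_eq_profileS, ThinFilm.betaQuarter]
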